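/- Let $R=\mathbb{Z}[a^{\pm1},b^{\pm1},c^{\pm1}]$, and let $B_n$ be the braid group on $n$ strands with Artin generators $s_1,\dots,s_{n-1}$. Let $\mathrm{Q}_n$ be the quotient of the group algebra $RB_n$ by the relations $(s_i-a)(s_i-b)(s_i-c)=0$ for $1\le i\le n-1$ and, if $n\ge 3$, the relation $$ \begin{aligned} s_1^{-1}s_2s_1 ={}& s_1s_2s_1^{-1}-a^{-1}s_1s_2+a\,s_1s_2^{-1}+a\,s_1^{-1}s_2-a^3s_1^{-1}s_2^{-1}+a^{-1}s_2s_1-a\,s_2s_1^{-1}\\ &-a\,s_2^{-1}s_1+a^3s_2^{-1}s_1^{-1}+a^2s_1^{-1}s_2^{-1}s_1-a^2s_1s_2^{-1}s_1^{-1}. \end{aligned} $$ For $n\ge 1$, inside $\mathrm{Q}_{n+1}$ write again $\mathrm{Q}_n$ for the image of the natural morphism $\mathrm{Q}_n\to\mathrm{Q}_{n+1}$, $s_i\mapsto s_i$, and put $u_n=R+Rs_n+Rs_n^2$. Let $$\mathrm{Q}_{n+1}^{(k)}=\mathrm{Q}_nu_n\mathrm{Q}_nu_n\cdots u_n\mathrm{Q}_n\qquad(k+1\text{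 factors }\mathrm{Q}_n,\ k\text{ factors }u_n),$$ where a product of $R$-submodules of $\mathrm{Q}_{n+1}$ denotes the $R$-span of the products of their elements. **Theorem.** $\mathrm{Q}_5$ is a finitely generated $R$-module, and $\mathrm{Q}_5=\mathrm{Q}_5^{(3)}=\mathrm{Q}_4u_4\mathrm{Q}_4u_4\mathrm{Q}_4u_4\mathrm{Q}_4$. -/

import Mathlib

noncomputable section

namespace CubicQuotient

/-- The Laurent polynomial ring `R = ℤ[a^{±1}, b^{±1}, c^{±1}]`, as the group ring of `ℤ³`. -/
abbrev R : Type := AddMonoidAlgebra ℤ (Fin 3 →₀ ℤ)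

/-- The three variables of `R`, as units. -/
def var (i : Fin 3) : Rˣ :=
  Units.map (AddMonoidAlgebra.of ℤ (Fin 3 →₀ ℤ))
    (toUnits (Multiplicative.ofAdd (Finsupp.single i (1 : ℤ))))

def a : Rˣ := var 0

def b : Rˣ := var 1

def c : Rˣ := var 2

/-- Indices of the Artin generators `s_1, …, s_{n-1}` of the braid group on `n` strands. -/
abbrev Index (n : ℕ) : Type := {i : ℕ // 1 ≤ i ∧ i < n}

/-- Artin's relations: `s_i s_{i+1} s_i = s_{i+1} s_i s_{i+1}`, and `s_i s_j = s_j s_i` for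
`|i - j| ≥ 2`. -/
inductive ArtinRel (n : ℕ) : FreeGroup (Index n) → Prop
  | braid (i j : Index n) (h : i.1 + 1 = j.1) :
      ArtinRel n (FreeGroup.of i * FreeGroup.of j * FreeGroup.of i *
        (FreeGroup.of j * FreeGroup.of i * FreeGroup.of j)⁻¹)
  | comm (i j : Index n) (h : i.1 + 2 ≤ j.1) :
      ArtinRel n (FreeGroup.of i * FreeGroup.of j * (FreeGroup.of j * FreeGroup.of i)⁻¹)

/-- The braid group `B_n` on `n` strands. -/
abbrev BraidGroup (n : ℕ) : Type := PresentedGroup {r | ArtinRel n r}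

/-- The Artin generator `s_i` of `B_n`. -/
def artin {n : ℕ} (i : Index n) : BraidGroup n := PresentedGroup.of i

/-- The group algebra `R B_n`. -/
abbrev BraidAlgebra (n : ℕ) : Type := MonoidAlgebra R (BraidGroup n)

/-- A braid, as an element of `R B_n`. -/
def br {n : ℕ} (g : BraidGroup n) : BraidAlgebra n := MonoidAlgebra.of R (BraidGroup n) g

/-- The defining relations of `Q_n` in `R B_n`: the cubic relation
`(s_i - a)(s_i - b)(s_i - c) = 0` for all `i` and, if `n ≥ 3`, the relation expressing
`s_1⁻¹ s_2 s_1`. -/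
inductive QRel (n : ℕ) : BraidAlgebra n → BraidAlgebra n → Prop
  | cubic (i : Index n) :
      QRel n
        ((br (artin i) - algebraMap R (BraidAlgebra n) a) *
          (br (artin i) - algebraMap R (BraidAlgebra n) b) *
          (br (artin i) - algebraMap R (BraidAlgebra n) c)) 0
  | skein (s₁ s₂ : BraidGroup n) (h₁ : ∃ h, s₁ = artin ⟨1, h⟩) (h₂ : ∃ h, s₂ = artin ⟨2, h⟩) :
      QRel n
        (br (s₁⁻¹ * s₂ * s₁))
        (br (s₁ * s₂ * s₁⁻¹)
          - ((a⁻¹ : Rˣ) : R) • br (s₁ * s₂)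
          + (a : R) • br (s₁ * s₂⁻¹)
          + (a : R) • br (s₁⁻¹ * s₂)
          - (a : R) ^ 3 • br (s₁⁻¹ * s₂⁻¹)
          + ((a⁻¹ : Rˣ) : R) • br (s₂ * s₁)
          - (a : R) • br (s₂ * s₁⁻¹)
          - (a : R) • br (s₂⁻¹ * s₁)
          + (a : R) ^ 3 • br (s₂⁻¹ * s₁⁻¹)
          + (a : R) ^ 2 • br (s₁⁻¹ * s₂⁻¹ * s₁)
          - (a : R) ^ 2 • br (s₁ * s₂⁻¹ * s₁⁻¹))

/-- The `R`-algebra `Q_n`: the quotient of `R B_n` by the two-sided ideal generated by the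
defining relations. -/
abbrev Q (n : ℕ) : Type := RingQuot (QRel n)

/-- The quotient map `R B_n → Q_n`. -/
def toQ (n : ℕ) : BraidAlgebra n →ₐ[R] Q n := RingQuot.mkAlgHom R (QRel n)

/-- The image of the Artin generator `s_i` in `Q_n`. -/
def s {n : ℕ} (i : Index n) : Q n := toQ n (br (artin i))

/-- `B_n → B_{n+1}`, `s_i ↦ s_i` (adding a strand on the right). -/
def braidIncl (n : ℕ) : BraidGroup n →* BraidGroup (n + 1) :=
  PresentedGroup.toGroup (f := fun i => artin ⟨i.1, i.2.1, Nat.lt_succ_of_lt i.2.2⟩) (by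
    rintro r (⟨i, j, h⟩ | ⟨i, j, h⟩)
    · simpa [artin, PresentedGroup.of] using
        PresentedGroup.one_of_mem (rels := {r | ArtinRel (n + 1) r})
          (ArtinRel.braid ⟨i.1, i.2.1, Nat.lt_succ_of_lt i.2.2⟩
            ⟨j.1, j.2.1, Nat.lt_succ_of_lt j.2.2⟩ h)
    · simpa [artin, PresentedGroup.of] using
        PresentedGroup.one_of_mem (rels := {r | ArtinRel (n + 1) r})
          (ArtinRel.comm ⟨i.1, i.2.1, Nat.lt_succ_of_lt i.2.2⟩
            ⟨j.1, j.2.1, Nat.lt_succ_of_lt j.2.2⟩ h))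

theorem braidIncl_artin {n : ℕ} (i : Index n) :
    braidIncl n (artin i) = artin ⟨i.1, i.2.1, Nat.lt_succ_of_lt i.2.2⟩ := by
  simp [braidIncl, artin]

/-- `R B_n → R B_{n+1}`. -/
def braidAlgebraIncl (n : ℕ) : BraidAlgebra n →ₐ[R] BraidAlgebra (n + 1) :=
  MonoidAlgebra.mapDomainAlgHom R R (braidIncl n)

theorem braidAlgebraIncl_br {n : ℕ} (g : BraidGroup n) :
    braidAlgebraIncl n (br g) = br (braidIncl n g) := by
  simp [braidAlgebraIncl, br]

theorem braidAlgebraIncl_rel {n : ℕ} {x y : BraidAlgebra n} (h : QRel n x y) :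
    QRel (n + 1) (braidAlgebraIncl n x) (braidAlgebraIncl n y) := by
  cases h with
  | cubic i =>
    simp only [map_mul, map_sub, map_zero, AlgHom.commutes, braidAlgebraIncl_br, braidIncl_artin]
    exact QRel.cubic _
  | skein s₁ s₂ h₁ h₂ =>
    simp only [map_mul, map_sub, map_add, map_smul, map_inv, braidAlgebraIncl_br]
    refine QRel.skein _ _ ?_ ?_
    · obtain ⟨h, rfl⟩ := h₁
      exact ⟨_, braidIncl_artin _⟩
    · obtain ⟨h, rfl⟩ := h₂
      exact ⟨_, braidIncl_artin _⟩

/-- The natural morphism `Q_n → Q_{n+1}`, `s_i ↦ s_i`. -/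
def incl (n : ℕ) : Q n →ₐ[R] Q (n + 1) :=
  RingQuot.liftAlgHom R ⟨(toQ (n + 1)).comp (braidAlgebraIncl n), fun _ _ h =>
    RingQuot.mkAlgHom_rel R (braidAlgebraIncl_rel h)⟩

theorem incl_s {n : ℕ} (i : Index n) :
    incl n (s i) = s ⟨i.1, i.2.1, Nat.lt_succ_of_lt i.2.2⟩ := by
  simp [incl, s, toQ, braidAlgebraIncl_br, braidIncl_artin]

/-- The image of `Q_n` in `Q_{n+1}`, as an `R`-submodule. -/
def sub (n : ℕ) : Submodule R (Q (n + 1)) := LinearMap.range (incl n).toLinearMap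

/-- `u_i = R + R s_i + R s_i²`. -/
def u {n : ℕ} (i : Index n) : Submodule R (Q n) := Submodule.span R {1, s i, s i ^ 2}

/-- `Q_{n+1}^{(k)} = Q_n u_n Q_n ⋯ u_n Q_n` with `k + 1` factors `Q_n` and `k` factors `u_n`.
Products are products of `R`-submodules of the algebra `Q_{n+1}`, i.e. `R`-spans of products. -/
def filt (n : ℕ) (hn : 1 ≤ n) : ℕ → Submodule R (Q (n + 1))
  | 0 => sub n
  | k + 1 => filt n hn k * u ⟨n, hn, Nat.lt_succ_self n⟩ * sub n

end CubicQuotient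

end

/-! Write `r`, `s`, `t`, `w` for the four generators, regarded as units of an arbitrary algebra
satisfying the relations, and let A₃ = ⟨r, s⟩ and A₄ = ⟨r, s, t⟩. The argument finds successive
normal forms for ⟨s, t⟩, A₄ and the whole algebra. Three symmetries let each case be proved once:
conjugation carries the skein relation to every adjacent pair (`conj`, `symm`, `shift`), inversion
of the generators preserves the relations with inverted parameters (`inv`), and so does reversal of
words, with the same parameters (`op`).

Three strands. Modulo N = u_s u_t u_s, the words κ = t s² t, t s⁻¹ t, t⁻¹ s t⁻¹ and κ⁻¹ are unit
multiples of one another, and multiplication by `s` on either side acts on them as the scalar `q`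
(`eigen_right`, `sq_word`, `inv_word`). Hence ⟨s, t⟩ = N + kκ. Later arguments constantly exchange
one of these words for another, choosing the one whose letters slide or cancel.

Four strands. The word ξ = t s r² s t commutes with A₃, and A₄ = A₃ u_t u_s u_t A₃ + A₃ ξ + A₃ ξ⁻¹
(`gen_le_D`).

Five strands. Words are filtered by their degree in `w`, with `B₁` and `B₂` the A₄-bimodules of
degrees one and two. Put π = w t² w and υ = w t s² t w. Then u_w A₄ π lies in `B₂`
(`U_mul_gen_mul_pi`), while u_w A₄ υ lies in O = B₂ + ω A₄ for a single word ω of degree three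
(`U_mul_gen_upsilon_mem_O`); moreover O is stable under A₄ on both sides (`mul_mem_O`). Let H be the
sum of O and its analogue for the inverse generators, and T the set of m with u_w A₄ m ⊆ H. The
four-strand normal form, applied to ⟨s, t, w⟩ and to A₄, gives u_w A₄ u_w ⊆ T
(`U_mul_gen_mul_U_le_T`). So H is stable under left multiplication by all generators, contains 1,
and is the whole algebra. Since H ⊆ B₂ u_w A₄, the filtration stops at degree three; finiteness
follows because A₄ and u_w are finitely generated modules. -/

namespace SkeinAlgebra

open Submodule

/-! ### Braid words, the cubic relation, and the symmetries of the skein relation. -/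

section Words

variable {G : Type*} [Group G] {r s t w : G}

theorem braid_conj (h : s * t * s = t * s * t) : s * t * s⁻¹ = t⁻¹ * s * t := by
  rw [mul_inv_eq_iff_eq_mul, mul_assoc, mul_assoc, eq_inv_mul_iff_mul_eq]
  simpa only [mul_assoc] using h.symm

theorem braid_inv (h : s * t * s = t * s * t) : s⁻¹ * t⁻¹ * s⁻¹ = t⁻¹ * s⁻¹ * t⁻¹ := by
  simpa only [mul_inv_rev, mul_assoc] using congrArg (·⁻¹) h

theorem braid_conj_inv (h : s * t * s = t * s * t) : s * t⁻¹ * s⁻¹ = t⁻¹ * s⁻¹ * t := by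
  simpa only [mul_inv_rev, inv_inv, mul_assoc] using congrArg (·⁻¹) (braid_conj h)

theorem braid_inv_conj (h : s * t * s = t * s * t) : s⁻¹ * t * s = t * s * t⁻¹ :=
  (braid_conj h.symm).symm

theorem braid_inv_conj_inv (h : s * t * s = t * s * t) : s⁻¹ * t⁻¹ * s = t * s⁻¹ * t⁻¹ :=
  (braid_conj_inv h.symm).symm

end Words

variable {k A : Type*} [CommRing k] [Ring A] [Algebra k A]

/-- The span of `1`, `s` and `s⁻¹`. -/
def U (k : Type*) {A : Type*} [CommRing k] [Ring A] [Algebra k A] (s : Aˣ) : Submodule k A :=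
  span k {1, (s : A), ((s⁻¹ : Aˣ) : A)}

theorem one_mem_U (s : Aˣ) : (1 : A) ∈ U k s := subset_span (by simp)

theorem mem_U (s : Aˣ) : (s : A) ∈ U k s := subset_span (by simp)

theorem inv_mem_U (s : Aˣ) : ((s⁻¹ : Aˣ) : A) ∈ U k s := subset_span (by simp)

theorem U_le {s : Aˣ} {N : Submodule k A} :
    U k s ≤ N ↔ (1 : A) ∈ N ∧ (s : A) ∈ N ∧ ((s⁻¹ : Aˣ) : A) ∈ N := by
  simp [U, span_le, Set.insert_subset_iff]

theorem U_inv (s : Aˣ) : U k s⁻¹ = U k s := by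
  apply le_antisymm <;> rw [U_le]
  · exact ⟨one_mem_U s, inv_mem_U s, by simpa using mem_U s⟩
  · exact ⟨one_mem_U _, by simpa using inv_mem_U (k := k) s⁻¹, mem_U _⟩

/-- The cubic relation `s² = e₁ s - e₂ + e s⁻¹`. -/
def Cubic (e : kˣ) (e₁ e₂ : k) (s : Aˣ) : Prop :=
  ((s * s : Aˣ) : A) = e₁ • (s : A) - e₂ • 1 + (e : k) • ((s⁻¹ : Aˣ) : A)

/-- Multiply the relation by `e⁻¹ s⁻¹`. The coefficients play the role of elementary symmetric
functions of the roots, and become those of the inverse roots. -/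
theorem Cubic.inv {e : kˣ} {e₁ e₂ : k} {s : Aˣ} (h : Cubic e e₁ e₂ s) :
    Cubic e⁻¹ (↑e⁻¹ * e₂) (↑e⁻¹ * e₁) s⁻¹ := by
  have h' := congrArg (fun x => (↑e⁻¹ : k) • (x * ((s⁻¹ : Aˣ) : A))) h
  simp only [add_mul, sub_mul, smul_mul_assoc, one_mul, ← Units.val_mul, mul_assoc,
    mul_inv_cancel, mul_one, smul_add, smul_sub, smul_smul, inv_mul_cancel, one_smul,
    Units.val_one] at h'
  simp only [Cubic, inv_inv]
  rw [h']
  abel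

theorem Cubic.U_mul_U {e : kˣ} {e₁ e₂ : k} {s : Aˣ} (h : Cubic e e₁ e₂ s) :
    U k s * U k s ≤ U k s := by
  have key : ∀ {e : kˣ} {e₁ e₂ : k} {s : Aˣ}, Cubic e e₁ e₂ s → (s : A) * s ∈ U k s := by
    intro e e₁ e₂ s h
    rw [← Units.val_mul, h]
    exact add_mem (sub_mem (smul_mem _ _ (mem_U s)) (smul_mem _ _ (one_mem_U s)))
      (smul_mem _ _ (inv_mem_U s))
  have h2 := key h.inv
  rw [U_inv] at h2
  rw [U, span_mul_span, span_le]
  rintro _ ⟨x, hx, y, hy, rfl⟩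
  change _ ∈ U k s
  simp only [Set.mem_insert_iff, Set.mem_singleton_iff] at hx hy
  rcases hx with rfl | rfl | rfl <;> rcases hy with rfl | rfl | rfl <;>
    simp [one_mem_U, mem_U, inv_mem_U, key h, h2]

theorem Cubic.mul_mem_U {e : kˣ} {e₁ e₂ : k} {s : Aˣ} (h : Cubic e e₁ e₂ s) {x y : A}
    (hx : x ∈ U k s) (hy : y ∈ U k s) : x * y ∈ U k s :=
  h.U_mul_U (mul_mem_mul hx hy)

theorem Cubic.zpow_mem_U {e : kˣ} {e₁ e₂ : k} {s : Aˣ} (h : Cubic e e₁ e₂ s) (n : ℤ) :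
    ((s ^ n : Aˣ) : A) ∈ U k s := by
  induction n with
  | zero => simpa using one_mem_U s
  | succ n ih => simpa [zpow_add] using h.mul_mem_U ih (mem_U s)
  | pred n ih =>
    rw [sub_eq_add_neg, zpow_add, zpow_neg_one, Units.val_mul]
    exact h.mul_mem_U ih (inv_mem_U s)

/-- Two units satisfying the braid relation, the cubic relation and the skein relation. -/
structure SkeinPair (q e : kˣ) (e₁ e₂ : k) (s t : Aˣ) : Prop where
  braid : s * t * s = t * s * t
  cubic_left : Cubic e e₁ e₂ s
  cubic_right : Cubic e e₁ e₂ t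
  skein : ((s⁻¹ * t * s : Aˣ) : A) =
    ((s * t * s⁻¹ : Aˣ) : A) - (↑q⁻¹ : k) • ((s * t : Aˣ) : A) + (q : k) • ((s * t⁻¹ : Aˣ) : A)
      + (q : k) • ((s⁻¹ * t : Aˣ) : A) - (q : k) ^ 3 • ((s⁻¹ * t⁻¹ : Aˣ) : A)
      + (↑q⁻¹ : k) • ((t * s : Aˣ) : A) - (q : k) • ((t * s⁻¹ : Aˣ) : A)
      - (q : k) • ((t⁻¹ * s : Aˣ) : A) + (q : k) ^ 3 • ((t⁻¹ * s⁻¹ : Aˣ) : A)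
      + (q : k) ^ 2 • ((s⁻¹ * t⁻¹ * s : Aˣ) : A) - (q : k) ^ 2 • ((s * t⁻¹ * s⁻¹ : Aˣ) : A)

namespace SkeinPair

variable {q e : kˣ} {e₁ e₂ : k} {s t : Aˣ}

theorem conj (h : SkeinPair q e e₁ e₂ s t) (g : Aˣ) :
    SkeinPair q e e₁ e₂ (g * s * g⁻¹) (g * t * g⁻¹) := by
  have cub : ∀ x : Aˣ, Cubic e e₁ e₂ x → Cubic e e₁ e₂ (g * x * g⁻¹) := by
    intro x hx
    have h' := congrArg (fun x => (g : A) * x * ((g⁻¹ : Aˣ) : A)) hx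
    simp only [mul_add, add_mul, mul_sub, sub_mul, mul_smul_comm, smul_mul_assoc, mul_one,
      ← Units.val_mul, mul_inv_cancel, Units.val_one] at h'
    simpa only [Cubic, mul_inv_rev, inv_inv, mul_assoc, inv_mul_cancel_left] using h'
  refine ⟨?_, cub _ h.cubic_left, cub _ h.cubic_right, ?_⟩
  · have := congrArg (fun x => g * x * g⁻¹) h.braid
    simpa [mul_assoc] using this
  · have h' := congrArg (fun x => (g : A) * x * ((g⁻¹ : Aˣ) : A)) h.skein
    simp only [mul_add, add_mul, mul_sub, sub_mul, mul_smul_comm, smul_mul_assoc,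
      ← Units.val_mul] at h'
    simpa only [mul_inv_rev, inv_inv, mul_assoc, inv_mul_cancel_left] using h'

/-- Conjugation by the half twist `s * t * s` exchanges the two generators. -/
theorem symm (h : SkeinPair q e e₁ e₂ s t) : SkeinPair q e e₁ e₂ t s := by
  have h1 : s * t * s * s * (s * t * s)⁻¹ = t := by
    rw [mul_inv_eq_iff_eq_mul]
    nth_rw 1 [h.braid]
    simp only [mul_assoc]
  have h2 : s * t * s * t * (s * t * s)⁻¹ = s := by
    rw [mul_inv_eq_iff_eq_mul]
    nth_rw 2 [h.braid]
    simp only [mul_assoc]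
  have := h.conj (s * t * s)
  rwa [h1, h2] at this

/-- After division by `q²`, the skein relation is a rearrangement of the same relation for `s⁻¹`,
`t⁻¹` and `q⁻¹`. -/
theorem inv (h : SkeinPair q e e₁ e₂ s t) :
    SkeinPair q⁻¹ e⁻¹ (↑e⁻¹ * e₂) (↑e⁻¹ * e₁) s⁻¹ t⁻¹ := by
  refine ⟨braid_inv h.braid, h.cubic_left.inv, h.cubic_right.inv, ?_⟩
  have h' := congrArg (fun x => (↑q⁻¹ : k) ^ 2 • x) h.skein
  have q1 : (↑q⁻¹ : k) ^ 2 * q = ↑q⁻¹ := by rw [pow_two, mul_assoc]; simp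
  have q3 : (↑q⁻¹ : k) ^ 2 * q ^ 3 = q := by
    rw [pow_succ (q : k) 2, ← mul_assoc, ← mul_pow]; simp
  have q2 : (↑q⁻¹ : k) ^ 2 * q ^ 2 = 1 := by rw [← mul_pow]; simp
  have q4 : (↑q⁻¹ : k) ^ 2 * ↑q⁻¹ = ↑q⁻¹ ^ 3 := by ring
  simp only [smul_add, smul_sub, smul_smul, q1, q2, q3, q4, one_smul] at h'
  simp only [inv_inv]
  have h'' := sub_eq_zero.2 h'
  rw [← sub_eq_zero]
  rw [← h'']
  abel

end SkeinPair

end SkeinAlgebra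

/-! ### Generated subalgebras, opposite rings, and the skein relation modulo `N`. -/

namespace SkeinAlgebra

open Submodule MulOpposite

variable {k A : Type*} [CommRing k] [Ring A] [Algebra k A]

/-- The subalgebra generated by a set of units and their inverses. -/
def gen (k : Type*) {A : Type*} [CommRing k] [Ring A] [Algebra k A] (S : Set Aˣ) :
    Subalgebra k A :=
  Algebra.adjoin k {x | ∃ g ∈ S, x = (g : A) ∨ x = ((g⁻¹ : Aˣ) : A)}

theorem gen_mono {S T : Set Aˣ} (h : S ⊆ T) : gen k S ≤ gen k T :=
  Algebra.adjoin_mono fun _ ⟨g, hg, hx⟩ => ⟨g, h hg, hx⟩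

theorem closure_le_gen {S : Set Aˣ} {g : Aˣ} (h : g ∈ Subgroup.closure S) :
    (g : A) ∈ gen k S := by
  suffices (g : A) ∈ gen k S ∧ ((g⁻¹ : Aˣ) : A) ∈ gen k S from this.1
  induction h using Subgroup.closure_induction with
  | mem x hx =>
    exact ⟨Algebra.subset_adjoin ⟨x, hx, Or.inl rfl⟩, Algebra.subset_adjoin ⟨x, hx, Or.inr rfl⟩⟩
  | one => simp [one_mem]
  | mul x y _ _ hx hy =>
    rw [mul_inv_rev, Units.val_mul, Units.val_mul]
    exact ⟨mul_mem hx.1 hy.1, mul_mem hy.2 hx.2⟩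
  | inv x _ hx => exact ⟨hx.2, by simpa using hx.1⟩

theorem mem_gen {S : Set Aˣ} {g : Aˣ} (h : g ∈ S) : (g : A) ∈ gen k S :=
  closure_le_gen (Subgroup.subset_closure h)

theorem inv_mem_gen {S : Set Aˣ} {g : Aˣ} (h : g ∈ S) : ((g⁻¹ : Aˣ) : A) ∈ gen k S :=
  closure_le_gen (inv_mem (Subgroup.subset_closure h))

theorem U_le_gen {S : Set Aˣ} {g : Aˣ} (h : g ∈ S) : U k g ≤ (gen k S).toSubmodule :=
  U_le.2 ⟨(gen k S).one_mem, mem_gen h, inv_mem_gen h⟩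

theorem mul_mem_of_left_stable {S : Set Aˣ} {N : Submodule k A}
    (h : ∀ g ∈ S, ∀ x ∈ N, (g : A) * x ∈ N ∧ ((g⁻¹ : Aˣ) : A) * x ∈ N) {x y : A}
    (hy : y ∈ gen k S) (hx : x ∈ N) : y * x ∈ N := by
  induction hy using Algebra.adjoin_induction generalizing x with
  | mem z hz =>
    obtain ⟨g, hg, rfl | rfl⟩ := hz
    exacts [(h g hg x hx).1, (h g hg x hx).2]
  | algebraMap c => rw [← Algebra.smul_def]; exact smul_mem _ _ hx
  | add y z _ _ hy hz => rw [add_mul]; exact add_mem (hy hx) (hz hx)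
  | mul y z _ _ hy hz => rw [mul_assoc]; exact hy (hz hx)

theorem mul_mem_of_right_stable {S : Set Aˣ} {N : Submodule k A}
    (h : ∀ g ∈ S, ∀ x ∈ N, x * (g : A) ∈ N ∧ x * ((g⁻¹ : Aˣ) : A) ∈ N) {x y : A}
    (hy : y ∈ gen k S) (hx : x ∈ N) : x * y ∈ N := by
  induction hy using Algebra.adjoin_induction generalizing x with
  | mem z hz =>
    obtain ⟨g, hg, rfl | rfl⟩ := hz
    exacts [(h g hg x hx).1, (h g hg x hx).2]
  | algebraMap c => rw [← Algebra.commutes, ← Algebra.smul_def]; exact smul_mem _ _ hx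
  | add y z _ _ hy hz => rw [mul_add]; exact add_mem (hy hx) (hz hx)
  | mul y z _ _ hy hz => rw [← mul_assoc]; exact hz (hy hx)

theorem commute_of_mem_gen {S : Set Aˣ} {z : Aˣ} (h : ∀ g ∈ S, g * z = z * g) {y : A}
    (hy : y ∈ gen k S) : y * z = z * y := by
  have : gen k S ≤ Subalgebra.centralizer k {(z : A)} := by
    refine Algebra.adjoin_le ?_
    rintro _ ⟨g, hg, rfl | rfl⟩
    · rw [SetLike.mem_coe, Subalgebra.mem_centralizer_iff]
      rintro _ rfl
      simpa using congrArg Units.val (h g hg).symm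
    · rw [SetLike.mem_coe, Subalgebra.mem_centralizer_iff]
      rintro _ rfl
      have := (Commute.inv_left (show Commute g z from h g hg)).eq
      simpa using congrArg Units.val this.symm
  exact ((Subalgebra.mem_centralizer_iff k).1 (this hy) z rfl).symm

theorem gen_inv_image (S : Set Aˣ) : gen k S⁻¹ = gen k S := by
  have : ∀ S : Set Aˣ, gen k S⁻¹ ≤ gen k S := by
    intro S
    refine Algebra.adjoin_le ?_
    rintro _ ⟨g, hg, rfl | rfl⟩
    · simpa using inv_mem_gen (k := k) (Set.mem_inv.1 hg)
    · exact mem_gen (Set.mem_inv.1 hg)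
  exact le_antisymm (this S) (by simpa using this S⁻¹)

/-- A unit, viewed in the opposite ring. -/
def opU (s : Aˣ) : Aᵐᵒᵖˣ := Units.opEquiv.symm (op s)

@[simp] theorem val_opU (s : Aˣ) : ((opU s : Aᵐᵒᵖˣ) : Aᵐᵒᵖ) = op (s : A) := rfl

theorem opU_mul (s t : Aˣ) : opU (s * t) = opU t * opU s := rfl

theorem opU_inv (s : Aˣ) : opU s⁻¹ = (opU s)⁻¹ := rfl

/-- A submodule, viewed in the opposite ring. -/
def opS (N : Submodule k A) : Submodule k Aᵐᵒᵖ :=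
  N.map (opLinearEquiv k : A ≃ₗ[k] Aᵐᵒᵖ).toLinearMap

theorem mem_opS {N : Submodule k A} {x : A} : op x ∈ opS N ↔ x ∈ N := by
  constructor
  · rintro ⟨y, hy, h⟩
    rwa [← op_injective h]
  · exact fun h => ⟨x, h, rfl⟩

theorem opS_mul (M N : Submodule k A) : opS (M * N) = opS N * opS M := map_op_mul M N

theorem opS_U (s : Aˣ) : opS (U k s) = U k (opU s) := by
  rw [opS, U, U, map_span]
  simp [Set.image_insert_eq, ← opU_inv]

theorem opS_gen (S : Set Aˣ) :
    opS (gen k S).toSubmodule = (gen k (opU '' S)).toSubmodule := by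
  ext x
  obtain ⟨x, rfl⟩ := op_surjective x
  have hS : {x : Aᵐᵒᵖ | ∃ g ∈ opU '' S, x = (g : Aᵐᵒᵖ) ∨ x = ((g⁻¹ : Aᵐᵒᵖˣ) : Aᵐᵒᵖ)} =
      MulOpposite.unop ⁻¹' {x | ∃ g ∈ S, x = (g : A) ∨ x = ((g⁻¹ : Aˣ) : A)} := by
    ext y
    simp [← opU_inv, ← MulOpposite.unop_inj]
  rw [mem_opS, Subalgebra.mem_toSubmodule, Subalgebra.mem_toSubmodule, gen, gen, hS,
    ← Subalgebra.op_adjoin]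
  rfl

/-- Reversing words turns the difference of the two sides of the skein relation into its negative.
-/
theorem SkeinPair.op {q e : kˣ} {e₁ e₂ : k} {s t : Aˣ} (h : SkeinPair q e e₁ e₂ s t) :
    SkeinPair q e e₁ e₂ (opU s) (opU t) := by
  have cub : ∀ x : Aˣ, Cubic e e₁ e₂ x → Cubic e e₁ e₂ (opU x) := by
    intro x hx
    simpa only [Cubic, ← opU_inv, ← opU_mul, val_opU, MulOpposite.op_add, MulOpposite.op_sub,
      MulOpposite.op_smul, MulOpposite.op_one] using congrArg MulOpposite.op hx
  refine ⟨?_, cub _ h.cubic_left, cub _ h.cubic_right, ?_⟩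
  · simp only [← opU_mul, ← mul_assoc, h.braid]
  · have h' := congrArg MulOpposite.op h.skein
    simp only [MulOpposite.op_add, MulOpposite.op_sub, MulOpposite.op_smul] at h'
    simp only [← opU_inv, ← opU_mul, val_opU, ← mul_assoc]
    rw [← sub_eq_zero] at h' ⊢
    rw [← neg_eq_zero, ← h']
    abel

/-- The span of the words `s^i t^j s^l`. -/
def N (k : Type*) {A : Type*} [CommRing k] [Ring A] [Algebra k A] (s t : Aˣ) : Submodule k A :=
  U k s * U k t * U k s

namespace SkeinPair

variable {q e : kˣ} {e₁ e₂ : k} {s t : Aˣ}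

theorem mem_N (h : SkeinPair q e e₁ e₂ s t) {g : Aˣ} (i j l : ℤ) (hg : g = s ^ i * t ^ j * s ^ l) :
    (g : A) ∈ N k s t := by
  rw [hg, Units.val_mul, Units.val_mul]
  exact mul_mem_mul (mul_mem_mul (h.cubic_left.zpow_mem_U i) (h.cubic_right.zpow_mem_U j))
    (h.cubic_left.zpow_mem_U l)

/-- Multiply the skein relation by `t` on the left: the braid relation puts every term on the right
in the form s^i t^j s^l, except `q • t s⁻¹ t`. This is the main use of the skein relation on three
strands. -/
theorem eigen_right (h : SkeinPair q e e₁ e₂ s t) :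
    ((t * s⁻¹ * t * s : Aˣ) : A) - (q : k) • ((t * s⁻¹ * t : Aˣ) : A) ∈ N k s t := by
  have b := h.braid
  have h' := congrArg (fun x => (t : A) * x) h.skein
  simp only [mul_add, mul_sub, mul_smul_comm, ← Units.val_mul] at h'
  have h1 := h.mem_N (g := t * (s * t * s⁻¹)) 1 1 0 (by
    rw [← mul_assoc, ← mul_assoc, ← b]; group)
  have h2 := h.mem_N (g := t * (s * t)) 1 1 1 (by rw [← mul_assoc, ← b]; group)
  have h3 := h.mem_N (g := t * (s * t⁻¹)) (-1) 1 1 (by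
    rw [← mul_assoc, ← braid_inv_conj b]; group)
  have h5 := h.mem_N (g := t * (s⁻¹ * t⁻¹)) (-1) (-1) 1 (by
    rw [← mul_assoc, ← braid_inv_conj_inv b]; group)
  have h6 := h.mem_N (g := t * (t * s)) 0 2 1 (by simp [mul_assoc, pow_two, zpow_ofNat])
  have h7 := h.mem_N (g := t * (t * s⁻¹)) 0 2 (-1) (by simp [mul_assoc, pow_two, zpow_ofNat])
  have h8 := h.mem_N (g := t * (t⁻¹ * s)) 0 0 1 (by group)
  have h9 := h.mem_N (g := t * (t⁻¹ * s⁻¹)) 0 0 (-1) (by group)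
  have h10 := h.mem_N (g := t * (s⁻¹ * t⁻¹ * s)) (-1) (-1) 2 (by
    rw [← mul_assoc, ← mul_assoc, ← braid_inv_conj_inv b]; simp [mul_assoc, pow_two, zpow_ofNat])
  have h11 := h.mem_N (g := t * (s * t⁻¹ * s⁻¹)) (-1) 1 0 (by
    rw [← mul_assoc, ← mul_assoc, ← braid_inv_conj b]; group)
  have e0 : t * s⁻¹ * t * s = t * (s⁻¹ * t * s) := by group
  have e4 : t * s⁻¹ * t = t * (s⁻¹ * t) := by group
  rw [e0, e4, h']
  have := sub_mem (add_mem (add_mem (sub_mem (sub_mem (add_mem (sub_mem (add_mem (sub_mem h1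
    (smul_mem _ (↑q⁻¹ : k) h2)) (smul_mem _ (q : k) h3)) (smul_mem _ ((q : k) ^ 3) h5))
    (smul_mem _ (↑q⁻¹ : k) h6)) (smul_mem _ (q : k) h7)) (smul_mem _ (q : k) h8))
    (smul_mem _ ((q : k) ^ 3) h9)) (smul_mem _ ((q : k) ^ 2) h10)) (smul_mem _ ((q : k) ^ 2) h11)
  convert this using 1
  abel

theorem opS_N (s t : Aˣ) : opS (N k s t) = N k (opU s) (opU t) := by
  simp only [N, opS_mul, opS_U, mul_assoc]

/-- Expand `s * s` by the cubic relation; the other two terms are multiples of `t s t = s t s` and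
`t²`. -/
theorem sq_word (h : SkeinPair q e e₁ e₂ s t) :
    ((t * s * s * t : Aˣ) : A) - (e : k) • ((t * s⁻¹ * t : Aˣ) : A) ∈ N k s t := by
  have h' := congrArg (fun x => (t : A) * x * t) h.cubic_left
  simp only [mul_add, mul_sub, mul_smul_comm, add_mul, sub_mul, smul_mul_assoc, mul_one,
    ← Units.val_mul] at h'
  have h1 := h.mem_N (g := t * s * t) 1 1 1 (by rw [← h.braid]; group)
  have h2 := h.mem_N (g := t * t) 0 2 0 (by simp [pow_two, zpow_ofNat])
  rw [← mul_assoc] at h'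
  rw [h']
  have := sub_mem (smul_mem _ e₁ h1) (smul_mem _ e₂ h2)
  convert this using 1
  abel

/-- The word t² s t⁻¹ equals t s⁻¹ t s by the braid relation, so it is congruent to `q • t s⁻¹ t`;
expanding t² by the cubic relation leaves `e • t⁻¹ s t⁻¹` modulo `N`. -/
theorem inv_word (h : SkeinPair q e e₁ e₂ s t) :
    ((t⁻¹ * s * t⁻¹ : Aˣ) : A) - (↑(e⁻¹ * q) : k) • ((t * s⁻¹ * t : Aˣ) : A) ∈ N k s t := by
  have b := h.braid
  have h' := congrArg (fun x => (x * (s : A) * ((t⁻¹ : Aˣ) : A))) h.cubic_right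
  simp only [add_mul, sub_mul, smul_mul_assoc, one_mul, ← Units.val_mul] at h'
  have e0 : t * t * s * t⁻¹ = t * s⁻¹ * t * s := by
    rw [mul_assoc, mul_assoc, ← mul_assoc t s, ← braid_inv_conj b]; group
  have h1 := h.mem_N (g := t * s * t⁻¹) (-1) 1 1 (by rw [← braid_inv_conj b]; group)
  have h2 := h.mem_N (g := s * t⁻¹) 1 (-1) 0 (by group)
  rw [e0] at h'
  have := smul_mem _ (↑e⁻¹ : k) (sub_mem h.eigen_right
    (sub_mem (smul_mem _ e₁ h1) (smul_mem _ e₂ h2)))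
  rw [h'] at this
  convert this using 1
  simp only [smul_sub, smul_add, smul_smul, Units.val_mul, Units.inv_mul, one_smul]
  abel

end SkeinPair

end SkeinAlgebra

/-! ### Three strands: a skein pair generates `M`. -/

namespace SkeinAlgebra

open Submodule MulOpposite

variable {k A : Type*} [CommRing k] [Ring A] [Algebra k A]

theorem mul_mul_le {L M N P : Submodule k A} :
    L * M * N ≤ P ↔ ∀ x ∈ L, ∀ y ∈ M, ∀ z ∈ N, x * y * z ∈ P := by
  constructor
  · intro h x hx y hy z hz
    exact h (mul_mem_mul (mul_mem_mul hx hy) hz)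
  · intro h
    refine mul_le.2 fun m hm z hz => ?_
    induction hm using Submodule.mul_induction_on' with
    | mem_mul_mem x hx y hy => exact h x hx y hy z hz
    | add x _ y _ hx hy => rw [add_mul]; exact add_mem hx hy

theorem mul_U_le {s : Aˣ} {M P : Submodule k A} :
    M * U k s ≤ P ↔ ∀ y ∈ M, y ∈ P ∧ y * (s : A) ∈ P ∧ y * ((s⁻¹ : Aˣ) : A) ∈ P := by
  constructor
  · intro h y hy
    exact ⟨by simpa using h (mul_mem_mul hy (one_mem_U s)), h (mul_mem_mul hy (mem_U s)),
      h (mul_mem_mul hy (inv_mem_U s))⟩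
  · intro h
    refine mul_le.2 fun y hy z hz => ?_
    have : U k s ≤ P.comap (LinearMap.mulLeft k y) := U_le.2 (by simpa using h y hy)
    exact this hz

theorem U_mul_le {s : Aˣ} {M P : Submodule k A} :
    U k s * M ≤ P ↔ ∀ y ∈ M, y ∈ P ∧ (s : A) * y ∈ P ∧ ((s⁻¹ : Aˣ) : A) * y ∈ P := by
  constructor
  · intro h y hy
    exact ⟨by simpa using h (mul_mem_mul (one_mem_U s) hy), h (mul_mem_mul (mem_U s) hy),
      h (mul_mem_mul (inv_mem_U s) hy)⟩
  · intro h
    refine mul_le.2 fun z hz y hy => ?_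
    have : U k s ≤ P.comap (LinearMap.mulRight k y) := U_le.2 (by simpa using h y hy)
    exact this hz

theorem commute_of_mem_U {s z : Aˣ} (h : s * z = z * s) {y : A} (hy : y ∈ U k s) :
    y * z = z * y :=
  commute_of_mem_gen (S := {s}) (k := k) (by simpa using h) (U_le_gen (by simp) hy)

theorem mem_of_sub_smul_mem {P : Submodule k A} {x y : A} {c : k} (h : x - c • y ∈ P)
    (hy : y ∈ P) : x ∈ P := by
  simpa using add_mem h (smul_mem _ c hy)

theorem sub_smul_mem_symm {P : Submodule k A} {x y : A} {c : kˣ} (h : x - (c : k) • y ∈ P) :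
    y - (↑c⁻¹ : k) • x ∈ P := by
  have := neg_mem (smul_mem _ (↑c⁻¹ : k) h)
  rwa [smul_sub, smul_smul, Units.inv_mul, one_smul, neg_sub] at this

theorem sub_smul_mem_trans {P : Submodule k A} {x y z : A} {c d : kˣ} (h : x - (c : k) • y ∈ P)
    (h' : y - (d : k) • z ∈ P) : x - (↑(c * d) : k) • z ∈ P := by
  have := add_mem h (smul_mem _ (c : k) h')
  rw [smul_sub, smul_smul, ← Units.val_mul] at this
  convert this using 1
  abel

/-- The word `t s² t`. -/
def kap (s t : Aˣ) : Aˣ := t * s * s * t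

theorem kap_inv (s t : Aˣ) : kap s⁻¹ t⁻¹ = (kap s t)⁻¹ := by simp [kap, mul_assoc]

theorem kap_op (s t : Aˣ) : kap (opU s) (opU t) = opU (kap s t) := by
  simp only [kap, ← opU_mul, mul_assoc]

theorem N_inv (s t : Aˣ) : N k s⁻¹ t⁻¹ = N k s t := by simp only [N, U_inv]

/-- The span of `N k s t` and the word `t s² t`; it is the algebra generated by a skein pair. -/
def M (k : Type*) {A : Type*} [CommRing k] [Ring A] [Algebra k A] (s t : Aˣ) : Submodule k A :=
  N k s t ⊔ span k {((kap s t : Aˣ) : A)}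

theorem N_le_M (s t : Aˣ) : N k s t ≤ M k s t := le_sup_left

theorem kap_mem_M (s t : Aˣ) : ((kap s t : Aˣ) : A) ∈ M k s t :=
  le_sup_right (a := N k s t) (mem_span_singleton_self _)

theorem M_le {s t : Aˣ} {P : Submodule k A} (h : N k s t ≤ P) (h' : ((kap s t : Aˣ) : A) ∈ P) :
    M k s t ≤ P :=
  sup_le h (by simpa [span_le] using h')

namespace SkeinPair

variable {q e : kˣ} {e₁ e₂ : k} {s t : Aˣ}

theorem U_mul_N (h : SkeinPair q e e₁ e₂ s t) : U k s * N k s t ≤ N k s t := by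
  rw [N, ← mul_assoc, ← mul_assoc]
  gcongr
  exact h.cubic_left.U_mul_U

theorem N_mul_U (h : SkeinPair q e e₁ e₂ s t) : N k s t * U k s ≤ N k s t := by
  rw [N, mul_assoc]
  gcongr
  exact h.cubic_left.U_mul_U

theorem kap_mul (h : SkeinPair q e e₁ e₂ s t) :
    ((kap s t : Aˣ) : A) * s - (q : k) • ((kap s t : Aˣ) : A) ∈ N k s t := by
  have h1 := h.N_mul_U (mul_mem_mul h.sq_word (mem_U s))
  have h2 := smul_mem _ (q : k) h.sq_word
  have h3 := smul_mem _ (e : k) h.eigen_right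
  have := add_mem (sub_mem h1 h2) h3
  simp only [smul_sub, sub_mul, smul_mul_assoc, smul_smul, ← Units.val_mul] at this
  rw [mul_comm q e] at this
  convert this using 1
  rw [kap, ← Units.val_mul]
  abel

theorem kap_mul_inv (h : SkeinPair q e e₁ e₂ s t) :
    ((kap s t : Aˣ) : A) * ((s⁻¹ : Aˣ) : A) - (↑q⁻¹ : k) • ((kap s t : Aˣ) : A) ∈ N k s t := by
  have h1 := h.N_mul_U (mul_mem_mul h.kap_mul (inv_mem_U s))
  refine sub_smul_mem_symm ?_
  simpa [sub_mul, mul_assoc] using h1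

theorem mul_kap (h : SkeinPair q e e₁ e₂ s t) :
    (s : A) * ((kap s t : Aˣ) : A) - (q : k) • ((kap s t : Aˣ) : A) ∈ N k s t := by
  have := h.op.kap_mul
  rw [← opS_N, kap_op] at this
  simp only [val_opU, ← MulOpposite.op_sub, ← MulOpposite.op_smul, ← MulOpposite.op_mul,
    mem_opS] at this
  exact this

theorem inv_mul_kap (h : SkeinPair q e e₁ e₂ s t) :
    ((s⁻¹ : Aˣ) : A) * ((kap s t : Aˣ) : A) - (↑q⁻¹ : k) • ((kap s t : Aˣ) : A) ∈ N k s t := by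
  have h1 := h.U_mul_N (mul_mem_mul (inv_mem_U s) h.mul_kap)
  refine sub_smul_mem_symm ?_
  simpa [mul_sub, ← mul_assoc] using h1

/-- Modulo `N k s t`, the words `t s² t`, `t s⁻¹ t`, `t⁻¹ s t⁻¹` and `t⁻¹ s⁻² t⁻¹` agree up to
units. -/
theorem inv_word_kap (h : SkeinPair q e e₁ e₂ s t) :
    ∃ c : kˣ, ((t⁻¹ * s * t⁻¹ : Aˣ) : A) - (c : k) • ((kap s t : Aˣ) : A) ∈ N k s t :=
  ⟨_, sub_smul_mem_trans h.inv_word (sub_smul_mem_symm h.sq_word)⟩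

theorem word_kap (h : SkeinPair q e e₁ e₂ s t) :
    ∃ c : kˣ, ((t * s⁻¹ * t : Aˣ) : A) - (c : k) • ((kap s t : Aˣ) : A) ∈ N k s t :=
  ⟨_, sub_smul_mem_symm h.sq_word⟩

/-- `sq_word` for the inverse pair compares κ⁻¹ with t⁻¹ s t⁻¹. This makes `M` invariant under
inversion. -/
theorem kap_inv_kap (h : SkeinPair q e e₁ e₂ s t) :
    ∃ c : kˣ, (((kap s t)⁻¹ : Aˣ) : A) - (c : k) • ((kap s t : Aˣ) : A) ∈ N k s t := by
  obtain ⟨c, hc⟩ := h.inv_word_kap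
  have h1 := h.inv.sq_word
  rw [N_inv, inv_inv] at h1
  have := sub_smul_mem_trans h1 hc
  exact ⟨_, by rw [← kap_inv]; exact this⟩

theorem M_inv (h : SkeinPair q e e₁ e₂ s t) : M k s⁻¹ t⁻¹ = M k s t := by
  obtain ⟨c, hc⟩ := h.kap_inv_kap
  apply le_antisymm <;> refine M_le (by rw [← N_inv]; simpa using N_le_M _ _) ?_
  · rw [kap_inv]
    exact mem_of_sub_smul_mem (N_le_M _ _ hc) (kap_mem_M s t)
  · refine mem_of_sub_smul_mem (N_le_M _ _ (by rw [N_inv]; exact sub_smul_mem_symm hc)) ?_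
    rw [← kap_inv]
    exact kap_mem_M _ _

theorem M_mul_U_left (h : SkeinPair q e e₁ e₂ s t) : M k s t * U k s ≤ M k s t := by
  rw [M, Submodule.sup_mul]
  refine sup_le (h.N_mul_U.trans le_sup_left) (mul_U_le.2 fun y hy => ?_)
  obtain ⟨c, rfl⟩ := mem_span_singleton.1 hy
  simp only [smul_mul_assoc]
  exact ⟨smul_mem _ _ (kap_mem_M s t),
    smul_mem _ _ (mem_of_sub_smul_mem (N_le_M _ _ h.kap_mul) (kap_mem_M s t)),
    smul_mem _ _ (mem_of_sub_smul_mem (N_le_M _ _ h.kap_mul_inv) (kap_mem_M s t))⟩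

theorem U_mul_M_left (h : SkeinPair q e e₁ e₂ s t) : U k s * M k s t ≤ M k s t := by
  rw [M, Submodule.mul_sup]
  refine sup_le (h.U_mul_N.trans le_sup_left) (U_mul_le.2 fun y hy => ?_)
  obtain ⟨c, rfl⟩ := mem_span_singleton.1 hy
  simp only [mul_smul_comm]
  exact ⟨smul_mem _ _ (kap_mem_M s t),
    smul_mem _ _ (mem_of_sub_smul_mem (N_le_M _ _ h.mul_kap) (kap_mem_M s t)),
    smul_mem _ _ (mem_of_sub_smul_mem (N_le_M _ _ h.inv_mul_kap) (kap_mem_M s t))⟩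

theorem inv_mul_U_mul (h : SkeinPair q e e₁ e₂ s t) {x : A} (hx : x ∈ U k s) :
    ((t⁻¹ : Aˣ) : A) * x * t ∈ N k s t := by
  have : U k s ≤ (N k s t).comap (LinearMap.mulRight k (t : A) ∘ₗ
      LinearMap.mulLeft k ((t⁻¹ : Aˣ) : A)) := by
    refine U_le.2 ⟨?_, ?_, ?_⟩ <;>
      simp only [mem_comap, LinearMap.comp_apply, LinearMap.mulLeft_apply,
        LinearMap.mulRight_apply, mul_one, ← Units.val_mul]
    · exact h.mem_N 0 0 0 (by simp)
    · exact h.mem_N 1 1 (-1) (by rw [← braid_conj h.braid]; simp)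
    · exact h.mem_N 1 (-1) (-1) (by rw [← braid_conj_inv h.braid]; simp)
  exact this hx

theorem mul_U_mul_inv (h : SkeinPair q e e₁ e₂ s t) {x : A} (hx : x ∈ U k s) :
    (t : A) * x * ((t⁻¹ : Aˣ) : A) ∈ N k s t := by
  have := h.inv.inv_mul_U_mul (x := x) (by rwa [U_inv])
  rwa [N_inv, inv_inv] at this

theorem mul_U_mul (h : SkeinPair q e e₁ e₂ s t) {x : A} (hx : x ∈ U k s) :
    (t : A) * x * t ∈ M k s t := by
  have : U k s ≤ (M k s t).comap (LinearMap.mulRight k (t : A) ∘ₗ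
      LinearMap.mulLeft k (t : A)) := by
    refine U_le.2 ⟨?_, ?_, ?_⟩ <;>
      simp only [mem_comap, LinearMap.comp_apply, LinearMap.mulLeft_apply,
        LinearMap.mulRight_apply, mul_one, ← Units.val_mul]
    · exact N_le_M _ _ (h.mem_N 0 2 0 (by simp [pow_two, zpow_ofNat]))
    · exact N_le_M _ _ (h.mem_N 1 1 1 (by simp [h.braid]))
    · obtain ⟨c, hc⟩ := h.word_kap
      exact mem_of_sub_smul_mem (N_le_M _ _ hc) (kap_mem_M s t)
  exact this hx

/-- For outer letters of opposite signs the word is a conjugate and falls in `N`; for equal signs at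
most a multiple of κ is added. -/
theorem U_mul_U_mul_U (h : SkeinPair q e e₁ e₂ s t) : U k t * U k s * U k t ≤ M k s t := by
  have key : ∀ y ∈ U k s, y ∈ M k s t ∧ y * (t : A) ∈ M k s t ∧
      y * ((t⁻¹ : Aˣ) : A) ∈ M k s t ∧ (t : A) * y ∈ M k s t ∧
      ((t⁻¹ : Aˣ) : A) * y ∈ M k s t := by
    intro y hy
    have h1 : ∀ z ∈ U k t, y * z ∈ M k s t := fun z hz => N_le_M _ _ (by
      simpa [N] using mul_mem_mul (mul_mem_mul hy hz) (one_mem_U s))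
    have h2 : ∀ z ∈ U k t, z * y ∈ M k s t := fun z hz => N_le_M _ _ (by
      simpa [N] using mul_mem_mul (mul_mem_mul (one_mem_U s) hz) hy)
    exact ⟨by simpa using h1 1 (one_mem_U t), h1 _ (mem_U t), h1 _ (inv_mem_U t),
      h2 _ (mem_U t), h2 _ (inv_mem_U t)⟩
  rw [mul_assoc, U_mul_le]
  intro z hz
  have h1 : U k s * U k t ≤ M k s t := mul_U_le.2 fun y hy => ⟨(key y hy).1, (key y hy).2.1,
    (key y hy).2.2.1⟩
  have h2 : U k s * U k t ≤ (M k s t).comap (LinearMap.mulLeft k (t : A)) := by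
    refine mul_U_le.2 fun y hy => ⟨(key y hy).2.2.2.1, ?_, ?_⟩
    · simpa [mul_assoc] using h.mul_U_mul hy
    · simpa [mul_assoc] using N_le_M _ _ (h.mul_U_mul_inv hy)
  have h3 : U k s * U k t ≤ (M k s t).comap (LinearMap.mulLeft k ((t⁻¹ : Aˣ) : A)) := by
    refine mul_U_le.2 fun y hy => ⟨(key y hy).2.2.2.2, ?_, ?_⟩
    · simpa [mul_assoc] using N_le_M _ _ (h.inv_mul_U_mul hy)
    · have := h.inv.mul_U_mul (x := y) (by rwa [U_inv])
      rw [h.M_inv] at this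
      simpa [mul_assoc] using this
  exact ⟨h1 hz, h2 hz, h3 hz⟩

theorem kap_mem_U_mul_U_mul_U (h : SkeinPair q e e₁ e₂ s t) :
    ((kap s t : Aˣ) : A) ∈ U k t * U k s * U k t := by
  simp only [kap, Units.val_mul]
  rw [mul_assoc (t : A)]
  exact mul_mem_mul (mul_mem_mul (mem_U t) (h.cubic_left.mul_mem_U (mem_U s) (mem_U s))) (mem_U t)

/-- Reassociate N u_t as u_s (u_t u_s u_t), and use that κ itself lies in u_t u_s u_t, which absorbs
a further u_t. -/
theorem M_mul_U_right (h : SkeinPair q e e₁ e₂ s t) : M k s t * U k t ≤ M k s t := by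
  rw [M, Submodule.sup_mul]
  refine sup_le ?_ ?_
  · rw [N, mul_assoc, mul_assoc, ← mul_assoc (U k t)]
    exact (mul_le_mul_right h.U_mul_U_mul_U _).trans h.U_mul_M_left
  · calc span k {((kap s t : Aˣ) : A)} * U k t ≤ U k t * U k s * U k t * U k t := by
          gcongr
          simpa [span_le] using h.kap_mem_U_mul_U_mul_U
      _ ≤ U k t * U k s * U k t := by
          rw [mul_assoc]
          gcongr
          exact h.cubic_right.U_mul_U
      _ ≤ _ := h.U_mul_U_mul_U

theorem gen_le_M (h : SkeinPair q e e₁ e₂ s t) : (gen k {s, t}).toSubmodule ≤ M k s t := by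
  intro y hy
  have h1 : (1 : A) ∈ M k s t := by simpa using N_le_M _ _ (h.mem_N (g := 1) 0 0 0 (by simp))
  rw [← one_mul y]
  refine mul_mem_of_right_stable ?_ hy h1
  rintro g (rfl | rfl) x hx
  · exact ⟨h.M_mul_U_left (mul_mem_mul hx (mem_U g)), h.M_mul_U_left (mul_mem_mul hx (inv_mem_U g))⟩
  · exact ⟨h.M_mul_U_right (mul_mem_mul hx (mem_U _)),
      h.M_mul_U_right (mul_mem_mul hx (inv_mem_U _))⟩

end SkeinPair

end SkeinAlgebra

/-! ### Four strands: a skein triple generates `D`. -/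

namespace SkeinAlgebra

open Submodule MulOpposite

section Words

variable {G : Type*} [Group G] {r s t w : G}

theorem double_comm_left (h : r * s * r = s * r * s) : r * (s * r * r * s) = s * r * r * s * r := by
  calc r * (s * r * r * s) = r * s * r * (r * s) := by simp only [mul_assoc]
    _ = s * r * (s * r * s) := by rw [h]; simp only [mul_assoc]
    _ = s * r * r * s * r := by rw [← h]; simp only [mul_assoc]

theorem double_comm_right {g : G} (h : s * t * s = t * s * t) (hg : g * t = t * g) :
    s * (t * (s * g * s) * t) = t * (s * g * s) * t * s := by
  calc s * (t * (s * g * s) * t) = s * t * s * (g * s * t) := by simp only [mul_assoc]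
    _ = t * s * (t * g) * (s * t) := by rw [h]; simp only [mul_assoc]
    _ = t * s * g * (t * s * t) := by rw [← hg]; simp only [mul_assoc]
    _ = _ := by rw [← h]; simp only [mul_assoc]

/-- The conjugate of s r² s by `t` is a conjugate of t s² t by an element of ⟨r, s⟩, so it involves
only words t^i s^j t^l between elements of A₃. -/
theorem double_conj (h : r * s * r = s * r * s) (h' : s * t * s = t * s * t) (c : r * t = t * r) :
    t * (s * r * r * s) * t⁻¹ = s⁻¹ * r⁻¹ * (t * s * s * t) * (r * s) := by
  have h1 : s⁻¹ * t * s = t * s * t⁻¹ := braid_inv_conj h'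
  have h2 : s * r * s⁻¹ = r⁻¹ * s * r := (braid_inv_conj h).symm
  have c' : t * r⁻¹ = r⁻¹ * t := (Commute.inv_left (show Commute r t from c)).eq.symm
  calc t * (s * r * r * s) * t⁻¹ = t * s * (r * r) * t * t⁻¹ * s * t⁻¹ := by
        simp only [mul_assoc, mul_inv_cancel_left]
    _ = t * s * t⁻¹ * (t * (r * r) * t⁻¹) * (t * s * t⁻¹) := by
        simp only [mul_assoc, mul_inv_cancel_left, inv_mul_cancel_left]
    _ = s⁻¹ * t * s * (r * r) * (s⁻¹ * t * s) := by
        rw [← h1, ← mul_assoc t r r, ← c, mul_assoc r t r, ← c, ← mul_assoc r r t,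
          mul_inv_cancel_right]
    _ = s⁻¹ * t * (s * r * s⁻¹) * (s * r * s⁻¹) * t * s := by
        simp only [mul_assoc, inv_mul_cancel_left]
    _ = s⁻¹ * (t * r⁻¹) * s * s * (r * t) * s := by
        rw [h2]; simp only [mul_assoc, mul_inv_cancel_left]
    _ = _ := by rw [c, c']; simp only [mul_assoc]

end Words

variable {k A : Type*} [CommRing k] [Ring A] [Algebra k A]

theorem gen_pair_inv (r s : Aˣ) : gen k {r⁻¹, s⁻¹} = gen k {r, s} := by
  rw [← gen_inv_image]; simp

theorem gen_triple_inv (r s t : Aˣ) : gen k {r⁻¹, s⁻¹, t⁻¹} = gen k {r, s, t} := by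
  rw [← gen_inv_image]; simp

theorem opS_gen_pair (r s : Aˣ) :
    opS (gen k {r, s}).toSubmodule = (gen k {opU r, opU s}).toSubmodule := by
  rw [opS_gen, Set.image_pair]

theorem opS_gen_triple (r s t : Aˣ) :
    opS (gen k {r, s, t}).toSubmodule = (gen k {opU r, opU s, opU t}).toSubmodule := by
  rw [opS_gen, Set.image_insert_eq, Set.image_pair]

theorem gen_mul_gen (S : Set Aˣ) :
    (gen k S).toSubmodule * (gen k S).toSubmodule = (gen k S).toSubmodule :=
  Subalgebra.isIdempotentElem_toSubmodule _

theorem one_mem_gen (S : Set Aˣ) : (1 : A) ∈ (gen k S).toSubmodule := (gen k S).one_mem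

theorem U_mul_mul_U_le {t : Aˣ} {M P : Submodule k A} (h : M ≤ P)
    (h1 : ∀ y ∈ M, y * (t : A) ∈ P) (h2 : ∀ y ∈ M, y * ((t⁻¹ : Aˣ) : A) ∈ P)
    (h3 : ∀ y ∈ M, (t : A) * y ∈ P) (h4 : ∀ y ∈ M, ((t⁻¹ : Aˣ) : A) * y ∈ P)
    (h5 : ∀ y ∈ M, (t : A) * y * t ∈ P) (h6 : ∀ y ∈ M, (t : A) * y * ((t⁻¹ : Aˣ) : A) ∈ P)
    (h7 : ∀ y ∈ M, ((t⁻¹ : Aˣ) : A) * y * t ∈ P)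
    (h8 : ∀ y ∈ M, ((t⁻¹ : Aˣ) : A) * y * ((t⁻¹ : Aˣ) : A) ∈ P) :
    U k t * M * U k t ≤ P := by
  rw [mul_assoc, U_mul_le]
  intro z hz
  refine ⟨?_, ?_, ?_⟩
  · exact (mul_U_le.2 fun y hy => ⟨h hy, h1 y hy, h2 y hy⟩ : M * U k t ≤ P) hz
  · refine (mul_U_le.2 fun y hy => ?_ : M * U k t ≤ P.comap (LinearMap.mulLeft k (t : A))) hz
    exact ⟨h3 y hy, by simpa [mul_assoc] using h5 y hy, by simpa [mul_assoc] using h6 y hy⟩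
  · refine (mul_U_le.2 fun y hy => ?_ :
      M * U k t ≤ P.comap (LinearMap.mulLeft k ((t⁻¹ : Aˣ) : A))) hz
    exact ⟨h4 y hy, by simpa [mul_assoc] using h7 y hy, by simpa [mul_assoc] using h8 y hy⟩

/-- Three units satisfying the relations of the generators of the algebra on four strands. -/
structure SkeinTriple (q e : kˣ) (e₁ e₂ : k) (r s t : Aˣ) : Prop where
  left : SkeinPair q e e₁ e₂ r s
  right : SkeinPair q e e₁ e₂ s t
  comm : r * t = t * r

/-- The word `t s r² s t`. -/
def xi (r s t : Aˣ) : Aˣ := t * kap r s * t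

theorem xi_inv (r s t : Aˣ) : xi r⁻¹ s⁻¹ t⁻¹ = (xi r s t)⁻¹ := by
  simp [xi, kap_inv, mul_assoc]

theorem xi_op (r s t : Aˣ) : xi (opU r) (opU s) (opU t) = opU (xi r s t) := by
  simp only [xi, kap_op, ← opU_mul, mul_assoc]

/-- The bimodule over the algebra generated by `r`, `s` spanned by the words `t^i s^j t^l`. -/
def D₀ (k : Type*) {A : Type*} [CommRing k] [Ring A] [Algebra k A] (r s t : Aˣ) :
    Submodule k A :=
  (gen k {r, s}).toSubmodule * (U k t * U k s * U k t) * (gen k {r, s}).toSubmodule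

theorem D₀_inv (r s t : Aˣ) : D₀ k r⁻¹ s⁻¹ t⁻¹ = D₀ k r s t := by
  simp only [D₀, U_inv, gen_pair_inv]

theorem mul_mem_D₀ {r s t : Aˣ} {x y : A} (hx : x ∈ gen k {r, s}) (hy : y ∈ D₀ k r s t) :
    x * y ∈ D₀ k r s t := by
  have : (gen k {r, s}).toSubmodule * D₀ k r s t = D₀ k r s t := by
    simp only [D₀, ← mul_assoc, gen_mul_gen]
  rw [← this]
  exact mul_mem_mul hx hy

theorem D₀_mul_mem {r s t : Aˣ} {x y : A} (hx : x ∈ gen k {r, s}) (hy : y ∈ D₀ k r s t) :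
    y * x ∈ D₀ k r s t := by
  have : D₀ k r s t * (gen k {r, s}).toSubmodule = D₀ k r s t := by
    simp only [D₀, mul_assoc, gen_mul_gen]
  rw [← this]
  exact mul_mem_mul hy hx

theorem U_mul_U_mul_U_le_D₀ (r s t : Aˣ) : U k t * U k s * U k t ≤ D₀ k r s t := by
  intro x hx
  simpa [D₀] using mul_mem_mul (mul_mem_mul (one_mem_gen (k := k) {r, s}) hx)
    (one_mem_gen (k := k) {r, s})

theorem U_le_D₀ (r s t : Aˣ) : U k t ≤ D₀ k r s t := by
  intro x hx
  apply U_mul_U_mul_U_le_D₀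
  simpa using mul_mem_mul (mul_mem_mul hx (one_mem_U s)) (one_mem_U t)

/-- The algebra generated by a skein triple. -/
def D (k : Type*) {A : Type*} [CommRing k] [Ring A] [Algebra k A] (r s t : Aˣ) :
    Submodule k A :=
  D₀ k r s t ⊔ ((gen k {r, s}).toSubmodule * span k {((xi r s t : Aˣ) : A)} ⊔
    (gen k {r, s}).toSubmodule * span k {(((xi r s t)⁻¹ : Aˣ) : A)})

theorem D_inv (r s t : Aˣ) : D k r⁻¹ s⁻¹ t⁻¹ = D k r s t := by
  rw [D, D, D₀_inv, gen_pair_inv, xi_inv, inv_inv, sup_comm (_ * _)]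

theorem D₀_le_D (r s t : Aˣ) : D₀ k r s t ≤ D k r s t := le_sup_left

theorem xi_mem_D (r s t : Aˣ) : ((xi r s t : Aˣ) : A) ∈ D k r s t := by
  refine (le_sup_left.trans le_sup_right : _ ≤ D k r s t)
    (?_ : _ ∈ (gen k {r, s}).toSubmodule * span k {((xi r s t : Aˣ) : A)})
  simpa using mul_mem_mul (one_mem_gen (k := k) {r, s})
    (mem_span_singleton_self (R := k) ((xi r s t : Aˣ) : A))

theorem mul_mem_D {r s t : Aˣ} {x y : A} (hx : x ∈ gen k {r, s}) (hy : y ∈ D k r s t) :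
    x * y ∈ D k r s t := by
  have : (gen k {r, s}).toSubmodule * D k r s t = D k r s t := by
    simp only [D, D₀, Submodule.mul_sup, ← mul_assoc, gen_mul_gen]
  rw [← this]
  exact mul_mem_mul hx hy

namespace SkeinTriple

variable {q e : kˣ} {e₁ e₂ : k} {r s t : Aˣ}

theorem inv (h : SkeinTriple q e e₁ e₂ r s t) :
    SkeinTriple q⁻¹ e⁻¹ (↑e⁻¹ * e₂) (↑e⁻¹ * e₁) r⁻¹ s⁻¹ t⁻¹ :=
  ⟨h.left.inv, h.right.inv, (Commute.inv_inv (show Commute r t from h.comm)).eq⟩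

theorem op (h : SkeinTriple q e e₁ e₂ r s t) :
    SkeinTriple q e e₁ e₂ (opU r) (opU s) (opU t) :=
  ⟨h.left.op, h.right.op, by rw [← opU_mul, ← opU_mul, h.comm]⟩

theorem xi_comm (h : SkeinTriple q e e₁ e₂ r s t) {y : A} (hy : y ∈ gen k {r, s}) :
    y * ((xi r s t : Aˣ) : A) = ((xi r s t : Aˣ) : A) * y := by
  refine commute_of_mem_gen ?_ hy
  rintro g (rfl | rfl)
  · have h1 := double_comm_left h.left.braid
    rw [xi, kap, ← mul_assoc, ← mul_assoc, h.comm, mul_assoc t, h1, mul_assoc _ t,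
      ← h.comm]
    simp only [mul_assoc]
  · have := double_comm_right (g := r * r) h.right.braid (by
      rw [mul_assoc, h.comm, ← mul_assoc, h.comm, mul_assoc])
    simpa only [xi, kap, mul_assoc] using this

theorem xi_inv_comm (h : SkeinTriple q e e₁ e₂ r s t) {y : A} (hy : y ∈ gen k {r, s}) :
    y * (((xi r s t)⁻¹ : Aˣ) : A) = (((xi r s t)⁻¹ : Aˣ) : A) * y := by
  have := h.inv.xi_comm (k := k) (y := y) (by rwa [gen_pair_inv])
  rwa [xi_inv] at this

theorem D_mul_mem (h : SkeinTriple q e e₁ e₂ r s t) {x y : A} (hx : x ∈ gen k {r, s})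
    (hy : y ∈ D k r s t) : y * x ∈ D k r s t := by
  have key : ∀ z : Aˣ, (∀ y ∈ gen k {r, s}, y * (z : A) = z * y) → ∀ y ∈
      (gen k {r, s}).toSubmodule * span k {(z : A)}, y * x ∈
      (gen k {r, s}).toSubmodule * span k {(z : A)} := by
    intro z hz y hy
    obtain ⟨y', hy', rfl⟩ := mem_mul_span_singleton.1 hy
    rw [mul_assoc, ← hz x hx, ← mul_assoc]
    exact mul_mem_mul ((gen k {r, s}).mul_mem hy' hx) (mem_span_singleton_self _)
  obtain ⟨y1, h1, y2, h2, rfl⟩ := mem_sup.1 hy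
  obtain ⟨y2, h2', y3, h3, rfl⟩ := mem_sup.1 h2
  rw [add_mul, add_mul]
  exact add_mem (D₀_le_D _ _ _ (D₀_mul_mem hx h1))
    (le_sup_right (a := D₀ k r s t) (add_mem
    (mem_sup_left (key _ (fun y => h.xi_comm) _ h2'))
    (mem_sup_right (key _ (fun y => h.xi_inv_comm) _ h3))))

/-- The outer powers of `r` commute with `a` and `b` and slide out, leaving a power of `s` between
powers of `t`. -/
theorem mul_N_mul (h : SkeinTriple q e e₁ e₂ r s t) {y : A} (hy : y ∈ N k r s) {a b : Aˣ}
    (ha : a = t ∨ a = t⁻¹) (hb : b = t ∨ b = t⁻¹) : (a : A) * y * b ∈ D₀ k r s t := by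
  have hc : ∀ c : Aˣ, c = t ∨ c = t⁻¹ → r * c = c * r ∧ (c : A) ∈ U k t := by
    rintro c (rfl | rfl)
    exacts [⟨h.comm, mem_U _⟩, ⟨(Commute.inv_right (show Commute r t from h.comm)).eq, inv_mem_U _⟩]
  refine (mul_mul_le.2 fun x hx y hy z hz => ?_ : N k r s ≤ (D₀ k r s t).comap
    (LinearMap.mulRight k (b : A) ∘ₗ LinearMap.mulLeft k (a : A))) hy
  have e1 : (a : A) * (x * y * z) * b = x * (a * y * b) * z := by
    have h1 := commute_of_mem_U (hc a ha).1 hx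
    have h2 := commute_of_mem_U (hc b hb).1 hz
    simp only [mul_assoc]
    rw [h2, ← mul_assoc (a : A) x, ← h1]
    simp only [mul_assoc]
  change (a : A) * (x * y * z) * b ∈ D₀ k r s t
  rw [e1]
  exact mul_mem_mul (mul_mem_mul (U_le_gen (by simp) hx)
    (mul_mem_mul (mul_mem_mul (hc a ha).2 hy) (hc b hb).2)) (U_le_gen (by simp) hz)

theorem mul_gen_mul (h : SkeinTriple q e e₁ e₂ r s t) {y : A} (hy : y ∈ gen k {r, s}) :
    (t : A) * y * t ∈ D k r s t := by
  refine (M_le ?_ ?_ : M k r s ≤ (D k r s t).comap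
    (LinearMap.mulRight k (t : A) ∘ₗ LinearMap.mulLeft k (t : A))) (h.left.gen_le_M hy)
  · exact fun y hy => D₀_le_D _ _ _ (h.mul_N_mul hy (Or.inl rfl) (Or.inl rfl))
  · simpa [xi] using xi_mem_D (k := k) r s t

theorem mul_gen_mul_inv (h : SkeinTriple q e e₁ e₂ r s t) {y : A} (hy : y ∈ gen k {r, s}) :
    (t : A) * y * ((t⁻¹ : Aˣ) : A) ∈ D₀ k r s t := by
  refine (M_le ?_ ?_ : M k r s ≤ (D₀ k r s t).comap
    (LinearMap.mulRight k ((t⁻¹ : Aˣ) : A) ∘ₗ LinearMap.mulLeft k (t : A)))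
    (h.left.gen_le_M hy)
  · exact fun y hy => h.mul_N_mul hy (Or.inl rfl) (Or.inr rfl)
  · have := double_conj h.left.braid h.right.braid h.comm
    simp only [mem_comap, LinearMap.comp_apply, LinearMap.mulLeft_apply,
        LinearMap.mulRight_apply, ← Units.val_mul]
    rw [kap, this, Units.val_mul, Units.val_mul]
    refine mul_mem_mul (mul_mem_mul ?_ h.right.kap_mem_U_mul_U_mul_U) ?_
    · rw [Units.val_mul]
      exact (gen k {r, s}).mul_mem (inv_mem_gen (by simp)) (inv_mem_gen (by simp))
    · rw [Units.val_mul]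
      exact (gen k {r, s}).mul_mem (mem_gen (by simp)) (mem_gen (by simp))

theorem U_mul_gen_mul_U (h : SkeinTriple q e e₁ e₂ r s t) :
    U k t * (gen k {r, s}).toSubmodule * U k t ≤ D k r s t := by
  have hU : ∀ x ∈ U k t, x ∈ D₀ k r s t := fun x hx => U_le_D₀ r s t hx
  apply U_mul_mul_U_le
  · intro y hy
    simpa using D₀_le_D _ _ _ (mul_mem_D₀ hy (hU 1 (one_mem_U t)))
  · exact fun y hy => D₀_le_D _ _ _ (mul_mem_D₀ hy (hU _ (mem_U t)))
  · exact fun y hy => D₀_le_D _ _ _ (mul_mem_D₀ hy (hU _ (inv_mem_U t)))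
  · exact fun y hy => D₀_le_D _ _ _ (D₀_mul_mem hy (hU _ (mem_U t)))
  · exact fun y hy => D₀_le_D _ _ _ (D₀_mul_mem hy (hU _ (inv_mem_U t)))
  · exact fun y hy => h.mul_gen_mul hy
  · exact fun y hy => D₀_le_D _ _ _ (h.mul_gen_mul_inv hy)
  · intro y hy
    have := h.inv.mul_gen_mul_inv (k := k) (y := y) (by rwa [gen_pair_inv])
    rw [D₀_inv, inv_inv] at this
    exact D₀_le_D _ _ _ this
  · intro y hy
    have := h.inv.mul_gen_mul (k := k) (y := y) (by rwa [gen_pair_inv])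
    rwa [D_inv] at this

theorem N_le_gen_mul_U_mul_gen (r s t : Aˣ) :
    N k s t ≤ (gen k {r, s}).toSubmodule * U k t * (gen k {r, s}).toSubmodule := by
  rw [N]
  gcongr <;> exact U_le_gen (by simp)

theorem gen_U_gen_U_le (h : SkeinTriple q e e₁ e₂ r s t) :
    (gen k {r, s}).toSubmodule * U k t * (gen k {r, s}).toSubmodule *
      (gen k {r, s}).toSubmodule * U k t ≤ D k r s t := by
  rw [mul_assoc _ _ (gen k {r, s}).toSubmodule, gen_mul_gen, mul_assoc, mul_assoc,
    ← mul_assoc (U k t)]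
  exact mul_le.2 fun x hx y hy => mul_mem_D hx (h.U_mul_gen_mul_U hy)

/-- This is the only hard case of right multiplication by `t`. The normal form of A₃ is taken as `M
k s r`, with `s` outermost, because κ absorbs powers of `s` on its right modulo `N k s t`. -/
theorem kap_mul_gen_mul (h : SkeinTriple q e e₁ e₂ r s t) {y : A} (hy : y ∈ gen k {r, s}) :
    ((kap s t : Aˣ) : A) * y * t ∈ D k r s t := by
  have low : ∀ n ∈ N k s t, ∀ y ∈ gen k {r, s}, n * y * t ∈ D k r s t := fun n hn y hy =>
    h.gen_U_gen_U_le (mul_mem_mul (mul_mem_mul (N_le_gen_mul_U_mul_gen r s t hn) hy) (mem_U t))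
  -- With κ exchanged for t⁻¹ s t⁻¹, `x` slides left and t⁻¹ z t falls in `N k s t`, so only two
  -- powers of `t` remain.
  have base : ∀ x ∈ U k r, ∀ z ∈ U k s, ((kap s t : Aˣ) : A) * (x * z) * t ∈ D k r s t := by
    intro x hx z hz
    obtain ⟨c, hc⟩ := h.right.inv_word_kap
    have hxz : x * z ∈ gen k {r, s} :=
      (gen k {r, s}).mul_mem (U_le_gen (by simp) hx) (U_le_gen (by simp) hz)
    have h1 := low _ (sub_smul_mem_symm hc) _ hxz
    rw [sub_mul, sub_mul, smul_mul_assoc, smul_mul_assoc] at h1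
    refine mem_of_sub_smul_mem h1 ?_
    have hx' := commute_of_mem_U (k := k) (Commute.inv_right (show Commute r t from h.comm)).eq hx
    have e1 : ((t⁻¹ * s * t⁻¹ : Aˣ) : A) * (x * z) * t =
        ((t⁻¹ : Aˣ) : A) * (s * x) * (((t⁻¹ : Aˣ) : A) * z * t) := by
      simp only [Units.val_mul, mul_assoc]
      rw [← mul_assoc ((t⁻¹ : Aˣ) : A) x, ← hx']
      simp only [mul_assoc]
    rw [e1]
    have h2 : U k t * (gen k {r, s}).toSubmodule * ((gen k {r, s}).toSubmodule * U k t *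
        (gen k {r, s}).toSubmodule) ≤ D k r s t := by
      rw [← mul_assoc, ← mul_assoc, mul_assoc (U k t), gen_mul_gen]
      exact mul_le.2 fun x hx y hy => h.D_mul_mem hy (h.U_mul_gen_mul_U hx)
    exact h2 (mul_mem_mul (mul_mem_mul (inv_mem_U t) ((gen k {r, s}).mul_mem (mem_gen (by simp))
      (U_le_gen (by simp) hx))) (N_le_gen_mul_U_mul_gen r s t (h.right.inv_mul_U_mul hz)))
  have hM : M k s r ≤ (D k r s t).comap (LinearMap.mulRight k (t : A) ∘ₗ
      LinearMap.mulLeft k ((kap s t : Aˣ) : A)) := by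
    refine M_le (mul_mul_le.2 fun x hx y hy z hz => ?_) ?_
    · change ((kap s t : Aˣ) : A) * (x * y * z) * t ∈ D k r s t
      have hyz : y * z ∈ gen k {r, s} :=
        (gen k {r, s}).mul_mem (U_le_gen (by simp) hy) (U_le_gen (by simp) hz)
      obtain ⟨n, hn, m, hm, hnm⟩ := mem_sup.1
        (h.right.M_mul_U_left (mul_mem_mul (kap_mem_M s t) hx))
      obtain ⟨c, rfl⟩ := mem_span_singleton.1 hm
      rw [mul_assoc x, ← mul_assoc ((kap s t : Aˣ) : A), ← hnm, add_mul, add_mul, smul_mul_assoc,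
        smul_mul_assoc]
      exact add_mem (low n hn _ hyz) (smul_mem _ _ (base y hy z hz))
    · change ((kap s t : Aˣ) : A) * ((kap s r : Aˣ) : A) * t ∈ D k r s t
      have e1 : ((kap s t : Aˣ) : A) * ((kap s r : Aˣ) : A) * t =
          ((kap s t : Aˣ) : A) * (r * (s * s)) * t * r := by
        have : (r : A) * t = t * r := by simpa using congrArg Units.val h.comm
        rw [kap, kap]
        simp only [Units.val_mul, mul_assoc, this]
      rw [e1]
      exact h.D_mul_mem (mem_gen (by simp)) (base _ (mem_U r) _
        (h.left.cubic_right.mul_mem_U (mem_U s) (mem_U s)))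
  exact hM (h.left.symm.gen_le_M (by rwa [Set.pair_comm]))

theorem D_mul_right (h : SkeinTriple q e e₁ e₂ r s t) {x : A} (hx : x ∈ D k r s t) :
    x * t ∈ D k r s t := by
  have hX : ∀ z ∈ U k t * (gen k {r, s}).toSubmodule * U k t, ∀ x ∈
      (gen k {r, s}).toSubmodule * span k {(z : A)}, x * (t : A) ∈ D k r s t := by
    -- When `z` is ξ or its inverse, the final `t` merges with the last letter of `z`.
    intro z hz x hx
    obtain ⟨x, hx', rfl⟩ := mem_mul_span_singleton.1 hx
    rw [mul_assoc]
    refine mul_mem_D hx' (h.U_mul_gen_mul_U ?_)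
    have := mul_mem_mul hz (mem_U (k := k) t)
    rw [mul_assoc _ (U k t)] at this
    exact mul_le_mul_right h.right.cubic_right.U_mul_U _ this
  have hk : ((kap r s : Aˣ) : A) ∈ gen k {r, s} := by
    simp only [kap, Units.val_mul]
    exact mul_mem (mul_mem (mul_mem (mem_gen (by simp)) (mem_gen (by simp)))
      (mem_gen (by simp))) (mem_gen (by simp))
  have hk' : (((kap r s)⁻¹ : Aˣ) : A) ∈ gen k {r, s} := by
    simp only [kap, Units.val_mul, mul_inv_rev]
    exact mul_mem (inv_mem_gen (by simp)) (mul_mem (inv_mem_gen (by simp))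
      (mul_mem (inv_mem_gen (by simp)) (inv_mem_gen (by simp))))
  obtain ⟨x1, h1, x2, h2, rfl⟩ := mem_sup.1 hx
  obtain ⟨x2, h2', x3, h3, rfl⟩ := mem_sup.1 h2
  rw [add_mul, add_mul]
  refine add_mem ?_ (add_mem (hX _ ?_ _ h2') (hX _ ?_ _ h3))
  · refine (mul_mul_le.2 fun x hx m hm y hy => ?_ : D₀ k r s t ≤
      (D k r s t).comap (LinearMap.mulRight k (t : A))) h1
    change x * m * y * t ∈ D k r s t
    rw [mul_assoc x, mul_assoc x]
    refine mul_mem_D hx ?_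
    obtain ⟨n, hn, m, hm', rfl⟩ := mem_sup.1 (h.right.U_mul_U_mul_U hm)
    obtain ⟨c, rfl⟩ := mem_span_singleton.1 hm'
    rw [add_mul, add_mul, smul_mul_assoc, smul_mul_assoc]
    exact add_mem (h.gen_U_gen_U_le (mul_mem_mul (mul_mem_mul
      (N_le_gen_mul_U_mul_gen r s t hn) hy) (mem_U t))) (smul_mem _ _ (h.kap_mul_gen_mul hy))
  · rw [xi, Units.val_mul, Units.val_mul]
    exact mul_mem_mul (mul_mem_mul (mem_U t) hk) (mem_U t)
  · rw [xi, mul_inv_rev, mul_inv_rev, Units.val_mul, Units.val_mul, ← mul_assoc]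
    exact mul_mem_mul (mul_mem_mul (inv_mem_U t) hk') (inv_mem_U t)

theorem gen_le_D (h : SkeinTriple q e e₁ e₂ r s t) :
    (gen k {r, s, t}).toSubmodule ≤ D k r s t := by
  intro y hy
  have h1 : (1 : A) ∈ D k r s t := D₀_le_D _ _ _ (U_le_D₀ r s t (one_mem_U t))
  rw [← one_mul y]
  refine mul_mem_of_right_stable ?_ hy h1
  rintro g (rfl | rfl | rfl) x hx
  · exact ⟨h.D_mul_mem (mem_gen (by simp)) hx, h.D_mul_mem (inv_mem_gen (by simp)) hx⟩
  · exact ⟨h.D_mul_mem (mem_gen (by simp)) hx, h.D_mul_mem (inv_mem_gen (by simp)) hx⟩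
  · refine ⟨h.D_mul_right hx, ?_⟩
    have := h.inv.D_mul_right (k := k) (x := x) (by rwa [D_inv])
    rwa [D_inv] at this

end SkeinTriple

end SkeinAlgebra

/-! ### Five strands: the degree in `w` and a first reduction from degree three to two. -/

namespace SkeinAlgebra

open Submodule MulOpposite

section Words

variable {G : Type*} [Group G] {r s t w : G}

theorem double_conj' (h : r * s * r = s * r * s) (h' : s * t * s = t * s * t) (c : r * t = t * r) :
    t⁻¹ * (s * r * r * s) * t = s * r * (t * s * s * t) * (r⁻¹ * s⁻¹) := by
  have := congrArg unop (double_conj (r := op r) (s := op s) (t := op t)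
    (by simpa only [← op_mul, op_inj, mul_assoc] using h)
    (by simpa only [← op_mul, op_inj, mul_assoc] using h')
    (by simpa only [← op_mul, op_inj] using c.symm))
  simpa only [unop_mul, unop_op, unop_inv, mul_assoc] using this

/-- Conjugation by `w` carries ξ to a conjugate of its shift υ by an element of A₄; this relates
words w^{±1} ξ w^{∓1} to υ. -/
theorem triple_conj (h : r * s * r = s * r * s) (h' : s * t * s = t * s * t)
    (h'' : t * w * t = w * t * w) (c : r * t = t * r) (cr : r * w = w * r) (cs : s * w = w * s) :
    w * (t * (s * r * r * s) * t) * w⁻¹ =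
      t⁻¹ * s⁻¹ * r⁻¹ * (w * (t * s * s * t) * w) * (r * s * t) := by
  have h1 : t⁻¹ * w * t = w * t * w⁻¹ := braid_inv_conj h''
  have h2 := double_conj h h' c
  have c1 : (s * r * r * s) * w = w * (s * r * r * s) := by
    rw [mul_assoc, cs, ← mul_assoc, mul_assoc _ r w, cr, ← mul_assoc, mul_assoc _ r w, cr,
      ← mul_assoc, cs]
    simp only [mul_assoc]
  have c2 : (r * s) * w = w * (r * s) := by rw [mul_assoc, cs, ← mul_assoc, cr, mul_assoc]
  have c3 : w * (s⁻¹ * r⁻¹) = s⁻¹ * r⁻¹ * w := by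
    rw [← mul_inv_rev, eq_comm, inv_mul_eq_iff_eq_mul, ← mul_assoc, c2, mul_inv_cancel_right]
  calc w * (t * (s * r * r * s) * t) * w⁻¹
      = w * t * w⁻¹ * (w * (s * r * r * s)) * (t * w⁻¹) := by
        simp only [mul_assoc, inv_mul_cancel_left]
    _ = t⁻¹ * w * t * (s * r * r * s) * (w * t * w⁻¹) := by
        rw [h1, ← c1]; simp only [mul_assoc]
    _ = t⁻¹ * w * (t * (s * r * r * s) * t⁻¹) * w * t := by
        rw [← h1]; simp only [mul_assoc]
    _ = t⁻¹ * (w * (s⁻¹ * r⁻¹)) * (t * s * s * t) * (r * s * w) * t := by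
        rw [h2]; simp only [mul_assoc]
    _ = _ := by rw [c2, c3]; simp only [mul_assoc]

theorem triple_conj' (h : r * s * r = s * r * s) (h' : s * t * s = t * s * t)
    (h'' : t * w * t = w * t * w) (c : r * t = t * r) (cr : r * w = w * r) (cs : s * w = w * s) :
    w⁻¹ * (t * (s * r * r * s) * t) * w =
      t * s * r * (w * (t * s * s * t) * w) * (r⁻¹ * s⁻¹ * t⁻¹) := by
  have := congrArg unop (triple_conj (r := op r) (s := op s) (t := op t) (w := op w)
    (by simpa only [← op_mul, op_inj, mul_assoc] using h)
    (by simpa only [← op_mul, op_inj, mul_assoc] using h')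
    (by simpa only [← op_mul, op_inj, mul_assoc] using h'')
    (by simpa only [← op_mul, op_inj] using c.symm)
    (by simpa only [← op_mul, op_inj] using cr.symm)
    (by simpa only [← op_mul, op_inj] using cs.symm))
  simpa only [unop_mul, unop_op, unop_inv, mul_assoc] using this

end Words

variable {k A : Type*} [CommRing k] [Ring A] [Algebra k A]

theorem gen_commute_U {S : Set Aˣ} {w : Aˣ} (h : ∀ g ∈ S, g * w = w * g) {x y : A}
    (hy : y ∈ gen k S) (hx : x ∈ U k w) : y * x = x * y := by
  have : U k w ≤ (Subalgebra.centralizer k {y}).toSubmodule := by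
    refine U_le.2 ⟨?_, ?_, ?_⟩
    · exact (Subalgebra.centralizer k {y}).one_mem
    · rw [Subalgebra.mem_toSubmodule, Subalgebra.mem_centralizer_iff]
      rintro _ rfl
      exact commute_of_mem_gen h hy
    · rw [Subalgebra.mem_toSubmodule, Subalgebra.mem_centralizer_iff]
      rintro _ rfl
      exact commute_of_mem_gen
        (fun g hg => (Commute.inv_right (show Commute g w from h g hg)).eq) hy
  exact (Subalgebra.mem_centralizer_iff k).1 (this hx) y rfl

/-- Four units satisfying the relations of the generators of the algebra on five strands. -/
structure SkeinQuad (q e : kˣ) (e₁ e₂ : k) (r s t w : Aˣ) : Prop where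
  left : SkeinTriple q e e₁ e₂ r s t
  right : SkeinTriple q e e₁ e₂ s t w
  comm : r * w = w * r

/-- Words of degree at most one in `w`. -/
def B₁ (k : Type*) {A : Type*} [CommRing k] [Ring A] [Algebra k A] (r s t w : Aˣ) :
    Submodule k A :=
  (gen k {r, s, t}).toSubmodule * U k w * (gen k {r, s, t}).toSubmodule

/-- Words of degree at most two in `w`. -/
def B₂ (k : Type*) {A : Type*} [CommRing k] [Ring A] [Algebra k A] (r s t w : Aˣ) :
    Submodule k A :=
  B₁ k r s t w * U k w * (gen k {r, s, t}).toSubmodule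

/-- Words of degree at most one in `t`, as a bimodule over the algebra generated by `r`, `s`. -/
def E (k : Type*) {A : Type*} [CommRing k] [Ring A] [Algebra k A] (r s t : Aˣ) :
    Submodule k A :=
  (gen k {r, s}).toSubmodule * U k t * (gen k {r, s}).toSubmodule

theorem B₁_inv (r s t w : Aˣ) : B₁ k r⁻¹ s⁻¹ t⁻¹ w⁻¹ = B₁ k r s t w := by
  simp only [B₁, U_inv, gen_triple_inv]

theorem B₂_inv (r s t w : Aˣ) : B₂ k r⁻¹ s⁻¹ t⁻¹ w⁻¹ = B₂ k r s t w := by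
  simp only [B₂, B₁_inv, U_inv, gen_triple_inv]

theorem opS_B₂ (r s t w : Aˣ) :
    opS (B₂ k r s t w) = B₂ k (opU r) (opU s) (opU t) (opU w) := by
  simp only [B₂, B₁, opS_mul, opS_U, opS_gen_triple, mul_assoc]

theorem opS_E (r s t : Aˣ) : opS (E k r s t) = E k (opU r) (opU s) (opU t) := by
  simp only [E, opS_mul, opS_U, opS_gen_pair, mul_assoc]

section Closure

variable {r s t w : Aˣ} {x y z : A}

theorem gen_pair_le : (gen k {r, s}) ≤ gen k {r, s, t} :=
  gen_mono (by intro x; simp only [Set.mem_insert_iff, Set.mem_singleton_iff]; tauto)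

theorem gen_pair_le' : (gen k {s, t}) ≤ gen k {r, s, t} :=
  gen_mono (by intro x; simp only [Set.mem_insert_iff, Set.mem_singleton_iff]; tauto)

theorem E_le_gen : E k r s t ≤ (gen k {r, s, t}).toSubmodule :=
  mul_mul_le.2 fun _ hx _ hy _ hz => (gen k {r, s, t}).mul_mem
    ((gen k {r, s, t}).mul_mem (gen_pair_le hx) (U_le_gen (by simp) hy)) (gen_pair_le hz)

theorem mul_mem_E (hx : x ∈ gen k {r, s}) (hy : y ∈ E k r s t) : x * y ∈ E k r s t := by
  have := mul_mem_mul (show x ∈ (gen k {r, s}).toSubmodule from hx) hy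
  rwa [E, ← mul_assoc, ← mul_assoc, gen_mul_gen] at this

theorem E_mul_mem (hy : y ∈ E k r s t) (hx : x ∈ gen k {r, s}) : y * x ∈ E k r s t := by
  have := mul_mem_mul hy (show x ∈ (gen k {r, s}).toSubmodule from hx)
  rwa [E, mul_assoc, gen_mul_gen] at this

theorem U_le_E : U k t ≤ E k r s t := by
  intro x hx
  simpa [E] using mul_mem_mul (mul_mem_mul (one_mem_gen (k := k) {r, s}) hx)
    (one_mem_gen (k := k) {r, s})

theorem mul_mem_B₁ (hx : x ∈ gen k {r, s, t}) (hy : y ∈ B₁ k r s t w) : x * y ∈ B₁ k r s t w := by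
  have := mul_mem_mul (show x ∈ (gen k {r, s, t}).toSubmodule from hx) hy
  rwa [B₁, ← mul_assoc, ← mul_assoc, gen_mul_gen] at this

theorem B₁_mul_mem (hy : y ∈ B₁ k r s t w) (hx : x ∈ gen k {r, s, t}) : y * x ∈ B₁ k r s t w := by
  have := mul_mem_mul hy (show x ∈ (gen k {r, s, t}).toSubmodule from hx)
  rwa [B₁, mul_assoc, gen_mul_gen] at this

theorem mul_mem_B₂ (hx : x ∈ gen k {r, s, t}) (hy : y ∈ B₂ k r s t w) : x * y ∈ B₂ k r s t w := by
  have := mul_mem_mul (show x ∈ (gen k {r, s, t}).toSubmodule from hx) hy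
  rwa [B₂, B₁, ← mul_assoc, ← mul_assoc, ← mul_assoc, ← mul_assoc, gen_mul_gen] at this

theorem B₂_mul_mem (hy : y ∈ B₂ k r s t w) (hx : x ∈ gen k {r, s, t}) : y * x ∈ B₂ k r s t w := by
  have := mul_mem_mul hy (show x ∈ (gen k {r, s, t}).toSubmodule from hx)
  rwa [B₂, mul_assoc, gen_mul_gen] at this

theorem U_le_B₁ : U k w ≤ B₁ k r s t w := by
  intro x hx
  simpa [B₁] using mul_mem_mul (mul_mem_mul (one_mem_gen (k := k) {r, s, t}) hx)
    (one_mem_gen (k := k) {r, s, t})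

theorem gen_le_B₁ : (gen k {r, s, t}).toSubmodule ≤ B₁ k r s t w := by
  intro x hx
  simpa using mul_mem_B₁ hx (U_le_B₁ (one_mem_U w))

theorem B₁_le_B₂ : B₁ k r s t w ≤ B₂ k r s t w := by
  intro x hx
  simpa [B₂] using mul_mem_mul (mul_mem_mul hx (one_mem_U w)) (one_mem_gen (k := k) {r, s, t})

theorem B₁_mul_U (hx : x ∈ B₁ k r s t w) (hz : z ∈ U k w) : x * z ∈ B₂ k r s t w := by
  simpa [B₂] using mul_mem_mul (mul_mem_mul hx hz) (one_mem_gen (k := k) {r, s, t})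

theorem B₁_gen_U (hx : x ∈ B₁ k r s t w) (hy : y ∈ gen k {r, s, t}) (hz : z ∈ U k w) :
    x * y * z ∈ B₂ k r s t w :=
  B₁_mul_U (B₁_mul_mem hx hy) hz

theorem U_mul_B₁ (hx : x ∈ U k w) (hz : z ∈ B₁ k r s t w) : x * z ∈ B₂ k r s t w := by
  have := mul_mem_mul (mul_mem_mul (one_mem_gen (k := k) {r, s, t}) hx) hz
  rw [one_mul, B₁, ← mul_assoc, ← mul_assoc] at this
  exact this

theorem U_gen_B₁ (hx : x ∈ U k w) (hy : y ∈ gen k {r, s, t}) (hz : z ∈ B₁ k r s t w) :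
    x * y * z ∈ B₂ k r s t w := by
  rw [mul_assoc]
  exact U_mul_B₁ hx (mul_mem_B₁ hy hz)

theorem N_le_B₁ : N k t w ≤ B₁ k r s t w := by
  rw [N, B₁]
  gcongr <;> exact U_le_gen (by simp)

end Closure

namespace SkeinQuad

variable {q e : kˣ} {e₁ e₂ : k} {r s t w : Aˣ}

theorem inv (h : SkeinQuad q e e₁ e₂ r s t w) :
    SkeinQuad q⁻¹ e⁻¹ (↑e⁻¹ * e₂) (↑e⁻¹ * e₁) r⁻¹ s⁻¹ t⁻¹ w⁻¹ :=
  ⟨h.left.inv, h.right.inv, (Commute.inv_inv (show Commute r w from h.comm)).eq⟩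

theorem op (h : SkeinQuad q e e₁ e₂ r s t w) :
    SkeinQuad q e e₁ e₂ (opU r) (opU s) (opU t) (opU w) :=
  ⟨h.left.op, h.right.op, by rw [← opU_mul, ← opU_mul, h.comm]⟩

theorem comm_U (h : SkeinQuad q e e₁ e₂ r s t w) {x y : A} (hy : y ∈ gen k {r, s})
    (hx : x ∈ U k w) : y * x = x * y := by
  refine gen_commute_U ?_ hy hx
  rintro g (rfl | rfl)
  exacts [h.comm, h.right.comm]

/-- Exchange π for w t⁻¹ w. The elements of A₃ slide past `w`, so the first two powers of `w`
surround a power of `t` and collapse into `M k t w`: degree one, or π again. -/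
theorem U_mul_E_mul_pi (h : SkeinQuad q e e₁ e₂ r s t w) {x y : A} (hx : x ∈ U k w)
    (hy : y ∈ E k r s t) : x * y * ((kap t w : Aˣ) : A) ∈ B₂ k r s t w := by
  obtain ⟨c, hc⟩ := h.right.right.word_kap
  obtain ⟨d, hd⟩ := h.right.right.inv_word_kap
  have h1 := U_gen_B₁ hx (E_le_gen hy) (N_le_B₁ (r := r) (s := s) (sub_smul_mem_symm hc))
  rw [mul_sub, mul_smul_comm] at h1
  refine mem_of_sub_smul_mem h1 ?_
  refine (mul_mul_le.2 fun a ha y hy b hb => ?_ : E k r s t ≤ (B₂ k r s t w).comap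
    (LinearMap.mulRight k ((w * t⁻¹ * w : Aˣ) : A) ∘ₗ LinearMap.mulLeft k x)) hy
  change x * (a * y * b) * ((w * t⁻¹ * w : Aˣ) : A) ∈ B₂ k r s t w
  have e1 : x * (a * y * b) * ((w * t⁻¹ * w : Aˣ) : A) =
      a * (x * y * w * (b * ((t⁻¹ : Aˣ) : A)) * w) := by
    have hb' := h.comm_U hb (mem_U w)
    have ha' := h.comm_U ha hx
    simp only [Units.val_mul, ← mul_assoc]
    rw [← ha', mul_assoc _ b (w : A), hb']
    simp only [← mul_assoc]
  rw [e1]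
  refine mul_mem_B₂ (gen_pair_le ha) ?_
  have hbt : b * ((t⁻¹ : Aˣ) : A) ∈ gen k {r, s, t} :=
    mul_mem (gen_pair_le hb) (inv_mem_gen (by simp))
  obtain ⟨n, hn, m, hm, hnm⟩ := mem_sup.1
    (h.right.right.U_mul_U_mul_U (mul_mem_mul (mul_mem_mul hx hy) (mem_U w)))
  obtain ⟨f, rfl⟩ := mem_span_singleton.1 hm
  rw [← hnm, add_mul, add_mul, smul_mul_assoc, smul_mul_assoc]
  refine add_mem (B₁_gen_U (N_le_B₁ hn) hbt (mem_U w)) (smul_mem _ _ ?_)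
  -- The remaining π is exchanged for w⁻¹ t w⁻¹, since w⁻¹ t⁻¹ w = t w⁻¹ t⁻¹ then removes one power
  -- of `w`.
  have h2 := B₁_gen_U (N_le_B₁ (r := r) (s := s) (sub_smul_mem_symm hd)) hbt (mem_U w)
  rw [sub_mul, sub_mul, smul_mul_assoc, smul_mul_assoc] at h2
  refine mem_of_sub_smul_mem h2 ?_
  have e2 : ((w⁻¹ * t * w⁻¹ : Aˣ) : A) * (b * ((t⁻¹ : Aˣ) : A)) * w =
      ((w⁻¹ : Aˣ) : A) * (t * b) * (t * ((w⁻¹ : Aˣ) : A) * ((t⁻¹ : Aˣ) : A)) := by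
    have hb' := h.comm_U hb (inv_mem_U w)
    have b1 := congrArg (Units.val : Aˣ → A) (braid_inv_conj_inv h.right.right.braid.symm)
    simp only [Units.val_mul] at b1 ⊢
    rw [← b1]
    simp only [mul_assoc]
    rw [← mul_assoc ((w⁻¹ : Aˣ) : A) b, ← hb']
    simp only [mul_assoc]
  rw [e2]
  refine U_gen_B₁ (inv_mem_U w) (mul_mem (mem_gen (by simp)) (gen_pair_le hb)) ?_
  exact B₁_mul_mem (mul_mem_B₁ (mem_gen (by simp)) (U_le_B₁ (inv_mem_U w)))
    (inv_mem_gen (by simp))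

theorem pi_mul_E_mul_U (h : SkeinQuad q e e₁ e₂ r s t w) {x y : A} (hx : x ∈ U k w)
    (hy : y ∈ E k r s t) : ((kap t w : Aˣ) : A) * y * x ∈ B₂ k r s t w := by
  have := h.op.U_mul_E_mul_pi (x := MulOpposite.op x) (y := MulOpposite.op y)
    (by rwa [← opS_U, mem_opS]) (by rwa [← opS_E, mem_opS])
  rw [kap_op, val_opU, ← MulOpposite.op_mul, ← MulOpposite.op_mul, ← opS_B₂, mem_opS] at this
  rwa [mul_assoc]

end SkeinQuad

end SkeinAlgebra

/-! ### Words π z κ w with z in A₃ have degree at most two. -/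

namespace SkeinAlgebra

open Submodule MulOpposite

variable {k A : Type*} [CommRing k] [Ring A] [Algebra k A]

/-- The submodule of all `y` such that `x * y * z` lies in `P`. -/
def between (P : Submodule k A) (x z : A) : Submodule k A :=
  P.comap (LinearMap.mulRight k z ∘ₗ LinearMap.mulLeft k x)

theorem mem_between {P : Submodule k A} {x y z : A} : y ∈ between P x z ↔ x * y * z ∈ P := Iff.rfl

theorem kap_mem_gen {S : Set Aˣ} {s t : Aˣ} (hs : s ∈ S) (ht : t ∈ S) :
    ((kap s t : Aˣ) : A) ∈ gen k S := by
  simp only [kap, Units.val_mul]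
  exact mul_mem (mul_mem (mul_mem (mem_gen ht) (mem_gen hs)) (mem_gen hs)) (mem_gen ht)

theorem kap_inv_mem_gen {S : Set Aˣ} {s t : Aˣ} (hs : s ∈ S) (ht : t ∈ S) :
    (((kap s t)⁻¹ : Aˣ) : A) ∈ gen k S := by
  rw [← kap_inv, ← gen_inv_image]
  exact kap_mem_gen (Set.inv_mem_inv.2 hs) (Set.inv_mem_inv.2 ht)

namespace SkeinQuad

variable {q e : kˣ} {e₁ e₂ : k} {r s t w : Aˣ}

theorem xi_mem_gen : ((xi r s t : Aˣ) : A) ∈ gen k {r, s, t} := by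
  rw [xi, Units.val_mul, Units.val_mul]
  exact mul_mem (mul_mem (mem_gen (by simp)) (kap_mem_gen (by simp) (by simp)))
    (mem_gen (by simp))

theorem upsilon_mem_B₂ : ((xi s t w : Aˣ) : A) ∈ B₂ k r s t w := by
  rw [xi, Units.val_mul, Units.val_mul]
  exact B₁_gen_U (U_le_B₁ (mem_U w)) (kap_mem_gen (by simp) (by simp)) (mem_U w)

theorem inv_kap_mul (h : SkeinQuad q e e₁ e₂ r s t w) :
    ((w⁻¹ : Aˣ) : A) * ((kap s t : Aˣ) : A) * w =
      t * s * ((kap t w : Aˣ) : A) * (((s⁻¹ : Aˣ) : A) * ((t⁻¹ : Aˣ) : A)) := by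
  have := double_conj' h.right.left.braid h.right.right.braid h.right.comm
  rw [← kap, ← kap] at this
  simpa only [Units.val_mul] using congrArg Units.val this

theorem mul_xi_mul_inv (h : SkeinQuad q e e₁ e₂ r s t w) :
    w * xi r s t * w⁻¹ = t⁻¹ * s⁻¹ * r⁻¹ * xi s t w * (r * s * t) :=
  triple_conj h.left.left.braid h.left.right.braid h.right.right.braid h.left.comm h.comm
    h.right.comm

theorem inv_mul_xi_mul (h : SkeinQuad q e e₁ e₂ r s t w) :
    w⁻¹ * xi r s t * w = t * s * r * xi s t w * (r⁻¹ * s⁻¹ * t⁻¹) :=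
  triple_conj' h.left.left.braid h.left.right.braid h.right.right.braid h.left.comm h.comm
    h.right.comm

/-- To see that `π z κ w` has degree at most two, one may replace `π = w t² w` by `w t⁻¹ w`. -/
theorem pi_kap_mem_iff (h : SkeinQuad q e e₁ e₂ r s t w) {z : A} (hz : z ∈ gen k {r, s}) :
    ((kap t w : Aˣ) : A) * (z * ((kap s t : Aˣ) : A)) * w ∈ B₂ k r s t w ↔
      (w : A) * ((t⁻¹ : Aˣ) : A) * z * ((xi s t w : Aˣ) : A) ∈ B₂ k r s t w := by
  obtain ⟨c, hc⟩ := h.right.right.word_kap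
  have hzk : z * ((kap s t : Aˣ) : A) ∈ gen k {r, s, t} :=
    mul_mem (gen_pair_le hz) (kap_mem_gen (by simp) (by simp))
  have h1 := B₁_gen_U (N_le_B₁ (r := r) (s := s) hc) hzk (mem_U w)
  rw [sub_mul, sub_mul, smul_mul_assoc, smul_mul_assoc] at h1
  have e1 : ((w * t⁻¹ * w : Aˣ) : A) * (z * ((kap s t : Aˣ) : A)) * w =
      (w : A) * ((t⁻¹ : Aˣ) : A) * z * ((xi s t w : Aˣ) : A) := by
    have hz' := h.comm_U hz (mem_U w)
    simp only [xi, Units.val_mul, mul_assoc]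
    rw [← mul_assoc (w : A) z, ← hz']
    simp only [mul_assoc]
  rw [e1] at h1
  exact ⟨fun h' => mem_of_sub_smul_mem h1 h', fun h' =>
    mem_of_sub_smul_mem (sub_smul_mem_symm h1) h'⟩

/-- Here `z` commutes with the first letter `t` of κ, and π absorbs that letter up to degree one;
what stands between π and `w` has degree one in `t`. -/
theorem pi_U_kap_mem (h : SkeinQuad q e e₁ e₂ r s t w) {z : A} (hz : z ∈ U k r) :
    ((kap t w : Aˣ) : A) * (z * ((kap s t : Aˣ) : A)) * w ∈ B₂ k r s t w := by
  have hz1 : z ∈ gen k {r, s} := U_le_gen (by simp) hz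
  have e1 : ((kap t w : Aˣ) : A) * (z * ((kap s t : Aˣ) : A)) * w =
      ((kap t w : Aˣ) : A) * t * (z * s * s * t) * w := by
    have := commute_of_mem_U h.left.comm hz
    simp only [kap, Units.val_mul, mul_assoc]
    rw [← mul_assoc z (t : A), this]
    simp only [mul_assoc]
  have hE : z * s * s * t ∈ E k r s t :=
    mul_mem_E (mul_mem (mul_mem hz1 (mem_gen (by simp))) (mem_gen (by simp))) (U_le_E (mem_U t))
  have h1 := B₁_gen_U (N_le_B₁ (r := r) (s := s) h.right.right.kap_mul) (E_le_gen hE) (mem_U w)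
  rw [sub_mul, sub_mul, smul_mul_assoc, smul_mul_assoc] at h1
  rw [e1]
  exact mem_of_sub_smul_mem h1 (h.pi_mul_E_mul_U (mem_U w) hE)

/-- With π exchanged for w⁻¹ t w⁻¹, the end w⁻¹ κ w becomes a conjugate of π, and t s t = s t s
leaves a word of the type u_w E π. -/
theorem pi_mul_U_kap_mem (h : SkeinQuad q e e₁ e₂ r s t w) {z : A} (hz : z ∈ U k r) :
    ((kap t w : Aˣ) : A) * (s * z * ((kap s t : Aˣ) : A)) * w ∈ B₂ k r s t w := by
  obtain ⟨d, hd⟩ := h.right.right.inv_word_kap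
  have hz1 : z ∈ gen k {r, s} := U_le_gen (by simp) hz
  have hsz : (s : A) * z ∈ gen k {r, s} := mul_mem (mem_gen (by simp)) hz1
  have h2 := B₁_gen_U (N_le_B₁ (r := r) (s := s) (sub_smul_mem_symm hd))
    (mul_mem (gen_pair_le hsz) (kap_mem_gen (s := s) (t := t) (by simp) (by simp))) (mem_U w)
  rw [sub_mul, sub_mul, smul_mul_assoc, smul_mul_assoc] at h2
  refine mem_of_sub_smul_mem h2 ?_
  have e2 : ((w⁻¹ * t * w⁻¹ : Aˣ) : A) * (s * z * ((kap s t : Aˣ) : A)) * w =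
      s * (((w⁻¹ : Aˣ) : A) * (t * (s * z * s)) * ((kap t w : Aˣ) : A)) *
        (((s⁻¹ : Aˣ) : A) * ((t⁻¹ : Aˣ) : A)) := by
    have hb' := h.comm_U hsz (inv_mem_U w)
    have hs := h.comm_U (y := (s : A)) (mem_gen (by simp)) (inv_mem_U w)
    have ht := commute_of_mem_U h.left.comm hz
    have b1 := h.inv_kap_mul
    have b2 : (t : A) * s * t = s * t * s := by
      simpa using congrArg Units.val h.left.right.braid.symm
    calc ((w⁻¹ * t * w⁻¹ : Aˣ) : A) * (s * z * ((kap s t : Aˣ) : A)) * w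
        = ((w⁻¹ : Aˣ) : A) * t * (((w⁻¹ : Aˣ) : A) * (s * z)) * ((kap s t : Aˣ) : A) * w := by
          simp only [Units.val_mul, mul_assoc]
      _ = ((w⁻¹ : Aˣ) : A) * t * (s * z) * (((w⁻¹ : Aˣ) : A) * ((kap s t : Aˣ) : A) * w) := by
          rw [← hb']; simp only [mul_assoc]
      _ = ((w⁻¹ : Aˣ) : A) * t * s * (z * t) * s * ((kap t w : Aˣ) : A) *
            (((s⁻¹ : Aˣ) : A) * ((t⁻¹ : Aˣ) : A)) := by
          rw [b1]; simp only [mul_assoc]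
      _ = ((w⁻¹ : Aˣ) : A) * (t * s * t) * z * s * ((kap t w : Aˣ) : A) *
            (((s⁻¹ : Aˣ) : A) * ((t⁻¹ : Aˣ) : A)) := by
          rw [ht]; simp only [mul_assoc]
      _ = _ := by
          rw [b2, mul_assoc (s : A) t, ← mul_assoc ((w⁻¹ : Aˣ) : A) s, ← hs]
          simp only [mul_assoc]
  rw [e2]
  refine B₂_mul_mem (mul_mem_B₂ (mem_gen (by simp)) (h.U_mul_E_mul_pi (inv_mem_U w) ?_))
    (mul_mem (inv_mem_gen (by simp)) (inv_mem_gen (by simp)))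
  exact E_mul_mem (U_le_E (mem_U t)) (mul_mem hsz (mem_gen (by simp)))

/-- Let Y = w ξ w⁻¹, a conjugate of υ. Then w⁻² Y = w⁻¹ ξ w⁻¹, Y and w⁻¹ Y all have degree at most
two, so the cubic relation for w⁻¹ gives the same for w Y. -/
theorem mul_inv_inv_inv_upsilon_mem (h : SkeinQuad q e e₁ e₂ r s t w) :
    (w : A) * ((t⁻¹ : Aˣ) : A) * (((s⁻¹ : Aˣ) : A) * ((r⁻¹ : Aˣ) : A)) *
      ((xi s t w : Aˣ) : A) ∈ B₂ k r s t w := by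
  have cub := h.right.right.cubic_right.inv
  set Y : A := ((t⁻¹ * s⁻¹ * r⁻¹ * xi s t w * (r * s * t) : Aˣ) : A) with hY
  have h1 : ((w⁻¹ : Aˣ) : A) * ((xi r s t : Aˣ) : A) * ((w⁻¹ : Aˣ) : A) =
      ((w⁻¹ * w⁻¹ : Aˣ) : A) * Y := by
    rw [hY, ← h.mul_xi_mul_inv]
    simp only [← Units.val_mul, mul_assoc, inv_mul_cancel_left]
  have h2 : ((w⁻¹ : Aˣ) : A) * ((xi r s t : Aˣ) : A) * ((w⁻¹ : Aˣ) : A) ∈ B₂ k r s t w :=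
    B₁_gen_U (U_le_B₁ (inv_mem_U w)) xi_mem_gen (inv_mem_U w)
  have hl : ((t⁻¹ * s⁻¹ * r⁻¹ : Aˣ) : A) ∈ gen k {r, s, t} := by
    simp only [Units.val_mul]
    exact mul_mem (mul_mem (inv_mem_gen (by simp)) (inv_mem_gen (by simp)))
      (inv_mem_gen (by simp))
  have hr : ((r * s * t : Aˣ) : A) ∈ gen k {r, s, t} := by
    simp only [Units.val_mul]
    exact mul_mem (mul_mem (mem_gen (by simp)) (mem_gen (by simp))) (mem_gen (by simp))
  have hr' : (((r * s * t)⁻¹ : Aˣ) : A) ∈ gen k {r, s, t} := by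
    simp only [mul_inv_rev, Units.val_mul]
    exact mul_mem (inv_mem_gen (by simp)) (mul_mem (inv_mem_gen (by simp))
      (inv_mem_gen (by simp)))
  have h3 : Y ∈ B₂ k r s t w := by
    rw [hY, Units.val_mul, Units.val_mul]
    exact B₂_mul_mem (mul_mem_B₂ hl upsilon_mem_B₂) hr
  have h4 : ((w⁻¹ : Aˣ) : A) * Y ∈ B₂ k r s t w := by
    have e1 : ((w⁻¹ : Aˣ) : A) * Y = ((w⁻¹ : Aˣ) : A) * ((t⁻¹ : Aˣ) : A) * w *
        (((s⁻¹ * r⁻¹ : Aˣ) : A) * ((kap s t : Aˣ) : A)) * w * ((r * s * t : Aˣ) : A) := by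
      have hc := h.comm_U (y := ((s⁻¹ * r⁻¹ : Aˣ) : A)) (by
        rw [Units.val_mul]
        exact mul_mem (inv_mem_gen (by simp)) (inv_mem_gen (by simp))) (mem_U w)
      calc ((w⁻¹ : Aˣ) : A) * Y = ((w⁻¹ : Aˣ) : A) * ((t⁻¹ : Aˣ) : A) *
            (((s⁻¹ * r⁻¹ : Aˣ) : A) * w) * ((kap s t : Aˣ) : A) * w * ((r * s * t : Aˣ) : A) := by
            rw [hY, xi]; simp only [Units.val_mul, mul_assoc]
        _ = _ := by rw [hc]; simp only [mul_assoc]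
    rw [e1]
    refine B₂_mul_mem (B₁_gen_U (N_le_B₁ (h.right.right.inv_mul_U_mul (inv_mem_U t))) ?_
      (mem_U w)) hr
    rw [Units.val_mul]
    exact mul_mem (mul_mem (inv_mem_gen (by simp)) (inv_mem_gen (by simp)))
      (kap_mem_gen (by simp) (by simp))
  have h5 : (w : A) * Y ∈ B₂ k r s t w := by
    rw [h1, cub] at h2
    simp only [add_mul, sub_mul, smul_mul_assoc, one_mul, inv_inv] at h2
    have h6 := smul_mem _ (e : k) (sub_mem h2 (sub_mem (smul_mem _ (↑e⁻¹ * e₂) h4)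
      (smul_mem _ (↑e⁻¹ * e₁) h3)))
    rwa [add_sub_cancel_left, smul_smul, Units.mul_inv, one_smul] at h6
  have h6 := B₂_mul_mem h5 hr'
  convert h6 using 1
  rw [hY]
  simp only [← Units.val_mul, mul_assoc, mul_inv_cancel, mul_one]

/-- In the form w t⁻¹ z υ, with `z` in `M k s r`, powers of `s` on the right of `z` commute with υ
and powers of `r` on its left slide out. Only the words s^i r^j remain, and i = -1, j = -1 is the
exceptional case treated above. -/
theorem pi_gen_kap_mem (h : SkeinQuad q e e₁ e₂ r s t w) {z : A} (hz : z ∈ gen k {r, s}) :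
    ((kap t w : Aˣ) : A) * (z * ((kap s t : Aˣ) : A)) * w ∈ B₂ k r s t w := by
  rw [h.pi_kap_mem_iff hz]
  have hY : ∀ x ∈ U k s, x * ((xi s t w : Aˣ) : A) = ((xi s t w : Aˣ) : A) * x := fun x hx =>
    h.right.xi_comm (U_le_gen (by simp) hx)
  have hr : ∀ x ∈ U k r, x * ((w : A) * ((t⁻¹ : Aˣ) : A)) = (w : A) * ((t⁻¹ : Aˣ) : A) * x := by
    intro x hx
    rw [← mul_assoc, commute_of_mem_U h.comm hx, mul_assoc,
      commute_of_mem_U (Commute.inv_right (show Commute r t from h.left.comm)).eq hx, mul_assoc]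
  have genr : ∀ x ∈ U k r, x ∈ gen k {r, s} := fun x hx => U_le_gen (by simp) hx
  have gens : ∀ x ∈ U k s, x ∈ gen k {r, s} := fun x hx => U_le_gen (by simp) hx
  have one : ∀ y ∈ U k r, (w : A) * ((t⁻¹ : Aˣ) : A) * y * ((xi s t w : Aˣ) : A) ∈
      B₂ k r s t w := fun y hy => (h.pi_kap_mem_iff (genr y hy)).1 (h.pi_U_kap_mem hy)
  have pos : ∀ y ∈ U k r, (w : A) * ((t⁻¹ : Aˣ) : A) * (s * y) * ((xi s t w : Aˣ) : A) ∈
      B₂ k r s t w := fun y hy => (h.pi_kap_mem_iff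
    (mul_mem (gens _ (mem_U s)) (genr y hy))).1 (h.pi_mul_U_kap_mem hy)
  have neg : ∀ y ∈ U k r, (w : A) * ((t⁻¹ : Aˣ) : A) * (((s⁻¹ : Aˣ) : A) * y) *
      ((xi s t w : Aˣ) : A) ∈ B₂ k r s t w := by
    intro y hy
    have key : U k r ≤ between (B₂ k r s t w)
        ((w : A) * ((t⁻¹ : Aˣ) : A) * ((s⁻¹ : Aˣ) : A)) ((xi s t w : Aˣ) : A) := by
      refine U_le.2 ⟨?_, ?_, ?_⟩ <;> rw [mem_between]
      · have := B₂_mul_mem (one 1 (one_mem_U r)) (gen_pair_le (gens _ (inv_mem_U s)))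
        rw [mul_assoc _ ((xi s t w : Aˣ) : A), ← hY _ (inv_mem_U s), mul_one, ← mul_assoc] at this
        rwa [mul_one]
      -- The identity s⁻¹ r = r s r⁻¹ s⁻¹ reduces this case to `pos`.
      · have := B₂_mul_mem (mul_mem_B₂ (gen_pair_le (genr _ (mem_U r))) (pos _ (inv_mem_U r)))
          (gen_pair_le (gens _ (inv_mem_U s)))
        convert this using 1
        have b1 : ((s⁻¹ : Aˣ) : A) * r = r * s * ((r⁻¹ : Aˣ) : A) * ((s⁻¹ : Aˣ) : A) := by
          have := braid_inv_conj h.left.left.braid.symm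
          rw [← eq_mul_inv_iff_mul_eq] at this
          simpa only [Units.val_mul] using congrArg Units.val this
        calc (w : A) * ((t⁻¹ : Aˣ) : A) * ((s⁻¹ : Aˣ) : A) * r * ((xi s t w : Aˣ) : A)
            = (w : A) * ((t⁻¹ : Aˣ) : A) * (((s⁻¹ : Aˣ) : A) * r) * ((xi s t w : Aˣ) : A) := by
              simp only [mul_assoc]
          _ = (w : A) * ((t⁻¹ : Aˣ) : A) * r * (s * ((r⁻¹ : Aˣ) : A)) *
                (((s⁻¹ : Aˣ) : A) * ((xi s t w : Aˣ) : A)) := by rw [b1]; simp only [mul_assoc]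
          _ = _ := by rw [hY _ (inv_mem_U s), ← hr _ (mem_U r)]; simp only [mul_assoc]
      · simpa only [mul_assoc] using h.mul_inv_inv_inv_upsilon_mem
    simpa only [mul_assoc] using mem_between.1 (key hy)
  have hN : N k s r ≤ between (B₂ k r s t w) ((w : A) * ((t⁻¹ : Aˣ) : A))
      ((xi s t w : Aˣ) : A) := by
    refine mul_mul_le.2 fun x hx y hy z hz => ?_
    have key : U k s ≤ between (B₂ k r s t w) ((w : A) * ((t⁻¹ : Aˣ) : A))
        (y * ((xi s t w : Aˣ) : A)) := by
      refine U_le.2 ⟨?_, ?_, ?_⟩ <;> rw [mem_between]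
      · simpa [mul_assoc] using one y hy
      · simpa [mul_assoc] using pos y hy
      · simpa [mul_assoc] using neg y hy
    have := B₂_mul_mem (mem_between.1 (key hx)) (gen_pair_le (gens z hz))
    simp only [mul_assoc] at this
    rw [← hY z hz] at this
    simpa only [mem_between, mul_assoc] using this
  refine (M_le hN ?_) (h.left.left.symm.gen_le_M (by rwa [Set.pair_comm]))
  -- The last generator r s² r is exchanged for r s⁻¹ r, whose first `r` slides out to the left.
  obtain ⟨c, hc⟩ := h.left.left.symm.word_kap
  refine mem_of_sub_smul_mem (hN (sub_smul_mem_symm hc)) ?_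
  have := mul_mem_B₂ (gen_pair_le (genr _ (mem_U r))) (neg r (mem_U r))
  simp only [← mul_assoc] at this
  rw [mul_assoc (r : A), hr _ (mem_U r)] at this
  simpa only [mem_between, Units.val_mul, mul_assoc] using this

end SkeinQuad

end SkeinAlgebra

/-! ### Multiplying υ by u_w E, and π by u_w A₄, stays in degree two. -/

namespace SkeinAlgebra

open Submodule MulOpposite

variable {k A : Type*} [CommRing k] [Ring A] [Algebra k A]

theorem N_le_E {r s t : Aˣ} : N k s t ≤ E k r s t := by
  rw [N, E]
  gcongr <;> exact U_le_gen (by simp)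

namespace SkeinQuad

variable {q e : kˣ} {e₁ e₂ : k} {r s t w : Aˣ}

/-- Since υ = w κ w, the first two powers of `w` collapse into `M k t w`, and the surviving words
are the π b κ w just treated. -/
theorem U_mul_E_mul_upsilon (h : SkeinQuad q e e₁ e₂ r s t w) {x y : A} (hx : x ∈ U k w)
    (hy : y ∈ E k r s t) : x * y * ((xi s t w : Aˣ) : A) ∈ B₂ k r s t w := by
  refine (mul_mul_le.2 fun a ha y hy b hb => ?_ :
    E k r s t ≤ between (B₂ k r s t w) x ((xi s t w : Aˣ) : A)) hy
  have e1 : x * (a * y * b) * ((xi s t w : Aˣ) : A) =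
      a * (x * y * w * (b * ((kap s t : Aˣ) : A)) * w) := by
    have hb' := h.comm_U hb (mem_U w)
    have ha' := h.comm_U ha hx
    simp only [xi, Units.val_mul, ← mul_assoc]
    rw [← ha', mul_assoc _ b (w : A), hb']
    simp only [← mul_assoc]
  rw [mem_between, e1]
  refine mul_mem_B₂ (gen_pair_le ha) ?_
  have hbk : b * ((kap s t : Aˣ) : A) ∈ gen k {r, s, t} :=
    mul_mem (gen_pair_le hb) (kap_mem_gen (by simp) (by simp))
  obtain ⟨n, hn, m, hm, hnm⟩ := mem_sup.1
    (h.right.right.U_mul_U_mul_U (mul_mem_mul (mul_mem_mul hx hy) (mem_U w)))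
  obtain ⟨f, rfl⟩ := mem_span_singleton.1 hm
  rw [← hnm, add_mul, add_mul, smul_mul_assoc, smul_mul_assoc]
  exact add_mem (B₁_gen_U (N_le_B₁ hn) hbk (mem_U w)) (smul_mem _ _ (h.pi_gen_kap_mem hb))

theorem upsilon_mul_E_mul_U (h : SkeinQuad q e e₁ e₂ r s t w) {x y : A} (hx : x ∈ U k w)
    (hy : y ∈ E k r s t) : ((xi s t w : Aˣ) : A) * y * x ∈ B₂ k r s t w := by
  have := h.op.U_mul_E_mul_upsilon (x := MulOpposite.op x) (y := MulOpposite.op y)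
    (by rwa [← opS_U, mem_opS]) (by rwa [← opS_E, mem_opS])
  rw [xi_op, val_opU, ← MulOpposite.op_mul, ← MulOpposite.op_mul, ← opS_B₂, mem_opS] at this
  rwa [mul_assoc]

theorem pi_gen_M_mem (h : SkeinQuad q e e₁ e₂ r s t w) {z m : A} (hz : z ∈ gen k {r, s})
    (hm : m ∈ M k s t) : ((kap t w : Aˣ) : A) * (z * m) * w ∈ B₂ k r s t w := by
  have : M k s t ≤ between (B₂ k r s t w) (((kap t w : Aˣ) : A) * z) w := by
    refine M_le (fun n hn => ?_) ?_
    · simpa only [mem_between, mul_assoc] using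
        h.pi_mul_E_mul_U (mem_U w) (mul_mem_E hz (N_le_E hn))
    · simpa only [mem_between, mul_assoc] using h.pi_gen_kap_mem hz
  simpa only [mem_between, mul_assoc] using this hm

/-- For `b` in `N k r s` the powers of `r` slide outwards and t⁻¹ s^j t⁻¹ lies in `M k s t`. The
remaining generator is taken as the inverse of `kap r s`, which makes t⁻¹ b t⁻¹ = ξ⁻¹: it commutes
with s⁻¹, and π absorbs its first letter. -/
theorem pi_conj_mem (h : SkeinQuad q e e₁ e₂ r s t w) {b : A} (hb : b ∈ gen k {r, s}) :
    ((kap t w : Aˣ) : A) * (((s⁻¹ : Aˣ) : A) * (((t⁻¹ : Aˣ) : A) * b * ((t⁻¹ : Aˣ) : A))) * w ∈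
      B₂ k r s t w := by
  have hs : ((s⁻¹ : Aˣ) : A) ∈ gen k {r, s} := inv_mem_gen (by simp)
  have key : N k r s ≤ between (B₂ k r s t w)
      (((kap t w : Aˣ) : A) * (((s⁻¹ : Aˣ) : A) * ((t⁻¹ : Aˣ) : A))) (((t⁻¹ : Aˣ) : A) * w) := by
    refine mul_mul_le.2 fun x hx y hy z hz => ?_
    have hx1 : x ∈ gen k {r, s} := U_le_gen (by simp) hx
    have hz1 : z ∈ gen k {r, s} := U_le_gen (by simp) hz
    have c := (Commute.inv_right (show Commute r t from h.left.comm)).eq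
    have hx' := commute_of_mem_U c hx
    have hz' := commute_of_mem_U c hz
    have hw := h.comm_U hz1 (mem_U w)
    have := B₂_mul_mem (h.pi_gen_M_mem (mul_mem hs hx1) (h.left.right.U_mul_U_mul_U
      (mul_mem_mul (mul_mem_mul (inv_mem_U t) hy) (inv_mem_U t)))) (gen_pair_le hz1)
    rw [mem_between]
    convert this using 1
    simp only [mul_assoc]
    rw [← hw, ← mul_assoc ((t⁻¹ : Aˣ) : A) x, ← hx', ← mul_assoc z, hz']
    simp only [mul_assoc]
  have hM : M k r s ≤ between (B₂ k r s t w)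
      (((kap t w : Aˣ) : A) * (((s⁻¹ : Aˣ) : A) * ((t⁻¹ : Aˣ) : A))) (((t⁻¹ : Aˣ) : A) * w) := by
    refine M_le key ?_
    obtain ⟨c, hc⟩ := h.left.left.kap_inv_kap
    refine mem_of_sub_smul_mem (key (sub_smul_mem_symm hc)) ?_
    have hE : (((kap r s)⁻¹ : Aˣ) : A) * ((t⁻¹ : Aˣ) : A) ∈ E k r s t :=
      mul_mem_E (kap_inv_mem_gen (by simp) (by simp)) (U_le_E (inv_mem_U t))
    have h1 := B₁_gen_U (N_le_B₁ (r := r) (s := s) h.right.right.kap_mul_inv) (E_le_gen hE)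
      (mem_U w)
    rw [sub_mul, sub_mul, smul_mul_assoc, smul_mul_assoc] at h1
    have h2 := B₂_mul_mem (mem_of_sub_smul_mem h1 (h.pi_mul_E_mul_U (mem_U w) hE))
      (gen_pair_le hs)
    rw [mem_between]
    convert h2 using 1
    have hX := h.left.xi_inv_comm hs
    have hw := h.comm_U hs (mem_U w)
    calc _ = ((kap t w : Aˣ) : A) * (((s⁻¹ : Aˣ) : A) * (((xi r s t)⁻¹ : Aˣ) : A)) * w := by
          simp only [xi, mul_inv_rev, Units.val_mul, mul_assoc]
      _ = ((kap t w : Aˣ) : A) * (((xi r s t)⁻¹ : Aˣ) : A) * (((s⁻¹ : Aˣ) : A) * w) := by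
          rw [hX]; simp only [mul_assoc]
      _ = _ := by rw [hw]; simp only [xi, mul_inv_rev, Units.val_mul, mul_assoc]
  simpa only [mem_between, mul_assoc] using hM (h.left.left.gen_le_M hb)

/-- With π exchanged for w t⁻¹ w, the case `x = w` produces υ, and the case `x = w⁻¹` produces a
conjugate of π followed by the word of `pi_conj_mem`. -/
theorem U_mul_kap_mul_pi (h : SkeinQuad q e e₁ e₂ r s t w) {x b : A} (hx : x ∈ U k w)
    (hb : b ∈ gen k {r, s}) :
    x * (((kap s t : Aˣ) : A) * b) * ((kap t w : Aˣ) : A) ∈ B₂ k r s t w := by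
  have hk : ((kap s t : Aˣ) : A) * b ∈ gen k {r, s, t} :=
    mul_mem (kap_mem_gen (by simp) (by simp)) (gen_pair_le hb)
  have hbw := h.comm_U hb (mem_U w)
  obtain ⟨c, hc⟩ := h.right.right.word_kap
  have h1 := U_gen_B₁ hx hk (N_le_B₁ (r := r) (s := s) (sub_smul_mem_symm hc))
  rw [mul_sub, mul_smul_comm] at h1
  refine mem_of_sub_smul_mem h1 ?_
  rw [mul_assoc]
  refine (U_le.2 ⟨?_, ?_, ?_⟩ : U k w ≤ (B₂ k r s t w).comap (LinearMap.mulRight k _)) hx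
  · rw [mem_comap, LinearMap.mulRight_apply, one_mul]
    refine mul_mem_B₂ hk ?_
    rw [Units.val_mul, Units.val_mul]
    exact B₁_gen_U (U_le_B₁ (mem_U w)) (inv_mem_gen (by simp)) (mem_U w)
  · have := h.upsilon_mul_E_mul_U (mem_U w) (mul_mem_E hb (U_le_E (inv_mem_U t)))
    rw [mem_comap, LinearMap.mulRight_apply]
    convert this using 1
    simp only [xi, Units.val_mul, mul_assoc]
    rw [← mul_assoc b, hbw]
    simp only [mul_assoc]
  · have := mul_mem_B₂ (mul_mem (mem_gen (g := t) (by simp)) (mem_gen (g := s) (by simp)))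
      (h.pi_conj_mem hb)
    rw [mem_comap, LinearMap.mulRight_apply]
    convert this using 1
    have b1 := h.inv_kap_mul
    calc _ = ((w⁻¹ : Aˣ) : A) * ((kap s t : Aˣ) : A) * (b * w) * ((t⁻¹ : Aˣ) : A) * w := by
          simp only [Units.val_mul, mul_assoc]
      _ = ((w⁻¹ : Aˣ) : A) * ((kap s t : Aˣ) : A) * w * b * ((t⁻¹ : Aˣ) : A) * w := by
          rw [hbw]; simp only [mul_assoc]
      _ = _ := by rw [b1]; simp only [mul_assoc]

/-- Run through the normal form `D` of A₄. The words ξ and ξ⁻¹ reduce to degree one in `t`, because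
π absorbs their last letter. -/
theorem U_mul_gen_mul_pi (h : SkeinQuad q e e₁ e₂ r s t w) {x y : A} (hx : x ∈ U k w)
    (hy : y ∈ gen k {r, s, t}) : x * y * ((kap t w : Aˣ) : A) ∈ B₂ k r s t w := by
  have low : ∀ z ∈ E k r s t, ∀ p : A, ∀ c : k,
      p - c • ((kap t w : Aˣ) : A) ∈ N k t w → x * z * p ∈ B₂ k r s t w := by
    intro z hz p c hp
    have h1 := U_gen_B₁ hx (E_le_gen hz) (N_le_B₁ (r := r) (s := s) hp)
    rw [mul_sub, mul_smul_comm] at h1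
    exact mem_of_sub_smul_mem h1 (h.U_mul_E_mul_pi hx hz)
  have hX : ∀ X : A, x * X * ((kap t w : Aˣ) : A) ∈ B₂ k r s t w →
      (gen k {r, s}).toSubmodule * span k {X} ≤
        between (B₂ k r s t w) x ((kap t w : Aˣ) : A) := by
    intro X hX y hy
    obtain ⟨z, hz, rfl⟩ := mem_mul_span_singleton.1 hy
    rw [mem_between, ← mul_assoc, ← h.comm_U hz hx]
    simpa only [mul_assoc] using mul_mem_B₂ (gen_pair_le hz) hX
  refine (sup_le ?_ (sup_le (hX _ ?_) (hX _ ?_)) :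
    D k r s t ≤ between (B₂ k r s t w) x ((kap t w : Aˣ) : A)) (h.left.gen_le_D hy)
  · refine mul_mul_le.2 fun a ha m hm b hb => ?_
    have : M k s t ≤ between (between (B₂ k r s t w) x ((kap t w : Aˣ) : A)) a b := by
      refine M_le (fun n hn => ?_) ?_
      · exact h.U_mul_E_mul_pi hx (E_mul_mem (mul_mem_E ha (N_le_E hn)) hb)
      · rw [mem_between, mem_between, mul_assoc a, ← mul_assoc x a, ← h.comm_U ha hx]
        simpa only [mul_assoc] using mul_mem_B₂ (gen_pair_le ha) (h.U_mul_kap_mul_pi hx hb)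
    exact this (h.left.right.U_mul_U_mul_U hm)
  · have := low (t * ((kap r s : Aˣ) : A)) (E_mul_mem (U_le_E (mem_U t))
      (kap_mem_gen (by simp) (by simp))) _ _ h.right.right.mul_kap
    simpa only [xi, Units.val_mul, mul_assoc] using this
  · have := low (((t⁻¹ : Aˣ) : A) * (((kap r s)⁻¹ : Aˣ) : A)) (E_mul_mem (U_le_E (inv_mem_U t))
      (kap_inv_mem_gen (by simp) (by simp))) _ _ h.right.right.inv_mul_kap
    simpa only [xi, mul_inv_rev, Units.val_mul, mul_assoc] using this

theorem pi_mul_gen_mul_U (h : SkeinQuad q e e₁ e₂ r s t w) {x y : A} (hx : x ∈ U k w)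
    (hy : y ∈ gen k {r, s, t}) : ((kap t w : Aˣ) : A) * y * x ∈ B₂ k r s t w := by
  have := h.op.U_mul_gen_mul_pi (x := MulOpposite.op x) (y := MulOpposite.op y)
    (by rwa [← opS_U, mem_opS]) (by
      rw [← Subalgebra.mem_toSubmodule, ← opS_gen_triple, mem_opS]; exact hy)
  rw [kap_op, val_opU, ← MulOpposite.op_mul, ← MulOpposite.op_mul, ← opS_B₂, mem_opS] at this
  rwa [mul_assoc]

end SkeinQuad

end SkeinAlgebra

/-! ### The degree-three word ω and the bimodule `O`. -/

namespace SkeinAlgebra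

open Submodule MulOpposite

variable {k A : Type*} [CommRing k] [Ring A] [Algebra k A]

/-- The bimodule generated by the words of degree at most one in `w` and the word `w t² w`. -/
def G (k : Type*) {A : Type*} [CommRing k] [Ring A] [Algebra k A] (r s t w : Aˣ) :
    Submodule k A :=
  B₁ k r s t w ⊔ (gen k {r, s, t}).toSubmodule * span k {((kap t w : Aˣ) : A)} *
    (gen k {r, s, t}).toSubmodule

theorem B₂_mul_gen {r s t w : Aˣ} :
    B₂ k r s t w * (gen k {r, s, t}).toSubmodule = B₂ k r s t w := by
  simp only [B₂, mul_assoc, gen_mul_gen]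

/-- The word of degree three `w (t⁻¹ s t⁻¹) (r s⁻¹ r) w t s² t w`. -/
def om (r s t w : Aˣ) : Aˣ := w * (t⁻¹ * s * t⁻¹ * (r * s⁻¹ * r)) * xi s t w

/-- Words of degree at most two in `w`, together with the right multiples of `om r s t w`. -/
def O (k : Type*) {A : Type*} [CommRing k] [Ring A] [Algebra k A] (r s t w : Aˣ) :
    Submodule k A :=
  B₂ k r s t w ⊔ span k {((om r s t w : Aˣ) : A)} * (gen k {r, s, t}).toSubmodule

section Closure

variable {r s t w : Aˣ} {x y z : A}

theorem mul_mem_G (hx : x ∈ gen k {r, s, t}) (hy : y ∈ G k r s t w) : x * y ∈ G k r s t w := by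
  have : (gen k {r, s, t}).toSubmodule * G k r s t w = G k r s t w := by
    simp only [G, B₁, Submodule.mul_sup, ← mul_assoc, gen_mul_gen]
  rw [← this]
  exact mul_mem_mul hx hy

theorem G_mul_mem (hy : y ∈ G k r s t w) (hx : x ∈ gen k {r, s, t}) : y * x ∈ G k r s t w := by
  have : G k r s t w * (gen k {r, s, t}).toSubmodule = G k r s t w := by
    simp only [G, B₁, Submodule.sup_mul, mul_assoc, gen_mul_gen]
  rw [← this]
  exact mul_mem_mul hy hx

theorem B₁_le_G : B₁ k r s t w ≤ G k r s t w := le_sup_left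

theorem pi_mem_G : ((kap t w : Aˣ) : A) ∈ G k r s t w := by
  refine mem_sup_right ?_
  simpa using mul_mem_mul (mul_mem_mul (one_mem_gen (k := k) {r, s, t})
    (mem_span_singleton_self (R := k) ((kap t w : Aˣ) : A))) (one_mem_gen (k := k) {r, s, t})

theorem B₂_le_O : B₂ k r s t w ≤ O k r s t w := le_sup_left

theorem om_mem_O : ((om r s t w : Aˣ) : A) ∈ O k r s t w := by
  refine mem_sup_right ?_
  simpa using mul_mem_mul (mem_span_singleton_self (R := k) ((om r s t w : Aˣ) : A))
    (one_mem_gen (k := k) {r, s, t})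

theorem O_mul_mem (hy : y ∈ O k r s t w) (hx : x ∈ gen k {r, s, t}) : y * x ∈ O k r s t w := by
  have : O k r s t w * (gen k {r, s, t}).toSubmodule = O k r s t w := by
    simp only [O, Submodule.sup_mul, B₂_mul_gen, mul_assoc, gen_mul_gen]
  rw [← this]
  exact mul_mem_mul hy hx

end Closure

namespace SkeinQuad

variable {q e : kˣ} {e₁ e₂ : k} {r s t w : Aˣ}

theorem U_mul_gen_mul_G (h : SkeinQuad q e e₁ e₂ r s t w) {x y z : A} (hx : x ∈ U k w)
    (hy : y ∈ gen k {r, s, t}) (hz : z ∈ G k r s t w) : x * y * z ∈ B₂ k r s t w := by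
  refine (sup_le ?_ ?_ : G k r s t w ≤ (B₂ k r s t w).comap (LinearMap.mulLeft k (x * y))) hz
  · exact fun z hz => U_gen_B₁ hx hy hz
  · refine mul_mul_le.2 fun a ha p hp b hb => ?_
    obtain ⟨c, rfl⟩ := mem_span_singleton.1 hp
    have := smul_mem _ c (B₂_mul_mem (h.U_mul_gen_mul_pi hx (mul_mem hy ha)) hb)
    simpa only [mem_comap, LinearMap.mulLeft_apply, mul_smul_comm, smul_mul_assoc, mul_assoc]
      using this

theorem G_mul_gen_mul_U (h : SkeinQuad q e e₁ e₂ r s t w) {x y z : A} (hz : z ∈ G k r s t w)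
    (hy : y ∈ gen k {r, s, t}) (hx : x ∈ U k w) : z * y * x ∈ B₂ k r s t w := by
  rw [mul_assoc]
  refine (sup_le ?_ ?_ : G k r s t w ≤ (B₂ k r s t w).comap (LinearMap.mulRight k (y * x))) hz
  · intro z hz
    simpa only [mem_comap, LinearMap.mulRight_apply, mul_assoc] using B₁_gen_U hz hy hx
  · refine mul_mul_le.2 fun a ha p hp b hb => ?_
    obtain ⟨c, rfl⟩ := mem_span_singleton.1 hp
    have := smul_mem _ c (mul_mem_B₂ ha (h.pi_mul_gen_mul_U hx (mul_mem hb hy)))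
    simpa only [mem_comap, LinearMap.mulRight_apply, mul_smul_comm, smul_mul_assoc, mul_assoc]
      using this

theorem D₀_le_G (h : SkeinQuad q e e₁ e₂ r s t w) : D₀ k s t w ≤ G k r s t w := by
  refine mul_mul_le.2 fun x hx y hy z hz => ?_
  have : M k t w ≤ G k r s t w := M_le (N_le_B₁.trans B₁_le_G) pi_mem_G
  exact G_mul_mem (mul_mem_G (gen_pair_le' hx) (this (h.right.right.U_mul_U_mul_U hy)))
    (gen_pair_le' hz)

/-- Sandwich s κ ≡ q κ modulo `N k s t` between two letters `w`, which commute with `s`. -/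
theorem mul_upsilon (h : SkeinQuad q e e₁ e₂ r s t w) :
    (s : A) * ((xi s t w : Aˣ) : A) - (q : k) • ((xi s t w : Aˣ) : A) ∈ G k r s t w := by
  have := h.D₀_le_G (h.right.mul_N_mul h.left.right.mul_kap (Or.inl rfl) (Or.inl rfl))
  convert this using 1
  have hs : (s : A) * w = w * s := by simpa using congrArg Units.val h.right.comm
  simp only [xi, Units.val_mul, mul_sub, sub_mul, mul_smul_comm, smul_mul_assoc, ← mul_assoc, hs]

/-- The braid `s * t` commutes with υ and conjugates `s` to `t`, so the previous congruence is
transported. -/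
theorem mul_upsilon' (h : SkeinQuad q e e₁ e₂ r s t w) :
    (t : A) * ((xi s t w : Aˣ) : A) - (q : k) • ((xi s t w : Aˣ) : A) ∈ G k r s t w := by
  have h1 : ((s * t : Aˣ) : A) ∈ gen k {s, t} := by
    rw [Units.val_mul]; exact mul_mem (mem_gen (by simp)) (mem_gen (by simp))
  have h2 : (((s * t)⁻¹ : Aˣ) : A) ∈ gen k {s, t} := by
    rw [mul_inv_rev, Units.val_mul]; exact mul_mem (inv_mem_gen (by simp)) (inv_mem_gen (by simp))
  have := G_mul_mem (mul_mem_G (gen_pair_le' h1) h.mul_upsilon) (gen_pair_le' h2)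
  convert this using 1
  have e1 : s * t * s * (s * t)⁻¹ = t := by
    rw [h.left.right.braid]; group
  have hY := h.right.xi_comm h2
  have e2 : ((s * t : Aˣ) : A) * (((s * t)⁻¹ : Aˣ) : A) = 1 := Units.mul_inv _
  rw [mul_sub, sub_mul, mul_smul_comm, smul_mul_assoc, mul_assoc _ ((xi s t w : Aˣ) : A), ← hY,
    mul_assoc _ _ (((s * t)⁻¹ : Aˣ) : A), mul_assoc _ _ (((s * t)⁻¹ : Aˣ) : A), ← hY,
    ← mul_assoc ((s * t : Aˣ) : A) (((s * t)⁻¹ : Aˣ) : A), e2, one_mul, ← mul_assoc, ← mul_assoc]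
  simp only [← Units.val_mul, e1]

theorem gen_mul_upsilon (h : SkeinQuad q e e₁ e₂ r s t w) {x : A} (hx : x ∈ gen k {s, t}) :
    x * ((xi s t w : Aˣ) : A) ∈ G k r s t w ⊔ span k {((xi s t w : Aˣ) : A)} := by
  refine mul_mem_of_left_stable ?_ hx (mem_sup_right (mem_span_singleton_self _))
  have key : ∀ g : Aˣ, (g : A) ∈ gen k {r, s, t} → ((g⁻¹ : Aˣ) : A) ∈ gen k {r, s, t} →
      (g : A) * ((xi s t w : Aˣ) : A) - (q : k) • ((xi s t w : Aˣ) : A) ∈ G k r s t w →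
      ∀ y ∈ G k r s t w ⊔ span k {((xi s t w : Aˣ) : A)},
      (g : A) * y ∈ G k r s t w ⊔ span k {((xi s t w : Aˣ) : A)} ∧
      ((g⁻¹ : Aˣ) : A) * y ∈ G k r s t w ⊔ span k {((xi s t w : Aˣ) : A)} := by
    intro g hg hg' h1 y hy
    have h2 : ((g⁻¹ : Aˣ) : A) * ((xi s t w : Aˣ) : A) - (↑q⁻¹ : k) • ((xi s t w : Aˣ) : A) ∈
        G k r s t w := by
      refine sub_smul_mem_symm ?_
      simpa [mul_sub, ← mul_assoc] using mul_mem_G hg' h1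
    obtain ⟨y, hy', z, hz, rfl⟩ := mem_sup.1 hy
    obtain ⟨c, rfl⟩ := mem_span_singleton.1 hz
    rw [mul_add, mul_add, mul_smul_comm, mul_smul_comm]
    exact ⟨add_mem (mem_sup_left (mul_mem_G hg hy')) (smul_mem _ _ (mem_of_sub_smul_mem
        (mem_sup_left h1) (mem_sup_right (mem_span_singleton_self _)))),
      add_mem (mem_sup_left (mul_mem_G hg' hy')) (smul_mem _ _ (mem_of_sub_smul_mem
        (mem_sup_left h2) (mem_sup_right (mem_span_singleton_self _))))⟩
  rintro g (rfl | rfl)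
  · exact key g (mem_gen (by simp)) (inv_mem_gen (by simp)) h.mul_upsilon
  · exact key _ (mem_gen (by simp)) (inv_mem_gen (by simp)) h.mul_upsilon'

theorem U_mul_E_mul_gen_mul_upsilon (h : SkeinQuad q e e₁ e₂ r s t w) {x y z : A}
    (hx : x ∈ U k w) (hy : y ∈ E k r s t) (hz : z ∈ gen k {s, t}) :
    x * (y * z) * ((xi s t w : Aˣ) : A) ∈ B₂ k r s t w := by
  have : G k r s t w ⊔ span k {((xi s t w : Aˣ) : A)} ≤
      (B₂ k r s t w).comap (LinearMap.mulLeft k (x * y)) := by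
    refine sup_le (fun z hz => h.U_mul_gen_mul_G hx (E_le_gen hy) hz) ?_
    rw [span_singleton_le_iff_mem]
    exact h.U_mul_E_mul_upsilon hx hy
  simpa only [mem_comap, LinearMap.mulLeft_apply, mul_assoc] using this (h.gen_mul_upsilon hz)

/-- Pure braid calculation: `r` travels through ω by braid moves and emerges as `t`, which commutes
with υ. It settles left multiplication by `r` on `O`. -/
theorem mul_om (h : SkeinQuad q e e₁ e₂ r s t w) : r * om r s t w = om r s t w * t := by
  have h1 := h.right.xi_comm (k := k) (y := (t : A)) (mem_gen (by simp))
  rw [← Units.val_mul, ← Units.val_mul, Units.val_inj] at h1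
  have c : r * t⁻¹ = t⁻¹ * r := (Commute.inv_right (show Commute r t from h.left.comm)).eq
  have b := braid_conj_inv h.left.right.braid
  calc r * om r s t w = r * w * t⁻¹ * s * (t⁻¹ * r) * s⁻¹ * r * xi s t w := by
        simp only [om, mul_assoc]
    _ = w * (r * t⁻¹) * s * r * t⁻¹ * s⁻¹ * r * xi s t w := by
        rw [← c, h.comm]; simp only [mul_assoc]
    _ = w * t⁻¹ * (r * s * r) * t⁻¹ * s⁻¹ * r * xi s t w := by
        rw [c]; simp only [mul_assoc]
    _ = w * t⁻¹ * s * r * (s * t⁻¹ * s⁻¹) * r * xi s t w := by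
        rw [h.left.left.braid]; simp only [mul_assoc]
    _ = w * t⁻¹ * s * (r * t⁻¹) * s⁻¹ * (t * r) * xi s t w := by
        rw [b]; simp only [mul_assoc]
    _ = w * t⁻¹ * s * t⁻¹ * r * s⁻¹ * r * (t * xi s t w) := by
        rw [c, ← h.left.comm]; simp only [mul_assoc]
    _ = _ := by rw [h1]; simp only [om, mul_assoc]

theorem word_mem_gen : ((r * s⁻¹ * r : Aˣ) : A) ∈ gen k {r, s} := by
  simp only [Units.val_mul]
  exact mul_mem (mul_mem (mem_gen (by simp)) (inv_mem_gen (by simp))) (mem_gen (by simp))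

theorem mul_M_word_upsilon_mem_O (h : SkeinQuad q e e₁ e₂ r s t w) {m : A} (hm : m ∈ M k s t) :
    (w : A) * (m * ((r * s⁻¹ * r : Aˣ) : A)) * ((xi s t w : Aˣ) : A) ∈ O k r s t w := by
  have hN : N k s t ≤ between (O k r s t w) w
      (((r * s⁻¹ * r : Aˣ) : A) * ((xi s t w : Aˣ) : A)) := by
    intro n hn
    simpa only [mem_between, mul_assoc] using
      B₂_le_O (h.U_mul_E_mul_upsilon (mem_U w) (E_mul_mem (N_le_E hn) word_mem_gen))
  obtain ⟨c, hc⟩ := h.left.right.inv_word_kap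
  have := M_le hN (mem_of_sub_smul_mem (hN (sub_smul_mem_symm hc)) (by
    simpa only [mem_between, om, Units.val_mul, mul_assoc] using om_mem_O (k := k))) hm
  simpa only [mem_between, mul_assoc] using this

/-- Exchanging t⁻¹ s t⁻¹ for κ and sliding r s⁻¹ r past `w` makes υ the beginning of the word.
Powers of `t` on the left can then be absorbed by υ. -/
theorem om_upsilon (h : SkeinQuad q e e₁ e₂ r s t w) :
    ∃ c : kˣ, ((om r s t w : Aˣ) : A) - (c : k) • (((xi s t w : Aˣ) : A) *
      (((r * s⁻¹ * r : Aˣ) : A) * ((kap s t : Aˣ) : A)) * w) ∈ B₂ k r s t w := by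
  obtain ⟨c, hc⟩ := h.left.right.inv_word_kap
  have h1 := h.U_mul_E_mul_upsilon (mem_U w) (E_mul_mem (N_le_E (r := r) hc) word_mem_gen)
  refine ⟨c, ?_⟩
  convert h1 using 1
  have hj := h.comm_U (word_mem_gen (k := k) (r := r) (s := s)) (mem_U w)
  have e1 : ((xi s t w : Aˣ) : A) * (((r * s⁻¹ * r : Aˣ) : A) * ((kap s t : Aˣ) : A)) * w =
      w * (((kap s t : Aˣ) : A) * ((r * s⁻¹ * r : Aˣ) : A)) * ((xi s t w : Aˣ) : A) := by
    calc _ = w * ((kap s t : Aˣ) : A) * (w * ((r * s⁻¹ * r : Aˣ) : A)) * ((kap s t : Aˣ) : A) * w :=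
          by rw [xi, Units.val_mul, Units.val_mul]; simp only [mul_assoc]
      _ = _ := by rw [← hj]; simp only [xi, Units.val_mul, mul_assoc]
  rw [e1, om]
  simp only [Units.val_mul, sub_mul, mul_sub, mul_smul_comm, smul_mul_assoc, mul_assoc]

theorem U_mul_om_mem_O (h : SkeinQuad q e e₁ e₂ r s t w) {x : A} (hx : x ∈ U k t) :
    x * ((om r s t w : Aˣ) : A) ∈ O k r s t w := by
  obtain ⟨c, hc⟩ := h.om_upsilon
  have hx' : x ∈ gen k {s, t} := U_le_gen (by simp) hx
  have h1 := mul_mem_B₂ (gen_pair_le' hx') hc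
  rw [mul_sub, mul_smul_comm] at h1
  refine mem_of_sub_smul_mem (B₂_le_O h1) ?_
  have h2 : G k r s t w ⊔ span k {((xi s t w : Aˣ) : A)} ≤ (O k r s t w).comap
      (LinearMap.mulRight k (((r * s⁻¹ * r : Aˣ) : A) * ((kap s t : Aˣ) : A) * w)) := by
    refine sup_le (fun z hz => ?_) ?_
    · simpa only [mem_comap, LinearMap.mulRight_apply, mul_assoc] using B₂_le_O
        (h.G_mul_gen_mul_U hz (mul_mem (gen_pair_le word_mem_gen)
          (kap_mem_gen (s := s) (t := t) (by simp) (by simp))) (mem_U w))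
    · rw [span_singleton_le_iff_mem]
      simpa only [mem_comap, LinearMap.mulRight_apply, mul_assoc] using
        mem_of_sub_smul_mem (B₂_le_O (sub_smul_mem_symm hc)) om_mem_O
  simpa only [mem_comap, LinearMap.mulRight_apply, mul_assoc] using h2 (h.gen_mul_upsilon hx')

/-- On ω, `r` passes to the right as `t`; `s` slides past `w` and is absorbed in `M k s t`; `t` is
absorbed after rewriting ω by `om_upsilon`. -/
theorem mul_mem_O (h : SkeinQuad q e e₁ e₂ r s t w) {x y : A} (hx : x ∈ gen k {r, s, t})
    (hy : y ∈ O k r s t w) : x * y ∈ O k r s t w := by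
  have key : ∀ z : A, z ∈ gen k {r, s, t} → z * ((om r s t w : Aˣ) : A) ∈ O k r s t w →
      ∀ y ∈ O k r s t w, z * y ∈ O k r s t w := by
    intro z hz hz' y hy
    obtain ⟨y, hy', v, hv, rfl⟩ := mem_sup.1 hy
    obtain ⟨v, hv', rfl⟩ := mem_span_singleton_mul.1 hv
    rw [mul_add, ← mul_assoc]
    exact add_mem (B₂_le_O (mul_mem_B₂ hz hy')) (O_mul_mem hz' hv')
  have hs : ∀ x ∈ U k s, x * ((om r s t w : Aˣ) : A) ∈ O k r s t w := by
    intro x hx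
    have hw := h.comm_U (U_le_gen (by simp) hx) (mem_U w)
    have := h.mul_M_word_upsilon_mem_O (h.left.right.U_mul_M_left (mul_mem_mul hx
      (h.left.right.U_mul_U_mul_U (mul_mem_mul (mul_mem_mul (inv_mem_U t) (mem_U s))
      (inv_mem_U t)))))
    convert this using 1
    rw [om, Units.val_mul, Units.val_mul, ← mul_assoc, ← mul_assoc, hw]
    simp only [Units.val_mul, mul_assoc]
  refine mul_mem_of_left_stable ?_ hx hy
  rintro g (rfl | rfl | rfl) x hx
  · refine ⟨key _ (mem_gen (by simp)) ?_ x hx, key _ (inv_mem_gen (by simp)) ?_ x hx⟩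
    · rw [← Units.val_mul, h.mul_om, Units.val_mul]
      exact O_mul_mem om_mem_O (mem_gen (by simp))
    · have : g⁻¹ * om g s t w = om g s t w * t⁻¹ := by
        rw [inv_mul_eq_iff_eq_mul, ← mul_assoc, h.mul_om, mul_inv_cancel_right]
      rw [← Units.val_mul, this, Units.val_mul]
      exact O_mul_mem om_mem_O (inv_mem_gen (by simp))
  · exact ⟨key _ (mem_gen (by simp)) (hs _ (mem_U _)) x hx,
      key _ (inv_mem_gen (by simp)) (hs _ (inv_mem_U _)) x hx⟩
  · exact ⟨key _ (mem_gen (by simp)) (h.U_mul_om_mem_O (mem_U _)) x hx,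
      key _ (inv_mem_gen (by simp)) (h.U_mul_om_mem_O (inv_mem_U _)) x hx⟩

/-- Only `x = w` can produce ω; for `x = w⁻¹` the conjugate w⁻¹ κ w yields π, and the word drops to
degree two. -/
theorem U_mul_kap_word_upsilon_mem_O (h : SkeinQuad q e e₁ e₂ r s t w) {x : A} (hx : x ∈ U k w) :
    x * (((kap s t : Aˣ) : A) * ((r * s⁻¹ * r : Aˣ) : A)) * ((xi s t w : Aˣ) : A) ∈
      O k r s t w := by
  have hk : ((kap s t : Aˣ) : A) ∈ gen k {r, s, t} := kap_mem_gen (by simp) (by simp)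
  have hj : ((r * s⁻¹ * r : Aˣ) : A) ∈ gen k {r, s, t} := gen_pair_le word_mem_gen
  have hjw := h.comm_U (word_mem_gen (k := k) (r := r) (s := s)) (mem_U w)
  rw [mul_assoc]
  refine (U_le.2 ⟨?_, ?_, ?_⟩ : U k w ≤ (O k r s t w).comap (LinearMap.mulRight k _)) hx
  · rw [mem_comap, LinearMap.mulRight_apply, one_mul]
    exact B₂_le_O (mul_mem_B₂ (mul_mem hk hj) upsilon_mem_B₂)
  · simpa only [mem_comap, LinearMap.mulRight_apply, mul_assoc] using
      h.mul_M_word_upsilon_mem_O (kap_mem_M s t)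
  · have := mul_mem_B₂ (mul_mem (mem_gen (g := t) (by simp)) (mem_gen (g := s) (by simp)))
      (h.pi_mul_gen_mul_U (mem_U w) (mul_mem (mul_mem (inv_mem_gen (g := s) (by simp))
      (inv_mem_gen (g := t) (by simp))) (mul_mem hj hk)))
    rw [mem_comap, LinearMap.mulRight_apply]
    refine B₂_le_O ?_
    convert this using 1
    have b1 := h.inv_kap_mul
    calc _ = ((w⁻¹ : Aˣ) : A) * ((kap s t : Aˣ) : A) * (((r * s⁻¹ * r : Aˣ) : A) * w) *
            ((kap s t : Aˣ) : A) * w := by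
          simp only [xi, Units.val_mul, mul_assoc]
      _ = ((w⁻¹ : Aˣ) : A) * ((kap s t : Aˣ) : A) * w * ((r * s⁻¹ * r : Aˣ) : A) *
            ((kap s t : Aˣ) : A) * w := by rw [hjw]; simp only [mul_assoc]
      _ = _ := by rw [b1]; simp only [mul_assoc]

/-- For `b = s^i r^j s^l`, κ absorbs s^i and υ commutes with s^l; then the last `t` of κ passes r^j
and is absorbed by υ. Only r s⁻¹ r needs the new word. -/
theorem U_mul_kap_gen_upsilon_mem_O (h : SkeinQuad q e e₁ e₂ r s t w) {x b : A} (hx : x ∈ U k w)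
    (hb : b ∈ gen k {r, s}) :
    x * (((kap s t : Aˣ) : A) * b) * ((xi s t w : Aˣ) : A) ∈ O k r s t w := by
  have hN : N k s r ≤ between (O k r s t w) (x * ((kap s t : Aˣ) : A))
      ((xi s t w : Aˣ) : A) := by
    refine mul_mul_le.2 fun x₁ h₁ x₂ h₂ x₃ h₃ => ?_
    have h3 := h.right.xi_comm (U_le_gen (by simp) h₃)
    have hM : M k s t ≤ between (O k r s t w) x (x₂ * ((xi s t w : Aˣ) : A)) := by
      refine M_le (fun n hn => ?_) ?_
      · simpa only [mem_between, mul_assoc] using B₂_le_O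
          (h.U_mul_E_mul_upsilon hx (E_mul_mem (N_le_E hn) (U_le_gen (by simp) h₂)))
      · have hE : (t : A) * (s * s * x₂) ∈ E k r s t :=
          E_mul_mem (U_le_E (mem_U t)) (mul_mem (mul_mem (mem_gen (by simp)) (mem_gen (by simp)))
            (U_le_gen (by simp) h₂))
        have := B₂_le_O (h.U_mul_E_mul_gen_mul_upsilon hx hE (mem_gen (g := t) (by simp)))
        rw [mem_between]
        convert this using 1
        have h2 := commute_of_mem_U h.left.comm h₂
        simp only [kap, Units.val_mul, mul_assoc]
        rw [← mul_assoc (t : A) x₂, ← h2]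
        simp only [mul_assoc]
    have := O_mul_mem (mem_between.1 (hM (h.left.right.M_mul_U_left
      (mul_mem_mul (kap_mem_M s t) h₁)))) (gen_pair_le (U_le_gen (by simp) h₃))
    rw [mem_between]
    convert this using 1
    simp only [mul_assoc]
    rw [h3]
  obtain ⟨c, hc⟩ := h.left.left.symm.word_kap
  have := M_le hN (mem_of_sub_smul_mem (hN (sub_smul_mem_symm hc)) (by
    simpa only [mem_between, mul_assoc] using h.U_mul_kap_word_upsilon_mem_O hx))
    (h.left.left.symm.gen_le_M (by rwa [Set.pair_comm]))
  simpa only [mem_between, mul_assoc] using this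

theorem U_mul_gen_upsilon_mem_O (h : SkeinQuad q e e₁ e₂ r s t w) {x y : A} (hx : x ∈ U k w)
    (hy : y ∈ gen k {r, s, t}) : x * y * ((xi s t w : Aˣ) : A) ∈ O k r s t w := by
  have hX : ∀ X : A, x * X * ((xi s t w : Aˣ) : A) ∈ B₂ k r s t w →
      (gen k {r, s}).toSubmodule * span k {X} ≤
        between (O k r s t w) x ((xi s t w : Aˣ) : A) := by
    intro X hX y hy
    obtain ⟨z, hz, rfl⟩ := mem_mul_span_singleton.1 hy
    rw [mem_between, ← mul_assoc, ← h.comm_U hz hx]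
    simpa only [mul_assoc] using B₂_le_O (mul_mem_B₂ (gen_pair_le hz) hX)
  refine (sup_le ?_ (sup_le (hX _ ?_) (hX _ ?_)) :
    D k r s t ≤ between (O k r s t w) x ((xi s t w : Aˣ) : A)) (h.left.gen_le_D hy)
  · refine mul_mul_le.2 fun a ha m hm b hb => ?_
    have : M k s t ≤ between (between (O k r s t w) x ((xi s t w : Aˣ) : A)) a b := by
      refine M_le (fun n hn => ?_) ?_
      · exact B₂_le_O (h.U_mul_E_mul_upsilon hx (E_mul_mem (mul_mem_E ha (N_le_E hn)) hb))
      · rw [mem_between, mem_between, mul_assoc a, ← mul_assoc x a, ← h.comm_U ha hx]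
        simpa only [mul_assoc] using
          h.mul_mem_O (gen_pair_le ha) (h.U_mul_kap_gen_upsilon_mem_O hx hb)
    exact this (h.left.right.U_mul_U_mul_U hm)
  · have hE : (t : A) * (s * r * r) ∈ E k r s t :=
      E_mul_mem (U_le_E (mem_U t)) (mul_mem (mul_mem (mem_gen (by simp)) (mem_gen (by simp)))
        (mem_gen (by simp)))
    have := h.U_mul_E_mul_gen_mul_upsilon hx hE
      (mul_mem (mem_gen (g := s) (by simp)) (mem_gen (g := t) (by simp)))
    simpa only [xi, kap, Units.val_mul, mul_assoc] using this
  · have hE : ((t⁻¹ : Aˣ) : A) * (((s⁻¹ : Aˣ) : A) * ((r⁻¹ : Aˣ) : A) * ((r⁻¹ : Aˣ) : A)) ∈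
        E k r s t :=
      E_mul_mem (U_le_E (inv_mem_U t)) (mul_mem (mul_mem (inv_mem_gen (by simp))
        (inv_mem_gen (by simp))) (inv_mem_gen (by simp)))
    have := h.U_mul_E_mul_gen_mul_upsilon hx hE
      (mul_mem (inv_mem_gen (g := s) (by simp)) (inv_mem_gen (g := t) (by simp)))
    simpa only [xi, kap, mul_inv_rev, Units.val_mul, mul_assoc] using this

end SkeinQuad

end SkeinAlgebra

/-! ### Stability of `H` under left multiplication. -/

namespace SkeinAlgebra

open Submodule MulOpposite

variable {k A : Type*} [CommRing k] [Ring A] [Algebra k A]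

/-- The algebra generated by a skein quadruple. -/
def H (k : Type*) {A : Type*} [CommRing k] [Ring A] [Algebra k A] (r s t w : Aˣ) :
    Submodule k A :=
  O k r s t w ⊔ O k r⁻¹ s⁻¹ t⁻¹ w⁻¹

/-- The elements which multiply `U k w` and the algebra generated by `r`, `s`, `t` into
`H k r s t w`. -/
def T (k : Type*) {A : Type*} [CommRing k] [Ring A] [Algebra k A] (r s t w : Aˣ) :
    Submodule k A where
  carrier := {m | ∀ x ∈ U k w, ∀ y ∈ gen k {r, s, t}, x * y * m ∈ H k r s t w}
  add_mem' hm hn x hx y hy := by rw [mul_add]; exact add_mem (hm x hx y hy) (hn x hx y hy)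
  zero_mem' x _ y _ := by rw [mul_zero]; exact zero_mem _
  smul_mem' c m hm x hx y hy := by rw [mul_smul_comm]; exact smul_mem _ c (hm x hx y hy)

theorem mem_T {r s t w : Aˣ} {m : A} :
    m ∈ T k r s t w ↔ ∀ x ∈ U k w, ∀ y ∈ gen k {r, s, t}, x * y * m ∈ H k r s t w := Iff.rfl

theorem H_inv (r s t w : Aˣ) : H k r⁻¹ s⁻¹ t⁻¹ w⁻¹ = H k r s t w := by
  simp only [H, inv_inv, sup_comm]

theorem T_inv (r s t w : Aˣ) : T k r⁻¹ s⁻¹ t⁻¹ w⁻¹ = T k r s t w := by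
  ext m
  simp only [mem_T, U_inv, gen_triple_inv, H_inv]

section Closure

variable {r s t w : Aˣ} {x y : A}

theorem B₂_le_H : B₂ k r s t w ≤ H k r s t w := B₂_le_O.trans le_sup_left

theorem H_mul_mem (hy : y ∈ H k r s t w) (hx : x ∈ gen k {r, s, t}) : y * x ∈ H k r s t w := by
  obtain ⟨y, hy', z, hz, rfl⟩ := mem_sup.1 hy
  rw [add_mul]
  exact add_mem (mem_sup_left (O_mul_mem hy' hx))
    (mem_sup_right (O_mul_mem hz (by rwa [gen_triple_inv])))

theorem T_mul_mem (hy : y ∈ T k r s t w) (hx : x ∈ gen k {r, s, t}) : y * x ∈ T k r s t w := by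
  intro u hu v hv
  rw [← mul_assoc]
  exact H_mul_mem (hy u hu v hv) hx

theorem mul_mem_T (hx : x ∈ gen k {r, s, t}) (hy : y ∈ T k r s t w) : x * y ∈ T k r s t w := by
  intro u hu v hv
  rw [← mul_assoc, mul_assoc u]
  exact hy u hu _ (mul_mem hv hx)

end Closure

namespace SkeinQuad

variable {q e : kˣ} {e₁ e₂ : k} {r s t w : Aˣ}

theorem mul_mem_H (h : SkeinQuad q e e₁ e₂ r s t w) {x y : A} (hx : x ∈ gen k {r, s, t})
    (hy : y ∈ H k r s t w) : x * y ∈ H k r s t w := by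
  obtain ⟨y, hy', z, hz, rfl⟩ := mem_sup.1 hy
  rw [mul_add]
  exact add_mem (mem_sup_left (h.mul_mem_O hx hy'))
    (mem_sup_right (h.inv.mul_mem_O (by rwa [gen_triple_inv]) hz))

theorem G_le_T (h : SkeinQuad q e e₁ e₂ r s t w) : G k r s t w ≤ T k r s t w :=
  fun _ hm _ hx _ hy => B₂_le_H (h.U_mul_gen_mul_G hx hy hm)

theorem upsilon_mem_T (h : SkeinQuad q e e₁ e₂ r s t w) :
    ((xi s t w : Aˣ) : A) ∈ T k r s t w :=
  fun _ hx _ hy => mem_sup_left (h.U_mul_gen_upsilon_mem_O hx hy)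

/-- The word υ⁻¹ is handled by inversion, which is why `H` contains the analogue of `O` for the
inverse generators. -/
theorem D_le_T (h : SkeinQuad q e e₁ e₂ r s t w) : D k s t w ≤ T k r s t w := by
  have key : ∀ z ∈ T k r s t w, (gen k {s, t}).toSubmodule * span k {(z : A)} ≤ T k r s t w := by
    intro z hz y hy
    obtain ⟨y, hy', rfl⟩ := mem_mul_span_singleton.1 hy
    exact mul_mem_T (gen_pair_le' hy') hz
  refine sup_le (h.D₀_le_G.trans h.G_le_T) (sup_le (key _ h.upsilon_mem_T) (key _ ?_))
  have := h.inv.upsilon_mem_T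
  rwa [xi_inv, T_inv] at this

/-- The outer elements of A₃ slide past the powers of `w`, leaving a word in ⟨s, t, w⟩, to which the
four-strand normal form applies. -/
theorem U_mul_D₀_mul_U_le_T (h : SkeinQuad q e e₁ e₂ r s t w) {x y z : A} (hx : x ∈ U k w)
    (hy : y ∈ D₀ k r s t) (hz : z ∈ U k w) : x * y * z ∈ T k r s t w := by
  refine (mul_mul_le.2 fun a ha m hm b hb => ?_ : D₀ k r s t ≤ between (T k r s t w) x z) hy
  have hm' : m ∈ (gen k {s, t}).toSubmodule := by
    have : U k t * U k s * U k t ≤ (gen k {s, t}).toSubmodule := mul_mul_le.2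
      fun a ha b hb c hc => (gen k {s, t}).mul_mem ((gen k {s, t}).mul_mem (U_le_gen (by simp) ha)
        (U_le_gen (by simp) hb)) (U_le_gen (by simp) hc)
    exact this hm
  have := T_mul_mem (mul_mem_T (gen_pair_le ha) (h.D_le_T
    (h.right.U_mul_gen_mul_U (mul_mem_mul (mul_mem_mul hx hm') hz)))) (gen_pair_le hb)
  rw [mem_between]
  convert this using 1
  have ha' := h.comm_U ha hx
  have hb' := h.comm_U hb hz
  simp only [mul_assoc]
  rw [hb', ← mul_assoc x a, ← ha']
  simp only [mul_assoc]

theorem mul_xi_mul_inv_mem_T (h : SkeinQuad q e e₁ e₂ r s t w) :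
    (w : A) * ((xi r s t : Aˣ) : A) * ((w⁻¹ : Aˣ) : A) ∈ T k r s t w := by
  rw [← Units.val_mul, ← Units.val_mul, h.mul_xi_mul_inv]
  simp only [Units.val_mul]
  refine T_mul_mem (mul_mem_T (mul_mem (mul_mem ?_ ?_) ?_) h.upsilon_mem_T)
    (mul_mem (mul_mem ?_ ?_) ?_)
  all_goals first | exact inv_mem_gen (by simp) | exact mem_gen (by simp)

theorem inv_mul_xi_mul_mem_T (h : SkeinQuad q e e₁ e₂ r s t w) :
    ((w⁻¹ : Aˣ) : A) * ((xi r s t : Aˣ) : A) * w ∈ T k r s t w := by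
  rw [← Units.val_mul, ← Units.val_mul, h.inv_mul_xi_mul]
  simp only [Units.val_mul]
  refine T_mul_mem (mul_mem_T (mul_mem (mul_mem ?_ ?_) ?_) h.upsilon_mem_T)
    (mul_mem (mul_mem ?_ ?_) ?_)
  all_goals first | exact inv_mem_gen (by simp) | exact mem_gen (by simp)

/-- The word w ξ w commutes with A₄; once y has moved to its right, the adjacent powers of `w` merge
and the degree is at most two. -/
theorem mul_xi_mul_mem_T (h : SkeinQuad q e e₁ e₂ r s t w) :
    (w : A) * ((xi r s t : Aˣ) : A) * w ∈ T k r s t w := by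
  have hX := fun g (hg : (g : A) ∈ gen k {r, s}) => h.left.xi_comm hg
  have hc : ∀ g ∈ ({r, s, t} : Set Aˣ), g * (w * xi r s t * w) = w * xi r s t * w * g := by
    have key : ∀ g : Aˣ, g ∈ ({r, s} : Set Aˣ) → g * w = w * g →
        g * (w * xi r s t * w) = w * xi r s t * w * g := by
      intro g hg hw
      have := hX g (mem_gen hg)
      rw [← Units.val_mul, ← Units.val_mul, Units.val_inj] at this
      rw [← mul_assoc, ← mul_assoc, hw, mul_assoc w, this, mul_assoc _ w g, ← hw]
      simp only [mul_assoc]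
    rintro g (rfl | rfl | rfl)
    · exact key g (by simp) h.comm
    · exact key g (by simp) h.right.comm
    · have hk : kap r s * w = w * kap r s := by
        have := h.comm_U (k := k) (y := ((kap r s : Aˣ) : A))
          (kap_mem_gen (by simp) (by simp)) (mem_U w)
        rwa [← Units.val_mul, ← Units.val_mul, Units.val_inj] at this
      exact double_comm_right h.right.right.braid hk
  intro x hx y hy
  have h1 := commute_of_mem_gen hc hy
  have h2 := B₂_mul_mem (B₁_gen_U (U_le_B₁ (r := r) (s := s) (t := t)
    (h.right.right.cubic_right.mul_mem_U hx (mem_U w))) xi_mem_gen (mem_U w)) hy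
  refine B₂_le_H ?_
  convert h2 using 1
  simp only [Units.val_mul] at h1
  rw [mul_assoc x, h1]
  simp only [mul_assoc]

/-- Multiply the skein relation of `t`, `w` on the right by c t⁻¹ w, where ξ⁻¹ = t⁻¹ c t⁻¹. Two
terms become t w ξ⁻¹ w and `-q • w ξ⁻¹ w`; the others are mixed conjugates of ξ⁻¹ or come from `D₀`,
and lie in `T`. -/
theorem mul_mul_xi_inv_mul (h : SkeinQuad q e e₁ e₂ r s t w) :
    (t : A) * ((w * (xi r s t)⁻¹ * w : Aˣ) : A) - (q : k) • ((w * (xi r s t)⁻¹ * w : Aˣ) : A) ∈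
      T k r s t w := by
  set c : A := (((kap r s)⁻¹ : Aˣ) : A) with hc
  have hc' : c ∈ gen k {r, s} := kap_inv_mem_gen (by simp) (by simp)
  have d1 : c * ((t⁻¹ : Aˣ) : A) ∈ D₀ k r s t := mul_mem_D₀ hc' (U_le_D₀ r s t (inv_mem_U t))
  have d2 : (t : A) * c * ((t⁻¹ : Aˣ) : A) ∈ D₀ k r s t := h.left.mul_gen_mul_inv hc'
  have low1 := fun x (hx : x ∈ U k w) => h.U_mul_D₀_mul_U_le_T hx d1 (mem_U w)
  have low2 := fun x (hx : x ∈ U k w) => h.U_mul_D₀_mul_U_le_T hx d2 (mem_U w)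
  have mixed : ((w⁻¹ : Aˣ) : A) * (((xi r s t)⁻¹ : Aˣ) : A) * w ∈ T k r s t w := by
    have := h.inv.mul_xi_mul_inv_mem_T
    rwa [xi_inv, T_inv, inv_inv] at this
  have ht : (t : A) ∈ gen k {r, s, t} := mem_gen (by simp)
  have ht' : ((t⁻¹ : Aˣ) : A) ∈ gen k {r, s, t} := inv_mem_gen (by simp)
  have sk := congrArg (fun x => x * (c * ((t⁻¹ : Aˣ) : A) * w)) h.right.right.skein
  simp only [xi, mul_inv_rev, Units.val_mul, add_mul, sub_mul, smul_mul_assoc, ← hc] at sk mixed ⊢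
  have h1 := mul_mem_T ht' (low2 _ (mem_U w))
  have h2 := smul_mem _ (↑q⁻¹ : k) (mul_mem_T ht (low1 _ (mem_U w)))
  have h3 := smul_mem _ (q : k) (mul_mem_T ht (low1 _ (inv_mem_U w)))
  have h4 := smul_mem _ (q : k) (mul_mem_T ht' (low1 _ (mem_U w)))
  have h5 := smul_mem _ ((q : k) ^ 3) (mul_mem_T ht' (low1 _ (inv_mem_U w)))
  have h6 := smul_mem _ (↑q⁻¹ : k) (low2 _ (mem_U w))
  have h8 := smul_mem _ (q : k) (low2 _ (inv_mem_U w))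
  have h9 := smul_mem _ ((q : k) ^ 3) mixed
  have h10 := smul_mem _ ((q : k) ^ 2) (mul_mem_T ht' (low2 _ (inv_mem_U w)))
  have h11 := smul_mem _ ((q : k) ^ 2) (mul_mem_T ht mixed)
  have := add_mem (sub_mem (sub_mem (add_mem (sub_mem (add_mem (sub_mem (sub_mem (add_mem h1 h2)
    h3) h4) h5) h6) h8) h9) h10) h11
  convert this using 1
  simp only [mul_assoc] at sk ⊢
  rw [sk]
  abel

/-- The word V = w ξ⁻¹ w commutes with A₃, and `t` acts on it as `q` modulo `T`. Thus A₄ V ⊆ V A₄ +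
T, and u_w V has degree at most two because u_w w ⊆ u_w. -/
theorem mul_xi_inv_mul_mem_T (h : SkeinQuad q e e₁ e₂ r s t w) :
    ((w * (xi r s t)⁻¹ * w : Aˣ) : A) ∈ T k r s t w := by
  set V : Aˣ := w * (xi r s t)⁻¹ * w with hV
  set P := span k {(V : A)} * (gen k {r, s, t}).toSubmodule ⊔ T k r s t w with hP
  have hVP : (V : A) ∈ P := by
    refine mem_sup_left ?_
    simpa using mul_mem_mul (mem_span_singleton_self (R := k) (V : A))
      (one_mem_gen (k := k) {r, s, t})
  have hPm : ∀ y ∈ P, ∀ x ∈ gen k {r, s, t}, y * x ∈ P := by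
    intro y hy x hx
    obtain ⟨y, hy', z, hz, rfl⟩ := mem_sup.1 hy
    rw [add_mul]
    refine add_mem (mem_sup_left ?_) (mem_sup_right (T_mul_mem hz hx))
    have := mul_mem_mul hy' (show x ∈ (gen k {r, s, t}).toSubmodule from hx)
    rwa [mul_assoc, gen_mul_gen] at this
  have key : ∀ z : A, z ∈ gen k {r, s, t} → z * (V : A) ∈ P → ∀ y ∈ P, z * y ∈ P := by
    intro z hz hz' y hy
    obtain ⟨y, hy', v, hv, rfl⟩ := mem_sup.1 hy
    obtain ⟨y, hy'', rfl⟩ := mem_span_singleton_mul.1 hy'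
    rw [mul_add, ← mul_assoc]
    exact add_mem (hPm _ hz' _ hy'') (mem_sup_right (mul_mem_T hz hv))
  have hrs : ∀ z ∈ gen k {r, s}, z * (V : A) ∈ P := by
    intro z hz
    have h1 := h.left.xi_inv_comm hz
    have h2 := h.comm_U hz (mem_U w)
    have : z * (V : A) = V * z := by
      rw [hV, Units.val_mul, Units.val_mul, ← mul_assoc, ← mul_assoc, h2, mul_assoc (w : A), h1,
        mul_assoc _ (w : A) z, ← h2]
      simp only [mul_assoc]
    rw [this]
    exact hPm _ hVP _ (gen_pair_le hz)
  have ht := h.mul_mul_xi_inv_mul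
  rw [← hV] at ht
  have ht' : ((t⁻¹ : Aˣ) : A) * (V : A) - (↑q⁻¹ : k) • (V : A) ∈ T k r s t w := by
    refine sub_smul_mem_symm ?_
    simpa [mul_sub, ← mul_assoc] using mul_mem_T (inv_mem_gen (g := t) (by simp)) ht
  have stable : ∀ y ∈ gen k {r, s, t}, y * (V : A) ∈ P := by
    intro y hy
    refine mul_mem_of_left_stable ?_ hy hVP
    rintro g (rfl | rfl | rfl) x hx
    · exact ⟨key _ (mem_gen (by simp)) (hrs _ (mem_gen (by simp))) x hx,
        key _ (inv_mem_gen (by simp)) (hrs _ (inv_mem_gen (by simp))) x hx⟩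
    · exact ⟨key _ (mem_gen (by simp)) (hrs _ (mem_gen (by simp))) x hx,
        key _ (inv_mem_gen (by simp)) (hrs _ (inv_mem_gen (by simp))) x hx⟩
    · exact ⟨key _ (mem_gen (by simp)) (mem_of_sub_smul_mem (mem_sup_right ht) hVP) x hx,
        key _ (inv_mem_gen (by simp)) (mem_of_sub_smul_mem (mem_sup_right ht') hVP) x hx⟩
  intro x hx y hy
  rw [mul_assoc]
  refine (sup_le ?_ ?_ : P ≤ (H k r s t w).comap (LinearMap.mulLeft k x)) (stable y hy)
  · intro z hz
    obtain ⟨z, hz', rfl⟩ := mem_span_singleton_mul.1 hz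
    have hX : (((xi r s t)⁻¹ : Aˣ) : A) ∈ gen k {r, s, t} := by
      rw [← xi_inv, ← gen_triple_inv]
      exact xi_mem_gen
    have := B₂_mul_mem (B₁_gen_U (U_le_B₁ (r := r) (s := s) (t := t)
      (h.right.right.cubic_right.mul_mem_U hx (mem_U w))) hX (mem_U w)) hz'
    refine B₂_le_H ?_
    simpa only [hV, LinearMap.mulLeft_apply, Units.val_mul, mul_assoc] using this
  · intro z hz
    simpa using hz x hx 1 (one_mem _)

theorem U_mul_xi_mul_U_le_T (h : SkeinQuad q e e₁ e₂ r s t w) :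
    U k w * span k {((xi r s t : Aˣ) : A)} * U k w ≤ T k r s t w := by
  have key : ∀ z ∈ T k r s t w, ∀ x z' : A, x * ((xi r s t : Aˣ) : A) * z' = z → ∀ y ∈
      span k {((xi r s t : Aˣ) : A)}, x * y * z' ∈ T k r s t w := by
    rintro _ hz x z' rfl y hy
    obtain ⟨c, rfl⟩ := mem_span_singleton.1 hy
    rw [mul_smul_comm, smul_mul_assoc]
    exact smul_mem _ _ hz
  have low : ∀ z ∈ B₁ k r s t w, z ∈ T k r s t w := fun z hz => h.G_le_T (B₁_le_G hz)
  have hX : ((xi r s t : Aˣ) : A) ∈ gen k {r, s, t} := xi_mem_gen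
  have right : ∀ z ∈ U k w, ∀ y ∈ span k {((xi r s t : Aˣ) : A)}, y * z ∈ T k r s t w :=
    fun z hz y hy => by
      simpa using key _ (low _ (mul_mem_B₁ hX (U_le_B₁ hz))) 1 z (by simp) y hy
  have left : ∀ z ∈ U k w, ∀ y ∈ span k {((xi r s t : Aˣ) : A)}, z * y ∈ T k r s t w :=
    fun z hz y hy => by
      simpa using key _ (low _ (B₁_mul_mem (U_le_B₁ hz) hX)) z 1 (by simp) y hy
  refine U_mul_mul_U_le (fun y hy => by simpa using right 1 (one_mem_U w) y hy)
    (right _ (mem_U w)) (right _ (inv_mem_U w)) (left _ (mem_U w)) (left _ (inv_mem_U w))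
    (key _ h.mul_xi_mul_mem_T _ _ rfl) (key _ h.mul_xi_mul_inv_mem_T _ _ rfl)
    (key _ h.inv_mul_xi_mul_mem_T _ _ rfl) (key _ ?_ _ _ rfl)
  have := h.inv.mul_xi_inv_mul_mem_T
  rw [T_inv, xi_inv, inv_inv] at this
  simpa only [Units.val_mul] using this

theorem U_mul_gen_mul_U_le_T (h : SkeinQuad q e e₁ e₂ r s t w) {x y z : A} (hx : x ∈ U k w)
    (hy : y ∈ gen k {r, s, t}) (hz : z ∈ U k w) : x * y * z ∈ T k r s t w := by
  have key : ∀ X : A, x * X * z ∈ T k r s t w →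
      (gen k {r, s}).toSubmodule * span k {X} ≤ between (T k r s t w) x z := by
    intro X hX y hy
    obtain ⟨v, hv, rfl⟩ := mem_mul_span_singleton.1 hy
    rw [mem_between, ← mul_assoc, ← h.comm_U hv hx]
    simpa only [mul_assoc] using mul_mem_T (gen_pair_le hv) hX
  refine (sup_le (fun y hy => h.U_mul_D₀_mul_U_le_T hx hy hz) (sup_le (key _ ?_) (key _ ?_)) :
    D k r s t ≤ between (T k r s t w) x z) (h.left.gen_le_D hy)
  · exact h.U_mul_xi_mul_U_le_T (mul_mem_mul (mul_mem_mul hx (mem_span_singleton_self _)) hz)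
  · have := h.inv.U_mul_xi_mul_U_le_T
    rw [T_inv, xi_inv, U_inv] at this
    exact this (mul_mem_mul (mul_mem_mul hx (mem_span_singleton_self _)) hz)

/-- On `B₂` the last two factors u_w, with the element between them, form an element of `T`. On ω
the new factor merges with its initial `w`, leaving u_w A₄ υ. -/
theorem U_mul_mem_H (h : SkeinQuad q e e₁ e₂ r s t w) {x y : A} (hx : x ∈ U k w)
    (hy : y ∈ H k r s t w) : x * y ∈ H k r s t w := by
  have key : ∀ {q e : kˣ} {e₁ e₂ : k} {r s t w : Aˣ}, SkeinQuad q e e₁ e₂ r s t w →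
      ∀ x ∈ U k w, O k r s t w ≤ (H k r s t w).comap (LinearMap.mulLeft k x) := by
    intro q e e₁ e₂ r s t w h x hx
    refine sup_le (mul_mul_le.2 fun b hb v hv c hc => ?_) ?_
    · have : B₁ k r s t w ≤ between (H k r s t w) x (v * c) := by
        refine mul_mul_le.2 fun a ha u hu d hd => ?_
        have := H_mul_mem (h.U_mul_gen_mul_U_le_T hu hd hv x hx a ha) hc
        simpa only [mem_between, mul_assoc] using this
      simpa only [mem_between, mem_comap, LinearMap.mulLeft_apply, mul_assoc] using this hb
    · intro y hy
      obtain ⟨y, hy', rfl⟩ := mem_span_singleton_mul.1 hy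
      have hm : ((t⁻¹ * s * t⁻¹ * (r * s⁻¹ * r) : Aˣ) : A) ∈ gen k {r, s, t} := by
        rw [Units.val_mul]
        refine mul_mem ?_ (gen_pair_le word_mem_gen)
        simp only [Units.val_mul]
        exact mul_mem (mul_mem (inv_mem_gen (by simp)) (mem_gen (by simp))) (inv_mem_gen (by simp))
      have := O_mul_mem (h.U_mul_gen_upsilon_mem_O
        (h.right.right.cubic_right.mul_mem_U hx (mem_U w)) hm) hy'
      refine mem_sup_left ?_
      simpa only [om, LinearMap.mulLeft_apply, Units.val_mul, mul_assoc] using this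
  refine (sup_le (key h x hx) ?_ : H k r s t w ≤ (H k r s t w).comap (LinearMap.mulLeft k x)) hy
  have := key h.inv x (by rwa [U_inv])
  rwa [H_inv] at this

theorem gen_le_H (h : SkeinQuad q e e₁ e₂ r s t w) :
    (gen k {r, s, t, w}).toSubmodule ≤ H k r s t w := by
  intro y hy
  have h1 : (1 : A) ∈ H k r s t w := B₂_le_H (B₁_le_B₂ (gen_le_B₁ (one_mem_gen _)))
  rw [← mul_one y]
  refine mul_mem_of_left_stable ?_ hy h1
  rintro g (rfl | rfl | rfl | rfl) x hx
  · exact ⟨h.mul_mem_H (mem_gen (by simp)) hx, h.mul_mem_H (inv_mem_gen (by simp)) hx⟩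
  · exact ⟨h.mul_mem_H (mem_gen (by simp)) hx, h.mul_mem_H (inv_mem_gen (by simp)) hx⟩
  · exact ⟨h.mul_mem_H (mem_gen (by simp)) hx, h.mul_mem_H (inv_mem_gen (by simp)) hx⟩
  · exact ⟨h.U_mul_mem_H (mem_U _) hx, h.U_mul_mem_H (inv_mem_U _) hx⟩

theorem O_le (r s t w : Aˣ) :
    O k r s t w ≤ B₂ k r s t w * U k w * (gen k {r, s, t}).toSubmodule := by
  refine sup_le (fun y hy => ?_) (fun y hy => ?_)
  · simpa using mul_mem_mul (mul_mem_mul hy (one_mem_U w)) (one_mem_gen (k := k) {r, s, t})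
  · obtain ⟨y, hy', rfl⟩ := mem_span_singleton_mul.1 hy
    refine mul_mem_mul ?_ hy'
    have hm : ((t⁻¹ * s * t⁻¹ * (r * s⁻¹ * r) : Aˣ) : A) ∈ gen k {r, s, t} := by
      rw [Units.val_mul]
      refine mul_mem ?_ (gen_pair_le word_mem_gen)
      simp only [Units.val_mul]
      exact mul_mem (mul_mem (inv_mem_gen (by simp)) (mem_gen (by simp))) (inv_mem_gen (by simp))
    have := mul_mem_mul (B₂_mul_mem (B₁_gen_U (U_le_B₁ (mem_U w)) hm (mem_U w))
      (kap_mem_gen (s := s) (t := t) (by simp) (by simp))) (mem_U (k := k) w)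
    simpa only [om, xi, Units.val_mul, mul_assoc] using this

theorem gen_le (h : SkeinQuad q e e₁ e₂ r s t w) : (gen k {r, s, t, w}).toSubmodule ≤
    B₂ k r s t w * U k w * (gen k {r, s, t}).toSubmodule := by
  refine h.gen_le_H.trans (sup_le (O_le r s t w) ?_)
  have := O_le (k := k) r⁻¹ s⁻¹ t⁻¹ w⁻¹
  rwa [B₂_inv, U_inv, gen_triple_inv] at this

end SkeinQuad

end SkeinAlgebra

/-! ### Finite generation, and transport of the skein relation along the strands. -/

namespace SkeinAlgebra

open Submodule

variable {k A : Type*} [CommRing k] [Ring A] [Algebra k A]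

theorem U_fg (s : Aˣ) : (U k s).FG := fg_span (by simp)

theorem cubic_of_mul_eq_zero {x : Aˣ} {α β γ : kˣ}
    (h : ((x : A) - algebraMap k A α) * (x - algebraMap k A β) * (x - algebraMap k A γ) = 0) :
    Cubic (α * β * γ) (α + β + γ : k) (α * β + α * γ + β * γ : k) x := by
  have h1 := congrArg (· * ((x⁻¹ : Aˣ) : A)) h
  simp only [Algebra.algebraMap_eq_smul_one, sub_mul, mul_sub, smul_mul_assoc, mul_smul_comm,
    one_mul, mul_one, zero_mul, mul_assoc, Units.mul_inv, smul_sub, smul_smul] at h1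
  rw [Cubic, ← sub_eq_zero, ← h1, Units.val_mul, Units.val_mul, Units.val_mul]
  module

theorem Cubic.U_le_span {e : kˣ} {e₁ e₂ : k} {s : Aˣ} (h : Cubic e e₁ e₂ s) :
    U k s ≤ span k {1, (s : A), (s : A) ^ 2} := by
  have h1 : (1 : A) ∈ span k {1, (s : A), (s : A) ^ 2} := subset_span (by simp)
  have h2 : (s : A) ∈ span k {1, (s : A), (s : A) ^ 2} := subset_span (by simp)
  have h3 : ((s * s : Aˣ) : A) ∈ span k {1, (s : A), (s : A) ^ 2} :=
    subset_span (by simp [pow_two])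
  refine U_le.2 ⟨h1, h2, ?_⟩
  rw [h] at h3
  have h4 := smul_mem _ (↑e⁻¹ : k) (sub_mem h3 (sub_mem (smul_mem _ e₁ h2) (smul_mem _ e₂ h1)))
  rwa [add_sub_cancel_left, smul_smul, Units.inv_mul, one_smul] at h4

namespace SkeinPair

variable {q e : kˣ} {e₁ e₂ : k} {r s t : Aˣ}

theorem gen_eq_M (h : SkeinPair q e e₁ e₂ s t) : (gen k {s, t}).toSubmodule = M k s t := by
  refine le_antisymm h.gen_le_M (M_le (mul_mul_le.2 fun x hx y hy z hz => ?_) ?_)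
  · exact (gen k {s, t}).mul_mem ((gen k {s, t}).mul_mem (U_le_gen (by simp) hx)
      (U_le_gen (by simp) hy)) (U_le_gen (by simp) hz)
  · exact kap_mem_gen (by simp) (by simp)

theorem gen_fg (h : SkeinPair q e e₁ e₂ s t) : (gen k {s, t}).toSubmodule.FG := by
  rw [h.gen_eq_M]
  exact (((U_fg s).mul (U_fg t)).mul (U_fg s)).sup (fg_span_singleton _)

/-- Conjugation by `r * s * t` sends `r` to `s` and `s` to `t`; hence a skein relation for the first
two generators suffices. -/
theorem shift (h : SkeinPair q e e₁ e₂ r s) (b : s * t * s = t * s * t) (c : r * t = t * r) :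
    SkeinPair q e e₁ e₂ s t := by
  have h1 : r * s * t * r * (r * s * t)⁻¹ = s := by
    rw [mul_inv_eq_iff_eq_mul, mul_assoc _ t r, ← c, ← mul_assoc, h.braid]
    simp only [mul_assoc]
  have h2 : r * s * t * s * (r * s * t)⁻¹ = t := by
    rw [mul_inv_eq_iff_eq_mul, mul_assoc r, mul_assoc r, b, ← mul_assoc, ← mul_assoc, c]
    simp only [mul_assoc]
  simpa only [h1, h2] using h.conj (r * s * t)

end SkeinPair

theorem SkeinTriple.gen_fg {q e : kˣ} {e₁ e₂ : k} {r s t : Aˣ}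
    (h : SkeinTriple q e e₁ e₂ r s t) : (gen k {r, s, t}).toSubmodule.FG := by
  have h1 := h.left.gen_fg
  have hD : (D k r s t).FG :=
    ((h1.mul (((U_fg t).mul (U_fg s)).mul (U_fg t))).mul h1).sup
      ((h1.mul (fg_span_singleton _)).sup (h1.mul (fg_span_singleton _)))
  have key : ∀ z ∈ gen k {r, s, t},
      (gen k {r, s}).toSubmodule * span k {z} ≤ (gen k {r, s, t}).toSubmodule := by
    intro z hz y hy
    obtain ⟨y, hy', rfl⟩ := mem_mul_span_singleton.1 hy
    exact (gen k {r, s, t}).mul_mem (gen_pair_le hy') hz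
  have hX : ((xi r s t : Aˣ) : A) ∈ gen k {r, s, t} := SkeinQuad.xi_mem_gen
  have hX' : (((xi r s t)⁻¹ : Aˣ) : A) ∈ gen k {r, s, t} := by
    rw [← xi_inv, ← gen_triple_inv]
    exact SkeinQuad.xi_mem_gen
  rw [le_antisymm h.gen_le_D (sup_le ?_ (sup_le (key _ hX) (key _ hX')))]
  · exact hD
  refine mul_mul_le.2 fun x hx y hy z hz => ?_
  have : U k t * U k s * U k t ≤ (gen k {r, s, t}).toSubmodule := mul_mul_le.2
    fun a ha b hb c hc => (gen k {r, s, t}).mul_mem ((gen k {r, s, t}).mul_mem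
      (U_le_gen (by simp) ha) (U_le_gen (by simp) hb)) (U_le_gen (by simp) hc)
  exact (gen k {r, s, t}).mul_mem ((gen k {r, s, t}).mul_mem (gen_pair_le hx) (this hy))
    (gen_pair_le hz)

end SkeinAlgebra

/-! ### Application to the quotients `Q n`. -/

namespace CubicQuotient

open SkeinAlgebra

theorem artin_braid {n : ℕ} (i j : Index n) (h : i.1 + 1 = j.1) :
    artin i * artin j * artin i = artin j * artin i * artin j := by
  rw [← mul_inv_eq_one]
  simpa [artin, PresentedGroup.of] using
    PresentedGroup.one_of_mem (rels := {r | ArtinRel n r}) (ArtinRel.braid i j h)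

theorem artin_comm {n : ℕ} (i j : Index n) (h : i.1 + 2 ≤ j.1) :
    artin i * artin j = artin j * artin i := by
  rw [← mul_inv_eq_one]
  simpa [artin, PresentedGroup.of] using
    PresentedGroup.one_of_mem (rels := {r | ArtinRel n r}) (ArtinRel.comm i j h)

/-- The image of a braid in the group of units of `Q n`. -/
noncomputable def unit (n : ℕ) : BraidGroup n →* (Q n)ˣ :=
  (Units.map ((toQ n : BraidAlgebra n →ₐ[R] Q n) : BraidAlgebra n →* Q n)).comp
    (MonoidAlgebra.of R (BraidGroup n)).toHomUnits

theorem val_unit {n : ℕ} (g : BraidGroup n) : ((unit n g : (Q n)ˣ) : Q n) = toQ n (br g) := rfl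

theorem cubic_unit {n : ℕ} (i : Index n) :
    Cubic (A := Q n) (a * b * c) (a + b + c : R) (a * b + a * c + b * c : R)
      (unit n (artin i)) := by
  apply cubic_of_mul_eq_zero
  have := RingQuot.mkAlgHom_rel R (QRel.cubic i)
  simp only [map_mul, map_sub, map_zero, AlgHom.commutes] at this
  exact this

theorem skeinPair {n : ℕ} (hn : 3 ≤ n) :
    SkeinPair (A := Q n) a (a * b * c) (a + b + c : R) (a * b + a * c + b * c : R)
      (unit n (artin ⟨1, by omega⟩)) (unit n (artin ⟨2, by omega⟩)) := by
  refine ⟨?_, cubic_unit _, cubic_unit _, ?_⟩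
  · simp only [← map_mul]
    rw [artin_braid _ _ rfl]
  · have := RingQuot.mkAlgHom_rel R (QRel.skein (n := n) (artin ⟨1, by omega⟩)
      (artin ⟨2, by omega⟩) ⟨_, rfl⟩ ⟨_, rfl⟩)
    simp only [map_sub, map_add, map_smul] at this
    simp only [← map_inv, ← map_mul, val_unit]
    exact this

theorem skeinQuad : SkeinQuad (A := Q 5) a (a * b * c) (a + b + c : R)
    (a * b + a * c + b * c : R)
    (unit 5 (artin ⟨1, by norm_num⟩)) (unit 5 (artin ⟨2, by norm_num⟩))
    (unit 5 (artin ⟨3, by norm_num⟩)) (unit 5 (artin ⟨4, by norm_num⟩)) := by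
  have br : ∀ i j : Index 5, i.1 + 1 = j.1 → unit 5 (artin i) * unit 5 (artin j) *
      unit 5 (artin i) = unit 5 (artin j) * unit 5 (artin i) * unit 5 (artin j) := by
    intro i j h
    simp only [← map_mul, artin_braid i j h]
  have co : ∀ i j : Index 5, i.1 + 2 ≤ j.1 → unit 5 (artin i) * unit 5 (artin j) =
      unit 5 (artin j) * unit 5 (artin i) := by
    intro i j h
    simp only [← map_mul, artin_comm i j h]
  have h1 := skeinPair (n := 5) (by norm_num)
  have h2 := h1.shift (br _ ⟨3, by norm_num⟩ rfl) (co _ _ (by norm_num))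
  have h3 := h2.shift (br _ ⟨4, by norm_num⟩ rfl) (co _ _ (by norm_num))
  exact ⟨⟨h1, h2, co _ _ (by norm_num)⟩, ⟨h2, h3, co _ _ (by norm_num)⟩, co _ _ (by norm_num)⟩

theorem gen_range (n : ℕ) :
    gen (A := Q n) R (Set.range fun i : Index n => unit n (artin i)) = ⊤ := by
  have hg : ∀ g : BraidGroup n,
      unit n g ∈ Subgroup.closure (Set.range fun i : Index n => unit n (artin i)) := by
    intro g
    have : Subgroup.closure (Set.range (PresentedGroup.of (rels := {r | ArtinRel n r}))) ≤
        (Subgroup.closure (Set.range fun i : Index n => unit n (artin i))).comap (unit n) := by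
      rw [Subgroup.closure_le]
      rintro _ ⟨i, rfl⟩
      exact Subgroup.subset_closure ⟨i, rfl⟩
    rw [PresentedGroup.closure_range_of] at this
    exact this (Subgroup.mem_top g)
  rw [eq_top_iff]
  rintro x -
  obtain ⟨x, rfl⟩ := RingQuot.mkAlgHom_surjective R (QRel n) x
  induction x using MonoidAlgebra.induction_on with
  | of g => exact closure_le_gen (A := Q n) (k := R) (hg g)
  | add x y hx hy => rw [map_add]; exact add_mem hx hy
  | smul c x hx => rw [map_smul]; exact Subalgebra.smul_mem _ hx c

theorem range_unit : Set.range (fun i : Index 5 => unit 5 (artin i)) =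
    {unit 5 (artin ⟨1, by norm_num⟩), unit 5 (artin ⟨2, by norm_num⟩),
      unit 5 (artin ⟨3, by norm_num⟩), unit 5 (artin ⟨4, by norm_num⟩)} := by
  ext x
  simp only [Set.mem_range, Set.mem_insert_iff, Set.mem_singleton_iff]
  constructor
  · rintro ⟨⟨i, h1, h2⟩, rfl⟩
    interval_cases i <;> simp
  · rintro (rfl | rfl | rfl | rfl) <;> exact ⟨_, rfl⟩

theorem gen_le_sub {n : ℕ} {S : Set (Q (n + 1))ˣ}
    (h : ∀ g ∈ S, ∃ i : Index n, g = unit (n + 1) (artin ⟨i.1, i.2.1, Nat.lt_succ_of_lt i.2.2⟩)) :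
    (gen (A := Q (n + 1)) R S).toSubmodule ≤ sub n := by
  have : gen (A := Q (n + 1)) R S ≤ (incl n).range := by
    refine Algebra.adjoin_le ?_
    rintro x ⟨g, hg, hx⟩
    obtain ⟨i, rfl⟩ := h g hg
    have hi : unit (n + 1) (artin ⟨i.1, i.2.1, Nat.lt_succ_of_lt i.2.2⟩) =
        Units.map ((incl n : Q n →ₐ[R] Q (n + 1)) : Q n →* Q (n + 1)) (unit n (artin i)) :=
      Units.ext (incl_s i).symm
    rw [hi] at hx
    obtain rfl | rfl := hx
    exacts [⟨_, rfl⟩, ⟨((unit n (artin i))⁻¹ : (Q n)ˣ), rfl⟩]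
  exact this

theorem U_le_u {n : ℕ} (i : Index n) : U (A := Q n) R (unit n (artin i)) ≤ u i :=
  (cubic_unit i).U_le_span

end CubicQuotient

theorem mainTheorem3 :
    Module.Finite CubicQuotient.R (CubicQuotient.Q 5) ∧
    (⊤ : Submodule CubicQuotient.R (CubicQuotient.Q 5)) =
      CubicQuotient.filt 4 (by norm_num) 3 ∧
    CubicQuotient.filt 4 (by norm_num) 3 =
      CubicQuotient.sub 4 * CubicQuotient.u ⟨4, by norm_num⟩ *
      CubicQuotient.sub 4 * CubicQuotient.u ⟨4, by norm_num⟩ *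
      CubicQuotient.sub 4 * CubicQuotient.u ⟨4, by norm_num⟩ *
      CubicQuotient.sub 4 := by
  have h := CubicQuotient.skeinQuad
  have top := h.gen_le
  rw [← CubicQuotient.range_unit, CubicQuotient.gen_range, Algebra.top_toSubmodule] at top
  refine ⟨⟨?_⟩, ?_, rfl⟩
  · have hA := h.left.gen_fg
    have hU := SkeinAlgebra.U_fg (k := CubicQuotient.R) (A := CubicQuotient.Q 5)
      (CubicQuotient.unit 5 (CubicQuotient.artin ⟨4, by norm_num⟩))
    rw [← top_le_iff.1 top]
    -- The whole algebra is a product of seven finitely generated submodules.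
    exact (((((hA.mul hU).mul hA).mul hU).mul hA).mul hU).mul hA
  · refine le_antisymm (top.trans ?_) le_top
    have hA := CubicQuotient.gen_le_sub (n := 4) (S := {
      CubicQuotient.unit 5 (CubicQuotient.artin ⟨1, by norm_num⟩),
      CubicQuotient.unit 5 (CubicQuotient.artin ⟨2, by norm_num⟩),
      CubicQuotient.unit 5 (CubicQuotient.artin ⟨3, by norm_num⟩)}) (by
        rintro g (rfl | rfl | rfl)
        exacts [⟨⟨1, by norm_num⟩, rfl⟩, ⟨⟨2, by norm_num⟩, rfl⟩, ⟨⟨3, by norm_num⟩, rfl⟩])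
    have hU := CubicQuotient.U_le_u (n := 5) ⟨4, by norm_num⟩
    have h1 := mul_le_mul' (mul_le_mul' hA hU) hA
    have h2 := mul_le_mul' (mul_le_mul' h1 hU) hA
    exact mul_le_mul' (mul_le_mul' h2 hU) hA
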